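/- Let $d\ge 1$, $r>0$, and let $\mathbb X\subset[0,r]^d\subset\mathbb R^d$ be nonempty, convex and compact. Let $k$ be a stationary kernel on $\mathbb X$ with $k(x,x')\le 1$ for all $x,x'\in\mathbb X$, let $\varepsilon\in[0,1]$ and $\sigma_n>0$. Let $g_1,g_2,\dots$ be i.i.d. samples of the centred Gaussian process $\mathcal{GP}(0,k)$ on $\mathbb X$, put $f_1=g_1$ and $f_t=\sqrt{1-\varepsilon}\,f_{t-1}+\sqrt{\varepsilon}\,g_t$ for $t\ge2$, and let $w_1,w_2,\dots$ be i.i.d. $\mathcal N(0,\sigma_n^2)$, independent of $(g_t)$. Let $a_0,a_1\ge0$ and $b_0,b_1>0$ be such that the sample paths of $g\sim\mathcal{GP}(0,k)$ are almost surely differentiable on $\mathbb X$ and, for all $L\ge1$ and $j=1,\dots,d$, $$\mathbb P\{\sup_{x\in\mathbb X}|g(x)|>L\}\le a_0e^{-(L/b_0)^2},\qquad \mathbb P\{\sup_{x\in\mathbb X}|\partial g/\partial x_j(x)|>L\}\le a_1e^{-(L/b_1)^2}.$$ Let $\delta,\delta_{\mathrm B}\in(0,1)$ with $\delta_{\mathrm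 B}\ge\delta/5$, let $\pi_t=\pi^2t^2/6$ and $$\beta_t=2\ln\frac{5\pi^2t^2}{3\delta}+2d\ln\Big(t^2\,d\,b_1\,r\sqrt{\ln\frac{5da_1\pi^2t^2}{3\delta}}\Big),$$ where $d\,b_1\,r\sqrt{\ln(5da_1\pi^2/(3\delta))}\ge1$ (so that the second summand is nonnegative for all $t\ge1$). For a finite dataset $\mathcal D=\{(x_i,y_i)\}_{i=1}^n$ let $K=[k(x_i,x_j)]_{i,j}$, $\mathbf k(x)=[k(x_i,x)]_i$, $\mathbf y=[y_i]_i$, and $$\mu_{\mathcal D}(x)=\mathbf k(x)^T(K+\sigma_n^2I)^{-1}\mathbf y,\qquad \sigma_{\mathcal D}^2(x)=k(x,x)-\mathbf k(x)^T(K+\sigma_n^2I)^{-1}\mathbf k(x).$$ The algorithm ET-GP-UCB starts from $\mathcal D_1=\emptyset$. At each time $t=1,2,\dots$ it queries $x_t\in\arg\max_{x\in\mathbb X}\mu_{\mathcal D_t}(x)+\sqrt{\beta_t}\,\sigma_{\mathcal D_t}(x)$ (ties being broken by a fixed measurable rule depending only on $t$ and $\mathcal D_t$) and observes $y_t=f_t(x_t)+w_t$.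 With $t'$ the time since the previous reset ($t'=t$ if there was none), the event-trigger is activated at time $t$ if $$|y_t-\mu_{\mathcal D_t}(x_t)|>\sqrt{2\ln\frac{2\pi_{t'}}{\delta_{\mathrm B}}}\;\sigma_{\mathcal D_t}(x_t)+\sqrt{2\sigma_n^2\ln\frac{2\pi_{t'}}{\delta_{\mathrm B}}}.$$ If it is activated, the dataset is reset to $\mathcal D_{t+1}=\{(x_t,y_t)\}$; otherwise $\mathcal D_{t+1}=\mathcal D_t\cup\{(x_t,y_t)\}$. Let $\tau$ be the first time at which the event-trigger is activated, assume $\mathbb E[\tau]<\infty$, and set $\bar\tau=\mathbb E[\tau]/\delta$. Let $\gamma_{\bar\tau}$ be the maximum of $\tfrac12\ln\det(I+\sigma_n^{-2}[k(x_i,x_j)]_{i,j=1}^M)$ over $x_1,\dots,x_M\in\mathbb X$ with $M=\lfloor\bar\tau\rfloor$. Then for every $T\ge1$ the regret $R_T=\sum_{t=1}^T\big(\max_{x\in\mathbb X}f_t(x)-f_t(x_t)\big)$ satisfies, with probability at least $1-\delta$, $$R_T\le\sqrt{C_1T\beta_T\Big(\frac T{\bar\tau}+1\Big)\gamma_{\bar\tau}}+2+T\,\phi_T(\varepsilon,\delta,\bar\tau),\qquad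 C_1=\frac{72}{\ln(1+\sigma_n^{-2})},$$ where $$\phi_T(\varepsilon,\delta,\bar\tau)=3\sqrt{\beta_T(3\sigma_n^{-2}+\sigma_n^{-4})\bar\tau^3\varepsilon}+(\sigma_n^{-2}+\sigma_n^{-4})\bar\tau^3\varepsilon\Big(b_0\sqrt{\ln\frac{5a_0\pi^2T^2}{2\delta}}+\bar w_{\bar\tau}\Big),\qquad \bar w_{\bar\tau}=\sqrt{2\sigma_n^2\ln\frac{5\pi^2\bar\tau^2}{6\delta}},$$ and $\sqrt{\ln(5a_0\pi^2T^2/(2\delta))}$ is read as $0$ if the logarithm is negative (or $a_0=0$). -/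

import Mathlib

open MeasureTheory ProbabilityTheory
open scoped ENNReal

noncomputable section

namespace ETGPUCB

/-- `ℝ^d` with its Euclidean structure. -/
abbrev Pt (d : ℕ) := EuclideanSpace ℝ (Fin d)

/-- A dataset: a finite list of pairs (query location, measurement). -/
abbrev Dataset (d : ℕ) := List (Pt d × ℝ)

/-! ### Gaussian process regression with the time-invariant model -/

/-- The Gram matrix `[k(x_i, x_j)]` of a finite family of points. -/
def gram {d : ℕ} {ι : Type} (k : Pt d → Pt d → ℝ) (p : ι → Pt d) : Matrix ι ι ℝ :=
  Matrix.of fun i j => k (p i) (p j)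

/-- The regularised Gram matrix `K + σ² I` of a dataset. -/
def regGram {d : ℕ} (k : Pt d → Pt d → ℝ) (σ : ℝ) (D : Dataset d) :
    Matrix (Fin D.length) (Fin D.length) ℝ :=
  gram k (fun i => (D.get i).1) + σ ^ 2 • (1 : Matrix (Fin D.length) (Fin D.length) ℝ)

/-- The vector `[k(x_i, x)]` of a dataset at the point `x`. -/
def kvec {d : ℕ} (k : Pt d → Pt d → ℝ) (D : Dataset d) (x : Pt d) : Fin D.length → ℝ :=
  fun i => k (D.get i).1 x

/-- The vector of measurements of a dataset. -/
def yvec {d : ℕ} (D : Dataset d) : Fin D.length → ℝ := fun i => (D.get i).2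

/-- Posterior mean `k(x)ᵀ (K + σ² I)⁻¹ y`. -/
def postMean {d : ℕ} (k : Pt d → Pt d → ℝ) (σ : ℝ) (D : Dataset d) (x : Pt d) : ℝ :=
  dotProduct (kvec k D x) (Matrix.mulVec (regGram k σ D)⁻¹ (yvec D))

/-- Posterior standard deviation, the square root of `k(x,x) - k(x)ᵀ (K + σ² I)⁻¹ k(x)`. -/
def postStd {d : ℕ} (k : Pt d → Pt d → ℝ) (σ : ℝ) (D : Dataset d) (x : Pt d) : ℝ :=
  Real.sqrt (k x x - dotProduct (kvec k D x) (Matrix.mulVec (regGram k σ D)⁻¹ (kvec k D x)))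

/-- Information gain `(1/2) ln det (I + σ⁻² K)` of a finite family of points. -/
def infoGain {d : ℕ} {ι : Type} [Fintype ι] [DecidableEq ι] (k : Pt d → Pt d → ℝ) (σ : ℝ)
    (p : ι → Pt d) : ℝ :=
  (1 / 2) * Real.log (1 + (σ ^ 2)⁻¹ • gram k p).det

/-- Maximum information gain `γ_M` over families of `M` points of `X`. -/
def maxInfoGain {d : ℕ} (X : Set (Pt d)) (k : Pt d → Pt d → ℝ) (σ : ℝ) (M : ℕ) : ℝ :=
  ⨆ p : Fin M → X, infoGain k σ (fun i => (p i : Pt d))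

/-! ### The event-trigger and the algorithm -/

/-- The numbers `π_t = π² t² / 6`, whose reciprocals sum to one over `t ≥ 1`. -/
def piSeq (t : ℕ) : ℝ := Real.pi ^ 2 * (t : ℝ) ^ 2 / 6

/-- `ρ_{t'} = 2 ln (2 π_{t'} / δ_B)`. -/
def rho (δB : ℝ) (t' : ℕ) : ℝ := 2 * Real.log (2 * piSeq t' / δB)

/-- The noise bound `√(2 σ² ln (2 π_{t'} / δ_B))` in the threshold of the event-trigger. -/
def wbar (σ δB : ℝ) (t' : ℕ) : ℝ := Real.sqrt (2 * σ ^ 2 * Real.log (2 * piSeq t' / δB))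

/-- The event-trigger, at `t'` steps since the previous reset, for the current dataset `D` and
the latest query location and measurement `(x, y)`. -/
def Trigger {d : ℕ} (k : Pt d → Pt d → ℝ) (σ δB : ℝ) (t' : ℕ) (D : Dataset d)
    (x : Pt d) (y : ℝ) : Prop :=
  Real.sqrt (rho δB t') * postStd k σ D x + wbar σ δB t' < |y - postMean k σ D x|

/-- The exploration weight `β_t`. -/
def beta (d : ℕ) (a₁ b₁ r δ : ℝ) (t : ℕ) : ℝ :=
  2 * Real.log (5 * Real.pi ^ 2 * (t : ℝ) ^ 2 / (3 * δ))
    + 2 * d * Real.log ((t : ℝ) ^ 2 * d * b₁ * r *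
        Real.sqrt (Real.log (5 * d * a₁ * Real.pi ^ 2 * (t : ℝ) ^ 2 / (3 * δ))))

/-- The UCB acquisition function `μ_D + √β σ_D`. -/
def ucb {d : ℕ} (k : Pt d → Pt d → ℝ) (σ β : ℝ) (D : Dataset d) (x : Pt d) : ℝ :=
  postMean k σ D x + Real.sqrt β * postStd k σ D x

/-- A rule that picks, from the time step and the current dataset alone, a maximizer over `X` of
the UCB acquisition function with weights `β`, as a measurable function of the data. -/
structure IsArgmaxRule {d : ℕ} (X : Set (Pt d)) (k : Pt d → Pt d → ℝ) (σ : ℝ) (β : ℕ → ℝ)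
    (sel : ℕ → Dataset d → Pt d) : Prop where
  mem : ∀ t, 1 ≤ t → ∀ D : Dataset d, (∀ p ∈ D, p.1 ∈ X) → sel t D ∈ X
  isMaxOn : ∀ t, 1 ≤ t → ∀ D : Dataset d, (∀ p ∈ D, p.1 ∈ X) →
    IsMaxOn (ucb k σ (β t) D) X (sel t D)
  measurable : ∀ t n, Measurable fun v : Fin n → Pt d × ℝ => sel t (List.ofFn v)

/-- State of the algorithm: the current dataset and the time of the last reset (`0` if none). -/
structure State (d : ℕ) where
  data : Dataset d
  lastReset : ℕ

/-- The query location at time `t` in state `s`. -/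
def State.query {d : ℕ} (sel : ℕ → Dataset d → Pt d) (t : ℕ) (s : State d) : Pt d := sel t s.data

/-- The measurement at time `t` in state `s`, for objectives `f` and noise `w`. -/
def State.meas {d : ℕ} (sel : ℕ → Dataset d → Pt d) (f : ℕ → Pt d → ℝ) (w : ℕ → ℝ) (t : ℕ)
    (s : State d) : ℝ := f t (s.query sel t) + w t

/-- The event-trigger is activated at time `t` in state `s`. -/
def State.Fires {d : ℕ} (k : Pt d → Pt d → ℝ) (σ δB : ℝ) (sel : ℕ → Dataset d → Pt d)
    (f : ℕ → Pt d → ℝ) (w : ℕ → ℝ) (t : ℕ) (s : State d) : Prop :=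
  Trigger k σ δB (t - s.lastReset) s.data (s.query sel t) (s.meas sel f w t)

open Classical in
/-- One time step of the algorithm: if the event-trigger is activated, the new dataset consists
of the latest pair only; otherwise the latest pair is appended. -/
def State.step {d : ℕ} (k : Pt d → Pt d → ℝ) (σ δB : ℝ) (sel : ℕ → Dataset d → Pt d)
    (f : ℕ → Pt d → ℝ) (w : ℕ → ℝ) (t : ℕ) (s : State d) : State d :=
  if s.Fires k σ δB sel f w t then
    { data := [(s.query sel t, s.meas sel f w t)], lastReset := t }
  else
    { data := s.data ++ [(s.query sel t, s.meas sel f w t)], lastReset := s.lastReset }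

/-- The state at the beginning of time step `t ≥ 1` (the value at `0` is a dummy). -/
def stateAt {d : ℕ} (k : Pt d → Pt d → ℝ) (σ δB : ℝ) (sel : ℕ → Dataset d → Pt d)
    (f : ℕ → Pt d → ℝ) (w : ℕ → ℝ) : ℕ → State d
  | 0 => ⟨[], 0⟩
  | 1 => ⟨[], 0⟩
  | t + 2 => (stateAt k σ δB sel f w (t + 1)).step k σ δB sel f w (t + 1)

/-- The query location `x_t` of the algorithm. -/
def queryAt {d : ℕ} (k : Pt d → Pt d → ℝ) (σ δB : ℝ) (sel : ℕ → Dataset d → Pt d)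
    (f : ℕ → Pt d → ℝ) (w : ℕ → ℝ) (t : ℕ) : Pt d :=
  (stateAt k σ δB sel f w t).query sel t

/-- The activation time of the event-trigger: the first time step at which it is activated
(`∞` if it never is). -/
def activationTime {d : ℕ} (k : Pt d → Pt d → ℝ) (σ δB : ℝ) (sel : ℕ → Dataset d → Pt d)
    (f : ℕ → Pt d → ℝ) (w : ℕ → ℝ) : ℝ≥0∞ :=
  ⨅ (t : ℕ) (_ : 1 ≤ t ∧ (stateAt k σ δB sel f w t).Fires k σ δB sel f w t), (t : ℝ≥0∞)

/-- The regret `R_T = ∑_{t=1}^T (max_X f_t - f_t(x_t))` of the algorithm. -/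
def regret {d : ℕ} (X : Set (Pt d)) (k : Pt d → Pt d → ℝ) (σ δB : ℝ)
    (sel : ℕ → Dataset d → Pt d) (f : ℕ → Pt d → ℝ) (w : ℕ → ℝ) (T : ℕ) : ℝ :=
  ∑ t ∈ Finset.Icc 1 T, (sSup (f t '' X) - f t (queryAt k σ δB sel f w t))

/-! ### The probabilistic model -/

/-- `h` is a centred Gaussian process on `X` with covariance function `k`. -/
structure IsCenteredGP {Ω : Type*} [MeasurableSpace Ω] {d : ℕ} (P : Measure Ω) (X : Set (Pt d))
    (k : Pt d → Pt d → ℝ) (h : Ω → Pt d → ℝ) : Prop where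
  gaussian : IsGaussianProcess (fun (x : X) (ω : Ω) => h ω x) P
  mean : ∀ x ∈ X, ∫ ω, h ω x ∂P = 0
  cov : ∀ x ∈ X, ∀ x' ∈ X, cov[fun ω => h ω x, fun ω => h ω x'; P] = k x x'

/-- `k` is stationary on `X`. -/
def IsStationaryOn {d : ℕ} (X : Set (Pt d)) (k : Pt d → Pt d → ℝ) : Prop :=
  ∀ x ∈ X, ∀ x' ∈ X, ∀ z ∈ X, ∀ z' ∈ X, x - x' = z - z' → k x x' = k z z'

/-- The Markov chain `f_1 = g_1`, `f_t = √(1-ε) f_{t-1} + √ε g_t` for `t ≥ 2` (the value at `0` is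
a dummy). -/
def objective {d : ℕ} (ε : ℝ) (g : ℕ → Pt d → ℝ) : ℕ → Pt d → ℝ
  | 0 => fun _ => 0
  | 1 => g 1
  | t + 2 => fun x => Real.sqrt (1 - ε) * objective ε g (t + 1) x + Real.sqrt ε * g (t + 2) x

/-- The smoothness tail conditions on a random function `h` on `X`: almost all sample paths are
differentiable on `X`, and the suprema of `|h|` and of each of its partial derivatives have
sub-Gaussian tails. (If `X` has nonempty interior, the gradient `G` is uniquely determined.) -/
structure SmoothTails {Ω : Type*} [MeasurableSpace Ω] {d : ℕ} (P : Measure Ω) (X : Set (Pt d))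
    (a₀ b₀ a₁ b₁ : ℝ) (h : Ω → Pt d → ℝ) : Prop where
  sup_tail : ∀ L : ℝ, 1 ≤ L →
    P {ω | ∃ x ∈ X, L < |h ω x|} ≤ ENNReal.ofReal (a₀ * Real.exp (-(L / b₀) ^ 2))
  deriv_tail : ∃ G : Ω → Pt d → Pt d,
    (∀ᵐ ω ∂P, ∀ x ∈ X, HasGradientWithinAt (h ω) (G ω x) X x) ∧
    ∀ j : Fin d, ∀ L : ℝ, 1 ≤ L →
      P {ω | ∃ x ∈ X, L < |G ω x j|} ≤ ENNReal.ofReal (a₁ * Real.exp (-(L / b₁) ^ 2))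

/-- The random inputs of the problem: i.i.d. centred Gaussian processes `g_1, g_2, …` with kernel
`k`, and, independently of them, i.i.d. Gaussian noise `w_1, w_2, …` of variance `σ²`. -/
structure IsModel {Ω : Type*} [MeasurableSpace Ω] {d : ℕ} (P : Measure Ω) (X : Set (Pt d))
    (k : Pt d → Pt d → ℝ) (σ : ℝ) (g : ℕ → Ω → Pt d → ℝ) (w : ℕ → Ω → ℝ) : Prop where
  gp : ∀ t, 1 ≤ t → IsCenteredGP P X k (g t)
  gp_indep : iIndepFun (fun (i : ℕ) (ω : Ω) (x : X) => g (i + 1) ω x) P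
  noise : ∀ t, 1 ≤ t → HasLaw (w t) (gaussianReal 0 (Real.toNNReal (σ ^ 2))) P
  noise_indep : iIndepFun (fun (i : ℕ) (ω : Ω) => w (i + 1) ω) P
  gp_noise_indep : IndepFun (fun (ω : Ω) (i : ℕ) (x : X) => g (i + 1) ω x)
    (fun (ω : Ω) (i : ℕ) => w (i + 1) ω) P

/-! ### The regret bound -/

/-- `φ_T(ε, δ, τ̄)`, with `w̄ = √(2 σ² ln (5 π² τ̄² / (6 δ)))`. -/
def phi (σ a₀ b₀ βT ε δ τbar : ℝ) (T : ℕ) : ℝ :=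
  3 * Real.sqrt (βT * (3 * (σ ^ 2)⁻¹ + (σ ^ 4)⁻¹) * τbar ^ 3 * ε)
    + ((σ ^ 2)⁻¹ + (σ ^ 4)⁻¹) * τbar ^ 3 * ε *
      (b₀ * Real.sqrt (Real.log (5 * a₀ * Real.pi ^ 2 * (T : ℝ) ^ 2 / (2 * δ)))
        + Real.sqrt (2 * σ ^ 2 * Real.log (5 * Real.pi ^ 2 * τbar ^ 2 / (6 * δ))))

/-- The right-hand side of the regret bound; `γ` at the real number `τ̄` is the maximum
information gain of at most `τ̄` points. -/
def regretBound {d : ℕ} (X : Set (Pt d)) (k : Pt d → Pt d → ℝ)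
    (σ a₀ b₀ βT ε δ τbar : ℝ) (T : ℕ) : ℝ :=
  Real.sqrt (72 / Real.log (1 + (σ ^ 2)⁻¹) * T * βT * (T / τbar + 1)
      * maxInfoGain X k σ ⌊τbar⌋₊)
    + 2 + T * phi σ a₀ b₀ βT ε δ τbar T

end ETGPUCB

end

/-! The bound holds because a finite mean activation time forces a strong drift, and under a strong
drift the term `T * phi` alone exceeds the trivial regret bound. Write N = `τbar`. The activation
time is at least 1 and δ < 1, so E[τ] < N. The heart of the proof
(`IsModel.two_le_of_mean_activationTime`) is that this implies σ⁻² N³ ε ≥ 2. Then `phi` ≥ 2 max(1,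
b₀√log(…)) by `two_mul_max_le_phi`. The regret is at most 2T times a common bound of |f_1|, …,
|f_T|; since each f_t has the same supremum tail as g_1, a union bound finishes. Of the other two
terms of the regret bound only nonnegativity matters.

For the drift bound, suppose σ⁻² N³ ε < 2. Until its first activation the algorithm coincides with
the one that never resets, and there an activation is a large innovation. If the objective did not
change, an innovation would be conditionally Gaussian with variance σ_D² + σ², and the threshold is
at least √ρ times its standard deviation. The changing objective is compared with this case through
densities. Along a fixed design the drifting covariance is the Hadamard product K ⊙ α^|i-j| with α =
√(1-ε). Oppenheim's inequality bounds its determinant from below, and a row-sum estimate bounds K ⊙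
α^|i-j| + σ²I from above by (1+κ)(K + σ²I). Hence the density of t observations is at most
(1+κ)^(t/2) times the static density with covariance inflated by 1+κ (`gaussDensity_le`). Adaptive
queries cause no trouble: the map from observations to noise is triangular with unit Jacobian
(`measure_adaptive`), and the static density factors into conditional Gaussians for every
predictable design.

So the trigger at time t has probability at most (1+κ)^(t/2) P(|Z| > √(ρ/(1+κ))) with Z standard
normal (`IsModel.measure_trigger_le`). Mills' bound and explicit numerics show that these
probabilities, weighted by 1.4N - t, sum to at most 0.4N. Since R ≤ E[τ] + Σ (R - t) P(trigger at t)
with R = 1.4N, this gives E[τ] ≥ N, a contradiction. -/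

namespace ETGPUCB

/-! ### Determinants and quadratic forms of positive definite matrices -/

section LinearAlgebra

open Matrix

/-- The inverse is antitone on positive definite matrices, tested on a vector. -/
theorem dotProduct_inv_mulVec_le {ι : Type*} [Fintype ι] [DecidableEq ι] {M M' : Matrix ι ι ℝ}
    (hM : M.PosDef) (hM' : M'.PosDef) (a y z : ι → ℝ)
    (hab : a ⬝ᵥ M *ᵥ a ≤ (M'⁻¹ *ᵥ y) ⬝ᵥ M' *ᵥ (M'⁻¹ *ᵥ y))
    (haz : a ⬝ᵥ z = (M'⁻¹ *ᵥ y) ⬝ᵥ y) :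
    y ⬝ᵥ M'⁻¹ *ᵥ y ≤ z ⬝ᵥ M⁻¹ *ᵥ z := by
  have hu : IsUnit M.det := (Matrix.isUnit_iff_isUnit_det _).1 hM.isUnit
  have hu' : IsUnit M'.det := (Matrix.isUnit_iff_isUnit_det _).1 hM'.isUnit
  -- Variational form of the inverse: zᵀM⁻¹z is the maximum over a of 2 aᵀz - aᵀMa. Every a gives a
  -- lower bound, and the hypotheses make this one at least aᵀz = yᵀM'⁻¹y.
  have h0 : 0 ≤ (a - M⁻¹ *ᵥ z) ⬝ᵥ M *ᵥ (a - M⁻¹ *ᵥ z) := by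
    simpa using hM.posSemidef.dotProduct_mulVec_nonneg (a - M⁻¹ *ᵥ z)
  have h1 : M *ᵥ (M⁻¹ *ᵥ z) = z := by rw [mulVec_mulVec, mul_nonsing_inv _ hu, one_mulVec]
  have h2 : M' *ᵥ (M'⁻¹ *ᵥ y) = y := by rw [mulVec_mulVec, mul_nonsing_inv _ hu', one_mulVec]
  have h3 : (M⁻¹ *ᵥ z) ⬝ᵥ M *ᵥ a = a ⬝ᵥ z := by
    have hs : Mᵀ = M := by simpa using hM.isHermitian.eq
    rw [dotProduct_mulVec, ← mulVec_transpose, hs, h1, dotProduct_comm]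
  rw [h2] at hab
  rw [mulVec_sub, h1, sub_dotProduct, dotProduct_sub, dotProduct_sub, h3,
    dotProduct_comm (M⁻¹ *ᵥ z) z, haz] at h0
  rw [dotProduct_comm y]
  linarith

theorem dotProduct_inv_mulVec_anti {ι : Type*} [Fintype ι] [DecidableEq ι] {M M' : Matrix ι ι ℝ}
    (hM : M.PosDef) (hM' : M'.PosDef) (h : ∀ v, v ⬝ᵥ M *ᵥ v ≤ v ⬝ᵥ M' *ᵥ v) (y : ι → ℝ) :
    y ⬝ᵥ M'⁻¹ *ᵥ y ≤ y ⬝ᵥ M⁻¹ *ᵥ y :=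
  dotProduct_inv_mulVec_le hM hM' (M'⁻¹ *ᵥ y) y y (h _) rfl

/-! ### Bordered matrices -/

/-- The leading principal submatrix. -/
def lead {n : ℕ} (M : Matrix (Fin (n + 1)) (Fin (n + 1)) ℝ) : Matrix (Fin n) (Fin n) ℝ :=
  M.submatrix Fin.castSucc Fin.castSucc

/-- The last column without its last entry. -/
def border {n : ℕ} (M : Matrix (Fin (n + 1)) (Fin (n + 1)) ℝ) : Fin n → ℝ :=
  fun i => M i.castSucc (Fin.last n)

/-- The Schur complement of the leading principal submatrix. -/
noncomputable def schur {n : ℕ} (M : Matrix (Fin (n + 1)) (Fin (n + 1)) ℝ) : ℝ :=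
  M (Fin.last n) (Fin.last n) - border M ⬝ᵥ (lead M)⁻¹ *ᵥ border M

theorem posDef_lead {n : ℕ} {M : Matrix (Fin (n + 1)) (Fin (n + 1)) ℝ} (hM : M.PosDef) :
    (lead M).PosDef := hM.submatrix (Fin.castSucc_injective n)

theorem det_eq_lead_mul_schur {n : ℕ} {M : Matrix (Fin (n + 1)) (Fin (n + 1)) ℝ}
    (hM : M.PosDef) : M.det = (lead M).det * schur M := by
  have hA := posDef_lead hM
  have hu : IsUnit (lead M).det := (Matrix.isUnit_iff_isUnit_det _).1 hA.isUnit
  have hs : ∀ i j, M i j = M j i := fun i j => by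
    simpa using (congrFun (congrFun hM.isHermitian.eq i) j).symm
  let _ := (lead M).invertibleOfIsUnitDet hu
  rw [← det_submatrix_equiv_self (finSumFinEquiv : Fin n ⊕ Fin 1 ≃ Fin (n + 1)) M,
    ← fromBlocks_toBlocks (M.submatrix (finSumFinEquiv : Fin n ⊕ Fin 1 ≃ Fin (n + 1)) _)]
  have e11 : (M.submatrix (finSumFinEquiv : Fin n ⊕ Fin 1 ≃ Fin (n + 1))
      finSumFinEquiv).toBlocks₁₁ = lead M := by
    ext i j; rfl
  rw [e11, det_fromBlocks₁₁]
  congr 1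
  rw [det_unique, schur, invOf_eq_nonsing_inv]
  simp only [Fin.default_eq_zero, Matrix.sub_apply]
  congr 1
  rw [Matrix.mul_assoc, Matrix.mul_apply]
  simp only [Matrix.mul_apply, dotProduct, mulVec]
  refine Finset.sum_congr rfl fun i _ => ?_
  change M (Fin.last n) i.castSucc * _ = _
  rw [hs]
  rfl

theorem schur_pos {n : ℕ} {M : Matrix (Fin (n + 1)) (Fin (n + 1)) ℝ} (hM : M.PosDef) :
    0 < schur M := by
  have h := det_eq_lead_mul_schur hM
  have h1 := hM.det_pos
  have h2 := (posDef_lead hM).det_pos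
  rw [h] at h1
  exact (pos_iff_pos_of_mul_pos h1).1 h2

/-- Completing the square in a Gaussian exponent: the last coordinate has conditional mean `border M
⬝ᵥ (lead M)⁻¹ *ᵥ y'`, with y' the preceding coordinates, and conditional variance `schur M`. -/
theorem quad_eq_lead_add {n : ℕ} {M : Matrix (Fin (n + 1)) (Fin (n + 1)) ℝ} (hM : M.PosDef)
    (y : Fin (n + 1) → ℝ) :
    y ⬝ᵥ M⁻¹ *ᵥ y = (fun i => y (Fin.castSucc i)) ⬝ᵥ (lead M)⁻¹ *ᵥ (fun i => y (Fin.castSucc i))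
      + (y (Fin.last n) - border M ⬝ᵥ (lead M)⁻¹ *ᵥ (fun i => y (Fin.castSucc i))) ^ 2
        / schur M := by
  have hA := posDef_lead hM
  have hS := schur_pos hM
  have hu : IsUnit (lead M).det := (Matrix.isUnit_iff_isUnit_det _).1 hA.isUnit
  have huM : IsUnit M.det := (Matrix.isUnit_iff_isUnit_det _).1 hM.isUnit
  have hs : ∀ i j, M i j = M j i := fun i j => by
    simpa using (congrFun (congrFun hM.isHermitian.eq i) j).symm
  set y' : Fin n → ℝ := fun i => y (Fin.castSucc i) with hy'
  set A := lead M with hAdef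
  set b := border M with hb
  -- Block elimination: `Fin.snoc z₁ z₂` is the solution of M z = y, with the last unknown
  -- eliminated first.
  set z₂ : ℝ := (y (Fin.last n) - b ⬝ᵥ A⁻¹ *ᵥ y') / schur M with hz₂
  set z₁ : Fin n → ℝ := A⁻¹ *ᵥ (y' - z₂ • b) with hz₁
  have hAz : A *ᵥ z₁ = y' - z₂ • b := by
    rw [hz₁, mulVec_mulVec, mul_nonsing_inv _ hu, one_mulVec]
  have hbz : b ⬝ᵥ z₁ = b ⬝ᵥ A⁻¹ *ᵥ y' - z₂ * (b ⬝ᵥ A⁻¹ *ᵥ b) := by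
    rw [hz₁, mulVec_sub, mulVec_smul, dotProduct_sub, dotProduct_smul, smul_eq_mul]
  have hsch : schur M = M (Fin.last n) (Fin.last n) - b ⬝ᵥ A⁻¹ *ᵥ b := rfl
  have hz₂' : z₂ * schur M = y (Fin.last n) - b ⬝ᵥ A⁻¹ *ᵥ y' := by
    rw [hz₂]; field_simp
  have hMz : M *ᵥ (Fin.snoc z₁ z₂ : Fin (n + 1) → ℝ) = y := by
    ext i
    refine Fin.lastCases ?_ (fun i => ?_) i
    · simp only [mulVec, dotProduct, Fin.sum_univ_castSucc, Fin.snoc_castSucc, Fin.snoc_last]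
      have : ∑ x : Fin n, M (Fin.last n) x.castSucc * z₁ x = b ⬝ᵥ z₁ :=
        Finset.sum_congr rfl fun j _ => by rw [hs]; rfl
      rw [this, hbz]
      rw [hsch] at hz₂'
      linarith
    · simp only [mulVec, dotProduct, Fin.sum_univ_castSucc, Fin.snoc_castSucc, Fin.snoc_last]
      have h1 := congrFun hAz i
      simp only [mulVec, dotProduct, Pi.sub_apply, Pi.smul_apply, smul_eq_mul] at h1
      have h2 : ∑ x : Fin n, M i.castSucc x.castSucc * z₁ x = ∑ x, A i x * z₁ x := rfl
      have h3 : M i.castSucc (Fin.last n) = b i := rfl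
      rw [h2, h1, h3, hy']
      ring
  have hinv : M⁻¹ *ᵥ y = Fin.snoc z₁ z₂ := by
    rw [← hMz, mulVec_mulVec, nonsing_inv_mul _ huM, one_mulVec]
  rw [hinv]
  have h4 : y ⬝ᵥ (Fin.snoc z₁ z₂ : Fin (n + 1) → ℝ) = y' ⬝ᵥ z₁ + y (Fin.last n) * z₂ := by
    simp only [dotProduct, Fin.sum_univ_castSucc, Fin.snoc_castSucc, Fin.snoc_last, hy']
  have hAs : A⁻¹ᵀ = A⁻¹ := by simpa using hA.inv.isHermitian.eq
  have h5 : y' ⬝ᵥ A⁻¹ *ᵥ b = b ⬝ᵥ A⁻¹ *ᵥ y' := by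
    rw [dotProduct_mulVec, ← mulVec_transpose, hAs, dotProduct_comm]
  have h6 : y' ⬝ᵥ z₁ = y' ⬝ᵥ A⁻¹ *ᵥ y' - z₂ * (b ⬝ᵥ A⁻¹ *ᵥ y') := by
    rw [hz₁, mulVec_sub, mulVec_smul, dotProduct_sub, dotProduct_smul, smul_eq_mul, h5]
  rw [h4, h6, ← hz₂']
  field_simp
  linear_combination (-z₂) * hz₂'

/-! ### Hadamard products with the correlation matrix of an autoregression -/

/-- The exponents `|i - j|`. -/
def gap (i j : ℕ) : ℕ := (i - j) + (j - i)

/-- The correlation matrix `α ^ |i - j|` of an autoregressive process. -/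
noncomputable def arCorr (α : ℝ) (n : ℕ) : Matrix (Fin n) (Fin n) ℝ := Matrix.of fun i j => α ^ gap i j

/-- A telescoping geometric sum: the increment (1 - α²) α^(2l-i-j) is the difference of consecutive
values of -α^(2l-i-j), and the terms start at l = max i j. -/
theorem sum_arCorr (α : ℝ) (i j m : ℕ) (hi : i ≤ m) (hj : j ≤ m) :
    ∑ l ∈ Finset.range m, (1 - α ^ 2) * ((if i ≤ l then α ^ (l - i) else 0) *
      (if j ≤ l then α ^ (l - j) else 0)) = α ^ gap i j - α ^ ((m - i) + (m - j)) := by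
  have key : ∀ m, max i j ≤ m → ∑ l ∈ Finset.range m, (1 - α ^ 2) *
      ((if i ≤ l then α ^ (l - i) else 0) * (if j ≤ l then α ^ (l - j) else 0))
        = α ^ gap i j - α ^ ((m - i) + (m - j)) := by
    intro m hm
    induction m, hm using Nat.le_induction with
    | base =>
      rw [Finset.sum_eq_zero]
      · have : max i j - i + (max i j - j) = gap i j := by unfold gap; omega
        rw [this, sub_self]
      · intro l hl
        rw [Finset.mem_range, lt_max_iff] at hl
        rcases hl with hl | hl <;> simp [Nat.not_le.2 hl]
    | succ m hm ih =>
      rw [max_le_iff] at hm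
      rw [Finset.sum_range_succ, ih, if_pos hm.1, if_pos hm.2]
      have e1 : m + 1 - i + (m + 1 - j) = (m - i) + (m - j) + 2 := by omega
      rw [e1, pow_add, pow_add]
      ring
  exact key m (max_le hi hj)

/-- The vector α^(n-i) is the border of the correlation matrix of size n + 1, so the difference is
the conditional covariance of the first n values of the autoregression given the next one. It is
exhibited as a nonnegative sum of rank-one matrices. The induction step of Oppenheim's inequality
needs this form. -/
theorem posSemidef_arCorr_sub {α : ℝ} (h0 : 0 ≤ α) (h1 : α ≤ 1) (n : ℕ) :
    (arCorr α n - vecMulVec (fun i : Fin n => α ^ (n - (i : ℕ))) fun i : Fin n =>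
      α ^ (n - (i : ℕ))).PosSemidef := by
  have : arCorr α n - vecMulVec (fun i : Fin n => α ^ (n - (i : ℕ)))
      (fun i : Fin n => α ^ (n - (i : ℕ))) = ∑ l ∈ Finset.range n, (1 - α ^ 2) •
      vecMulVec (fun i : Fin n => if (i : ℕ) ≤ l then α ^ (l - (i : ℕ)) else 0)
        (star fun i : Fin n => if (i : ℕ) ≤ l then α ^ (l - (i : ℕ)) else 0) := by
    ext i j
    rw [Matrix.sum_apply]
    simp only [Matrix.sub_apply, Matrix.smul_apply, vecMulVec_apply, smul_eq_mul, star_trivial]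
    rw [sum_arCorr α i j n i.2.le j.2.le, pow_add]
    rfl
  rw [this]
  refine posSemidef_sum _ fun l _ => ?_
  refine (posSemidef_vecMulVec_self_star _).smul ?_
  nlinarith

theorem hadamard_arCorr_diag {α : ℝ} {n : ℕ} (M : Matrix (Fin n) (Fin n) ℝ) (i : Fin n) :
    (M ⊙ arCorr α n) i i = M i i := by
  simp [hadamard_apply, arCorr, gap]

theorem posSemidef_hadamard_arCorr {α : ℝ} (h0 : 0 ≤ α) (h1 : α ≤ 1) {n : ℕ}
    {M : Matrix (Fin n) (Fin n) ℝ} (hM : M.PosSemidef) : (M ⊙ arCorr α n).PosSemidef := by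
  refine hM.hadamard ?_
  have := (posSemidef_arCorr_sub h0 h1 n).add
    (posSemidef_vecMulVec_self_star (fun i : Fin n => α ^ (n - (i : ℕ))))
  simpa using this

theorem lead_hadamard_arCorr (α : ℝ) {n : ℕ} (M : Matrix (Fin (n + 1)) (Fin (n + 1)) ℝ) :
    lead (M ⊙ arCorr α (n + 1)) = lead M ⊙ arCorr α n := by
  ext i j; rfl

/-- Oppenheim's inequality for the Hadamard product with an autoregressive correlation. -/
theorem det_le_det_hadamard_arCorr {α : ℝ} (h0 : 0 ≤ α) (h1 : α ≤ 1) :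
    ∀ {n : ℕ} {M : Matrix (Fin n) (Fin n) ℝ}, M.PosDef → (M ⊙ arCorr α n).PosDef →
      M.det ≤ (M ⊙ arCorr α n).det := by
  intro n
  induction n with
  | zero => intro M _ _; simp
  | succ n ih =>
    intro M hM hM'
    have hA := posDef_lead hM
    have hA' := posDef_lead hM'
    have hle := ih hA (by rw [← lead_hadamard_arCorr]; exact hA')
    rw [← lead_hadamard_arCorr] at hle
    rw [det_eq_lead_mul_schur hM, det_eq_lead_mul_schur hM']
    refine mul_le_mul hle ?_ (schur_pos hM).le (hA.det_pos.le.trans hle)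
    set a : Fin n → ℝ := fun i => α ^ (n - (i : ℕ)) with ha
    have hb : border (M ⊙ arCorr α (n + 1)) = fun i => a i * border M i := by
      ext i
      simp only [border, hadamard_apply, arCorr, of_apply, ha, gap, Fin.val_castSucc, Fin.val_last]
      rw [Nat.sub_eq_zero_of_le i.2.le, zero_add, mul_comm]
    unfold schur
    rw [hadamard_arCorr_diag]
    refine sub_le_sub_left ?_ _
    set u := (lead (M ⊙ arCorr α (n + 1)))⁻¹ *ᵥ border (M ⊙ arCorr α (n + 1)) with hu
    -- It remains to show that the border term of the Schur complement does not grow under the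
    -- Hadamard product. The border is multiplied entrywise by a, so the test vector a·u pairs with
    -- the old border as u does with the new one. Its energy under `lead M` is controlled because
    -- `lead M ⊙ (C - a aᵀ)` is positive semidefinite, C being the autoregressive correlation.
    refine dotProduct_inv_mulVec_le hA hA' (fun i => a i * u i) _ _ ?_ ?_
    · rw [← hu]
      have hps := hA.posSemidef.hadamard (posSemidef_arCorr_sub h0 h1 n)
      have h := hps.dotProduct_mulVec_nonneg u
      have e : (lead M ⊙ (arCorr α n - vecMulVec (fun i : Fin n => α ^ (n - (i : ℕ)))
          fun i : Fin n => α ^ (n - (i : ℕ)))) = lead (M ⊙ arCorr α (n + 1)) -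
          (lead M ⊙ vecMulVec a a) := by
        ext i j
        simp only [hadamard_apply, Matrix.sub_apply, lead, submatrix_apply, arCorr, of_apply,
          Fin.val_castSucc, ha, mul_sub]
      rw [e, sub_mulVec, dotProduct_sub, star_trivial] at h
      have e2 : u ⬝ᵥ (lead M ⊙ vecMulVec a a) *ᵥ u
          = (fun i => a i * u i) ⬝ᵥ lead M *ᵥ fun i => a i * u i := by
        simp only [dotProduct, mulVec, hadamard_apply, vecMulVec_apply, Finset.mul_sum]
        refine Finset.sum_congr rfl fun i _ => Finset.sum_congr rfl fun j _ => by ring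
      rw [← e2]
      linarith
    · rw [← hu, hb]
      simp only [dotProduct]
      exact Finset.sum_congr rfl fun i _ => by ring

/-- The end points have the largest total distance to {0, …, n-1}, namely n(n-1)/2. -/
theorem two_mul_sum_gap_le : ∀ (n i : ℕ), i < n →
    2 * ∑ j ∈ Finset.range n, gap i j ≤ n * (n - 1) := by
  intro n
  induction n with
  | zero => intro i hi; omega
  | succ n ih =>
    intro i hi
    rcases Nat.lt_succ_iff_lt_or_eq.1 hi with h | rfl
    · have := ih i h
      rw [Finset.sum_range_succ, mul_add]
      have hg : gap i n = n - i := by unfold gap; omega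
      rw [hg]
      obtain ⟨m, rfl⟩ : ∃ m, n = m + 1 := ⟨n - 1, by omega⟩
      simp only [Nat.add_sub_cancel] at this ⊢
      have : 2 * (m + 1 - i) ≤ 2 * (m + 1) := by omega
      nlinarith
    · have : ∑ j ∈ Finset.range (i + 1), gap i j = ∑ j ∈ Finset.range (i + 1), j := by
        rw [← Finset.sum_range_reflect]
        refine Finset.sum_congr rfl fun j hj => ?_
        rw [Finset.mem_range] at hj
        unfold gap; omega
      rw [this, mul_comm, Finset.sum_range_id_mul_two]

/-- A Schur test. The entries change by at most 1 - α^|i-j|, which is at most |i-j|(1-α) by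
Bernoulli; rows and columns of these bounds sum to at most (1-α)n(n-1)/2, and |v_i v_j| ≤ (v_i² +
v_j²)/2. -/
theorem quad_hadamard_arCorr_le {α : ℝ} (h0 : 0 ≤ α) (h1 : α ≤ 1) {n : ℕ}
    (K : Matrix (Fin n) (Fin n) ℝ) (hK : ∀ i j, |K i j| ≤ 1) (v : Fin n → ℝ) :
    v ⬝ᵥ (K ⊙ arCorr α n) *ᵥ v ≤ v ⬝ᵥ K *ᵥ v + (1 - α) * (n * (n - 1) / 2) * (v ⬝ᵥ v) := by
  have hα : ∀ m : ℕ, 1 - α ^ m ≤ m * (1 - α) := fun m => by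
    have := one_add_mul_le_pow (a := α - 1) (by linarith) m
    rw [add_sub_cancel] at this
    linarith
  have hα' : ∀ m : ℕ, 0 ≤ 1 - α ^ m := fun m => by
    have := pow_le_one₀ h0 h1 (n := m); linarith
  have hrow : ∀ i : Fin n, ∑ j : Fin n, (1 - α ^ gap i j) ≤ (1 - α) * (n * (n - 1) / 2) := by
    intro i
    have h := two_mul_sum_gap_le n i i.2
    have h' : (2 : ℝ) * ∑ j : Fin n, (gap i j : ℝ) ≤ n * (n - 1) := by
      have hn : 1 ≤ n := by have := i.2; omega
      rw [Finset.sum_range] at h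
      have := (Nat.cast_le (α := ℝ)).2 h
      push_cast [Nat.cast_sub hn] at this
      exact this
    calc ∑ j : Fin n, (1 - α ^ gap i j) ≤ ∑ j : Fin n, (gap i j : ℝ) * (1 - α) :=
          Finset.sum_le_sum fun j _ => hα _
      _ = (1 - α) * ∑ j : Fin n, (gap i j : ℝ) := by rw [← Finset.sum_mul, mul_comm]
      _ ≤ _ := mul_le_mul_of_nonneg_left (by linarith) (by linarith)
  have hcol : ∀ j : Fin n, ∑ i : Fin n, (1 - α ^ gap i j) ≤ (1 - α) * (n * (n - 1) / 2) := by
    intro j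
    refine le_trans (le_of_eq ?_) (hrow j)
    refine Finset.sum_congr rfl fun i _ => ?_
    unfold gap
    rw [add_comm]
  have hterm : ∀ i j : Fin n, v i * ((K ⊙ arCorr α n) i j * v j) ≤ v i * (K i j * v j)
      + ((1 - α ^ gap i j) * (v i ^ 2 / 2) + (1 - α ^ gap i j) * (v j ^ 2 / 2)) := by
    intro i j
    have e : v i * ((K ⊙ arCorr α n) i j * v j) = v i * (K i j * v j)
        + (1 - α ^ gap i j) * (-(K i j * (v i * v j))) := by
      simp only [hadamard_apply, arCorr, of_apply]; ring
    rw [e, ← mul_add]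
    refine add_le_add_right (mul_le_mul_of_nonneg_left ?_ (hα' _)) _
    have : -(K i j * (v i * v j)) ≤ |v i| * |v j| := by
      refine (neg_le_abs _).trans ?_
      rw [abs_mul, abs_mul]
      exact mul_le_of_le_one_left (by positivity) (hK i j)
    nlinarith [sq_nonneg (|v i| - |v j|), sq_abs (v i), sq_abs (v j)]
  have hq : ∀ M : Matrix (Fin n) (Fin n) ℝ, v ⬝ᵥ M *ᵥ v = ∑ i, ∑ j, v i * (M i j * v j) :=
    fun M => by simp only [dotProduct, mulVec, Finset.mul_sum]
  rw [hq, hq, dotProduct]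
  calc ∑ i, ∑ j, v i * ((K ⊙ arCorr α n) i j * v j)
      ≤ ∑ i, ∑ j, (v i * (K i j * v j)
        + ((1 - α ^ gap i j) * (v i ^ 2 / 2) + (1 - α ^ gap i j) * (v j ^ 2 / 2))) :=
        Finset.sum_le_sum fun i _ => Finset.sum_le_sum fun j _ => hterm i j
    _ = ∑ i, ∑ j, v i * (K i j * v j) + (∑ i : Fin n, (∑ j : Fin n, (1 - α ^ gap i j)) *
          (v i ^ 2 / 2) + ∑ j : Fin n, (∑ i : Fin n, (1 - α ^ gap i j)) * (v j ^ 2 / 2)) := by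
        simp only [Finset.sum_add_distrib, Finset.sum_mul]
        congr 2
        rw [Finset.sum_comm]
    _ ≤ ∑ i, ∑ j, v i * (K i j * v j) + (∑ i : Fin n, ((1 - α) * (n * (n - 1) / 2)) *
          (v i ^ 2 / 2) + ∑ j : Fin n, ((1 - α) * (n * (n - 1) / 2)) * (v j ^ 2 / 2)) := by
        gcongr with i _ j _
        · exact hrow i
        · exact hcol j
    _ = ∑ i, ∑ j, v i * (K i j * v j) + (1 - α) * (n * (n - 1) / 2) * ∑ i, v i * v i := by
        rw [← Finset.mul_sum, ← Finset.sum_div]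
        have : ∑ i, v i ^ 2 = ∑ i, v i * v i := Finset.sum_congr rfl fun i _ => by ring
        rw [this]
        ring

end LinearAlgebra

/-! ### Densities of Gaussian vectors -/

section GaussianDensity

open Matrix
open scoped NNReal

/-- The density of the centred Gaussian distribution with covariance matrix `M`. -/
noncomputable def gaussDensity {ι : Type*} [Fintype ι] [DecidableEq ι] (M : Matrix ι ι ℝ)
    (y : ι → ℝ) : ℝ :=
  (√((2 * Real.pi) ^ Fintype.card ι * M.det))⁻¹ * Real.exp (-(y ⬝ᵥ M⁻¹ *ᵥ y) / 2)

/-- Prior times likelihood equals evidence times posterior, by completing the square in x. -/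
theorem gaussianPDFReal_mul_gaussianPDFReal {s t : ℝ≥0} (hs : s ≠ 0) (ht : t ≠ 0) (a x : ℝ) :
    gaussianPDFReal 0 t x * gaussianPDFReal x s a
      = gaussianPDFReal 0 (t + s) a * gaussianPDFReal (t * a / (t + s)) (t * s / (t + s)) x := by
  have hs' : (0 : ℝ) < s := by positivity
  have ht' : (0 : ℝ) < t := by positivity
  simp only [gaussianPDFReal, NNReal.coe_add, NNReal.coe_div, NNReal.coe_mul, sub_zero]
  rw [mul_mul_mul_comm (√(2 * Real.pi * t))⁻¹, mul_mul_mul_comm (√(2 * Real.pi * (t + s)))⁻¹,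
    ← Real.exp_add, ← Real.exp_add, ← mul_inv, ← mul_inv,
    ← Real.sqrt_mul (by positivity), ← Real.sqrt_mul (by positivity)]
  congr 1
  · congr 2
    field_simp
  · congr 1
    field_simp
    ring

theorem lintegral_gaussianPDF_gaussianReal {s : ℝ≥0} (hs : s ≠ 0) (t : ℝ≥0) (a : ℝ) :
    ∫⁻ x, gaussianPDF x s a ∂(gaussianReal 0 t) = gaussianPDF 0 (t + s) a := by
  have hm : Measurable fun x => gaussianPDF x s a :=
    measurable_uncurry_gaussianPDF.comp (by fun_prop : Measurable fun x : ℝ => (x, s, a))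
  by_cases ht : t = 0
  · subst ht
    rw [gaussianReal_zero_var, lintegral_dirac' _ hm, zero_add]
  · rw [gaussianReal_of_var_ne_zero _ ht, lintegral_withDensity_eq_lintegral_mul _
      (measurable_gaussianPDF _ _) hm]
    have : ∀ x, (gaussianPDF 0 t * fun x => gaussianPDF x s a) x
        = gaussianPDF 0 (t + s) a * gaussianPDF (t * a / (t + s)) (t * s / (t + s)) x := by
      intro x
      simp only [Pi.mul_apply, gaussianPDF]
      rw [← ENNReal.ofReal_mul (gaussianPDFReal_nonneg _ _ _),
        ← ENNReal.ofReal_mul (gaussianPDFReal_nonneg _ _ _),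
        gaussianPDFReal_mul_gaussianPDFReal hs ht]
    simp_rw [this]
    rw [lintegral_const_mul _ (measurable_gaussianPDF _ _), lintegral_gaussianPDF_eq_one, mul_one]
    have : t + s ≠ 0 := by simp [ht]
    exact div_ne_zero (mul_ne_zero ht hs) this

theorem prod_gaussianPDFReal {ι : Type*} [Fintype ι] (m a : ι → ℝ) (s : ι → ℝ≥0) :
    ∏ i, gaussianPDFReal (m i) (s i) (a i) = (√((2 * Real.pi) ^ Fintype.card ι * ∏ i, (s i : ℝ)))⁻¹
      * Real.exp (-(∑ i, (a i - m i) ^ 2 / s i) / 2) := by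
  simp only [gaussianPDFReal]
  rw [Finset.prod_mul_distrib, Finset.prod_inv_distrib, ← Real.exp_sum, ← Finset.card_univ,
    ← Finset.prod_const, ← Finset.prod_mul_distrib, Real.sqrt_prod _ (fun i _ => by positivity)]
  congr 2
  rw [← Finset.sum_neg_distrib, Finset.sum_div]
  refine Finset.sum_congr rfl fun i _ => ?_
  by_cases h : (s i : ℝ) = 0
  · simp [h]
  · field_simp

/-- The density of the sum of a centred Gaussian vector and independent white noise. -/
theorem lintegral_prod_gaussianPDF {Ω : Type*} [MeasurableSpace Ω] {P : Measure Ω}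
    {ι : Type*} [Fintype ι] [DecidableEq ι] {v : ι → Ω → ℝ}
    (hv : HasGaussianLaw (fun ω i => v i ω) P) (hmean : ∀ i, ∫ ω, v i ω ∂P = 0)
    {C : Matrix ι ι ℝ} (hcov : ∀ i j, cov[v i, v j; P] = C i j) {s : ℝ≥0} (hs : s ≠ 0)
    (y : ι → ℝ) :
    ∫⁻ ω, ∏ i, gaussianPDF (v i ω) s (y i) ∂P
      = ENNReal.ofReal (gaussDensity (C + (s : ℝ) • (1 : Matrix ι ι ℝ)) y) := by
  have := hv.isProbabilityMeasure
  have hC : C.IsHermitian := by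
    ext i j
    rw [conjTranspose_apply, star_trivial, ← hcov, ← hcov, covariance_comm]
  -- Diagonalising C instead of inverting it admits singular covariances, for instance repeated
  -- query points. In the eigenbasis the coordinates are uncorrelated, hence independent.
  set U : Matrix ι ι ℝ := hC.eigenvectorUnitary.1 with hUdef
  set l : ι → ℝ := hC.eigenvalues with hl
  have hU1 : Uᵀ * U = 1 := by
    have := Unitary.coe_star_mul_self hC.eigenvectorUnitary
    simpa [star_eq_conjTranspose] using this
  have hU2 : U * Uᵀ = 1 := by
    have := Unitary.coe_mul_star_self hC.eigenvectorUnitary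
    simpa [star_eq_conjTranspose] using this
  have hCU : C = U * diagonal l * Uᵀ := by
    have := hC.spectral_theorem
    simpa [Unitary.conjStarAlgAut_apply, star_eq_conjTranspose, Function.comp_def] using this
  have hdiag : Uᵀ * C * U = diagonal l := by
    rw [hCU]
    calc Uᵀ * (U * diagonal l * Uᵀ) * U = (Uᵀ * U) * diagonal l * (Uᵀ * U) := by
          simp only [Matrix.mul_assoc]
      _ = diagonal l := by rw [hU1]; simp
  have hL2 : ∀ i, MemLp (v i) 2 P := fun i => (hv.eval i).memLp_two
  -- the coordinates in the eigenbasis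
  set v' : ι → Ω → ℝ := fun j ω => ∑ i, U i j * v i ω with hv'
  have hgv' : HasGaussianLaw (fun ω j => v' j ω) P := by
    have := hv.map_fun (LinearMap.toContinuousLinearMap (Matrix.toLin' Uᵀ))
    have e : (fun ω j => v' j ω)
        = fun ω => LinearMap.toContinuousLinearMap (Matrix.toLin' Uᵀ) fun i => v i ω := by
      ext ω j
      simp [v', Matrix.toLin'_apply, mulVec, dotProduct]
    rw [e]
    exact this
  have hcov' : ∀ j k, cov[v' j, v' k; P] = diagonal l j k := by
    intro j k
    rw [hv', covariance_fun_sum_fun_sum (fun i => (hL2 i).const_mul _)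
      (fun i => (hL2 i).const_mul _), ← hdiag]
    simp only [covariance_const_mul_left, covariance_const_mul_right, Matrix.mul_apply,
      transpose_apply, hcov, Finset.sum_mul]
    rw [Finset.sum_comm]
    refine Finset.sum_congr rfl fun a _ => Finset.sum_congr rfl fun b _ => by ring
  have hmean' : ∀ j, ∫ ω, v' j ω ∂P = 0 := by
    intro j
    rw [hv', integral_finsetSum _ fun i _ => ((hv.eval i).integrable).const_mul _]
    simp [integral_const_mul, hmean]
  have hlpos : ∀ j, 0 ≤ l j := by
    intro j
    have := hcov' j j
    rw [covariance_self (hgv'.eval j).aemeasurable, diagonal_apply_eq] at this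
    rw [← this]
    exact variance_nonneg _ _
  have hlaw : ∀ j, P.map (v' j) = gaussianReal 0 (l j).toNNReal := by
    intro j
    rw [(hgv'.eval j).map_eq_gaussianReal, hmean',
      ← covariance_self (hgv'.eval j).aemeasurable, hcov', diagonal_apply_eq]
  have hind : iIndepFun v' P := hgv'.iIndepFun_of_covariance_eq_zero fun i j hij => by
    rw [hcov', diagonal_apply_ne _ hij]
  -- White noise of equal variances has a rotation-invariant density, so the product may be taken in
  -- the eigenbasis.
  have hprod : ∀ ω, ∏ i, gaussianPDF (v i ω) s (y i)
      = ∏ j, gaussianPDF (v' j ω) s ((Uᵀ *ᵥ y) j) := by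
    intro ω
    simp only [gaussianPDF]
    rw [← ENNReal.ofReal_prod_of_nonneg fun _ _ => gaussianPDFReal_nonneg _ _ _,
      ← ENNReal.ofReal_prod_of_nonneg fun _ _ => gaussianPDFReal_nonneg _ _ _,
      prod_gaussianPDFReal, prod_gaussianPDFReal]
    congr 4
    rw [← Finset.sum_div, ← Finset.sum_div]
    congr 2
    have h1 : ∀ z : ι → ℝ, ∑ i, z i ^ 2 = z ⬝ᵥ z := fun z =>
      Finset.sum_congr rfl fun i _ => by ring
    have h2 := h1 fun i => y i - v i ω
    have h3 := h1 (Uᵀ *ᵥ fun i => y i - v i ω)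
    have h4 : (Uᵀ *ᵥ fun i => y i - v i ω) ⬝ᵥ (Uᵀ *ᵥ fun i => y i - v i ω)
        = (fun i => y i - v i ω) ⬝ᵥ fun i => y i - v i ω := by
      rw [dotProduct_mulVec, ← mulVec_transpose, mulVec_mulVec, transpose_transpose, hU2,
        one_mulVec]
    rw [h2, ← h4, ← h3]
    refine Finset.sum_congr rfl fun j _ => ?_
    congr 1
    simp only [mulVec, dotProduct, transpose_apply, hv', mul_sub, Finset.sum_sub_distrib]
  simp_rw [hprod]
  have hm : ∀ a : ℝ, Measurable fun x => gaussianPDF x s a := fun a =>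
    measurable_uncurry_gaussianPDF.comp (by fun_prop : Measurable fun x : ℝ => (x, s, a))
  have hstep : ∫⁻ ω, ∏ j, gaussianPDF (v' j ω) s ((Uᵀ *ᵥ y) j) ∂P
      = ∏ j, ∫⁻ ω, gaussianPDF (v' j ω) s ((Uᵀ *ᵥ y) j) ∂P := by
    -- The product formula for independent functions is applied to measurable modifications, since
    -- the v' are only almost everywhere measurable.
    have hae : ∀ j, AEMeasurable (v' j) P := fun j => (hgv'.eval j).aemeasurable
    have hind' : iIndepFun (fun j => (hae j).mk) P :=
      hind.congr fun j => (hae j).ae_eq_mk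
    have hcomp := hind'.comp (fun j x => gaussianPDF x s ((Uᵀ *ᵥ y) j)) fun j => hm _
    have h := lintegral_prod_eq_prod_lintegral_of_indepFun Finset.univ _ hcomp
      fun j => (hm _).comp (hae j).measurable_mk
    refine Eq.trans (lintegral_congr_ae ?_) (h.trans (Finset.prod_congr rfl fun j _ =>
      lintegral_congr_ae ?_))
    · filter_upwards [ae_all_iff.2 fun j => (hae j).ae_eq_mk] with ω hω
      exact Finset.prod_congr rfl fun j _ => by rw [hω j]; rfl
    · filter_upwards [(hae j).ae_eq_mk] with ω hω
      simp [hω]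
  rw [hstep]
  have hone : ∀ j, ∫⁻ ω, gaussianPDF (v' j ω) s ((Uᵀ *ᵥ y) j) ∂P
      = gaussianPDF 0 ((l j).toNNReal + s) ((Uᵀ *ᵥ y) j) := by
    intro j
    rw [← lintegral_gaussianPDF_gaussianReal hs, ← hlaw j,
      lintegral_map' (hm _).aemeasurable (hgv'.eval j).aemeasurable]
  simp_rw [hone, gaussianPDF]
  rw [← ENNReal.ofReal_prod_of_nonneg fun _ _ => gaussianPDFReal_nonneg _ _ _,
    prod_gaussianPDFReal, gaussDensity]
  have hls : ∀ j, (((l j).toNNReal + s : ℝ≥0) : ℝ) = l j + s := fun j => by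
    rw [NNReal.coe_add, Real.coe_toNNReal _ (hlpos j)]
  have hspos : (0 : ℝ) < s := by positivity
  have hM : C + (s : ℝ) • (1 : Matrix ι ι ℝ) = U * diagonal (fun j => l j + s) * Uᵀ := by
    have : diagonal (fun j => l j + (s : ℝ)) = diagonal l + (s : ℝ) • (1 : Matrix ι ι ℝ) := by
      rw [smul_one_eq_diagonal, diagonal_add]
    rw [this, Matrix.mul_add, Matrix.add_mul, ← hCU, Matrix.mul_smul, Matrix.mul_one,
      Matrix.smul_mul, hU2]
  have hdet : (C + (s : ℝ) • (1 : Matrix ι ι ℝ)).det = ∏ j, (l j + s) := by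
    rw [hM, det_mul, det_mul, det_diagonal, mul_comm, ← mul_assoc, ← det_mul, hU1, det_one,
      one_mul]
  have hinv : (C + (s : ℝ) • (1 : Matrix ι ι ℝ))⁻¹
      = U * diagonal (fun j => (l j + s)⁻¹) * Uᵀ := by
    refine inv_eq_right_inv ?_
    rw [hM]
    calc U * diagonal (fun j => l j + (s : ℝ)) * Uᵀ * (U * diagonal (fun j => (l j + s)⁻¹) * Uᵀ)
        = U * (diagonal (fun j => l j + (s : ℝ)) * (Uᵀ * U) * diagonal (fun j => (l j + s)⁻¹)) *
            Uᵀ := by simp only [Matrix.mul_assoc]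
      _ = 1 := by
          rw [hU1, Matrix.mul_one, diagonal_mul_diagonal]
          have : (fun j => (l j + (s : ℝ)) * (l j + s)⁻¹) = fun _ => 1 := by
            ext j
            exact mul_inv_cancel₀ (by have := hlpos j; positivity)
          rw [this, diagonal_one, Matrix.mul_one, hU2]
  rw [hdet, hinv]
  simp_rw [hls]
  congr 4
  rw [← mulVec_mulVec, ← mulVec_mulVec, dotProduct_mulVec, ← mulVec_transpose]
  simp only [dotProduct, mulVec_diagonal, sub_zero]
  congr 1
  refine Finset.sum_congr rfl fun j _ => ?_
  rw [div_eq_mul_inv]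
  ring

/-- The chain rule p(y) = p(y') p(y_n | y'). -/
theorem gaussDensity_succ {n : ℕ} {M : Matrix (Fin (n + 1)) (Fin (n + 1)) ℝ} (hM : M.PosDef)
    (y : Fin (n + 1) → ℝ) :
    gaussDensity M y = gaussDensity (lead M) (fun i => y i.castSucc) *
      gaussianPDFReal (border M ⬝ᵥ (lead M)⁻¹ *ᵥ fun i => y i.castSucc) (schur M).toNNReal
        (y (Fin.last n)) := by
  have h1 := (posDef_lead hM).det_pos
  have h2 := schur_pos hM
  rw [gaussDensity, gaussDensity, gaussianPDFReal, det_eq_lead_mul_schur hM, quad_eq_lead_add hM,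
    Real.coe_toNNReal _ h2.le, mul_mul_mul_comm, ← Real.exp_add, ← mul_inv,
    ← Real.sqrt_mul (by positivity)]
  simp only [Fintype.card_fin]
  congr 1
  · congr 2
    ring
  · congr 1
    field_simp
    ring

/-- Comparison of the densities of two centred Gaussian vectors. -/
theorem gaussDensity_le {n : ℕ} {M M' : Matrix (Fin n) (Fin n) ℝ} (hM : M.PosDef)
    (hM' : M'.PosDef) (hdet : M.det ≤ M'.det) {κ : ℝ} (hκ : 0 ≤ κ)
    (h : ∀ v, v ⬝ᵥ M' *ᵥ v ≤ (1 + κ) * (v ⬝ᵥ M *ᵥ v)) (y : Fin n → ℝ) :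
    gaussDensity M' y ≤ √((1 + κ) ^ n) * gaussDensity ((1 + κ) • M) y := by
  have hκ' : (0 : ℝ) < 1 + κ := by linarith
  have hMs : ((1 + κ) • M).PosDef := hM.smul hκ'
  -- The two hypotheses act separately: M' ≤ (1+κ)M compares the exponents, and det M ≤ det M'
  -- compares the normalisations. The factor √((1+κ)^n) only compensates the normalisation of the
  -- inflated covariance.
  have hq := dotProduct_inv_mulVec_anti hM' hMs
    (fun v => by rw [smul_mulVec, dotProduct_smul, smul_eq_mul]; exact h v) y
  rw [gaussDensity, gaussDensity, ← mul_assoc, det_smul, Fintype.card_fin]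
  have hd := hM.det_pos
  refine mul_le_mul ?_ (Real.exp_le_exp.2 (by linarith)) (Real.exp_pos _).le (by positivity)
  have e : (2 * Real.pi) ^ n * ((1 + κ) ^ n * M.det)
      = (1 + κ) ^ n * ((2 * Real.pi) ^ n * M.det) := by ring
  rw [e, Real.sqrt_mul (x := (1 + κ) ^ n) (by positivity), mul_inv, ← mul_assoc,
    mul_inv_cancel₀ (by positivity), one_mul]
  gcongr

end GaussianDensity

/-! ### Law of the changing objective -/

section Model

/-- The characteristic function of a Gaussian vector depends only on the mean and variance of each
linear functional, and these are determined by the means and covariances of the coordinates. -/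
theorem map_eq_of_covariance_eq {Ω : Type*} [MeasurableSpace Ω] {P : Measure Ω} {ι : Type*}
    [Fintype ι] {U V : ι → Ω → ℝ} (hU : HasGaussianLaw (fun ω i => U i ω) P)
    (hV : HasGaussianLaw (fun ω i => V i ω) P) (hmean : ∀ i, ∫ ω, U i ω ∂P = ∫ ω, V i ω ∂P)
    (hcov : ∀ i j, cov[U i, U j; P] = cov[V i, V j; P]) :
    P.map (fun ω i => U i ω) = P.map fun ω i => V i ω := by
  classical
  have := hU.isProbabilityMeasure
  have := hU.isGaussian_map
  have := hV.isGaussian_map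
  refine Measure.ext_of_charFunDual ?_
  ext L
  obtain ⟨c, hL⟩ : ∃ c : ι → ℝ, ∀ z : ι → ℝ, L z = ∑ i, c i * z i := by
    refine ⟨fun i => L (Pi.single i 1), fun z => ?_⟩
    conv_lhs => rw [← Finset.univ_sum_single z, map_sum]
    refine Finset.sum_congr rfl fun i _ => ?_
    have : (Pi.single i (z i) : ι → ℝ) = z i • Pi.single i 1 := by
      rw [← Pi.single_smul, smul_eq_mul, mul_one]
    rw [this, map_smul, smul_eq_mul, mul_comm]
  have eU : (L ∘ fun ω i => U i ω) = fun ω => ∑ i, c i * U i ω := funext fun ω => hL _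
  have eV : (L ∘ fun ω i => V i ω) = fun ω => ∑ i, c i * V i ω := funext fun ω => hL _
  have mU : ∀ i, MemLp (fun ω => c i * U i ω) 2 P := fun i => (hU.eval i).memLp_two.const_mul _
  have mV : ∀ i, MemLp (fun ω => c i * V i ω) 2 P := fun i => (hV.eval i).memLp_two.const_mul _
  rw [hU.charFunDual_map_eq, hV.charFunDual_map_eq, eU, eV]
  have e1 : ∫ ω, ∑ i, c i * U i ω ∂P = ∫ ω, ∑ i, c i * V i ω ∂P := by
    rw [integral_finsetSum _ fun i _ => (mU i).integrable one_le_two,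
      integral_finsetSum _ fun i _ => (mV i).integrable one_le_two]
    simp only [integral_const_mul, hmean]
  have e2 : Var[fun ω => ∑ i, c i * U i ω; P] = Var[fun ω => ∑ i, c i * V i ω; P] := by
    rw [← covariance_self (memLp_finsetSum _ fun i _ => mU i).aemeasurable,
      ← covariance_self (memLp_finsetSum _ fun i _ => mV i).aemeasurable,
      covariance_fun_sum_fun_sum mU mU, covariance_fun_sum_fun_sum mV mV]
    simp only [covariance_const_mul_left, covariance_const_mul_right, hcov]
  rw [e1, e2]

theorem objective_one {d : ℕ} (ε : ℝ) (g : ℕ → Pt d → ℝ) (x : Pt d) :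
    objective ε g 1 x = g 1 x := rfl

theorem objective_succ {d : ℕ} (ε : ℝ) (g : ℕ → Pt d → ℝ) (i : ℕ) (x : Pt d) :
    objective ε g (i + 1 + 1) x = √(1 - ε) * objective ε g (i + 1) x + √ε * g (i + 1 + 1) x := rfl

/-- The coefficients depend on neither the sample path nor the point, and the common length N lets
several times share one index set. Joint Gaussianity, measurability and independence thus pass from
the g's to the objectives. -/
theorem exists_objective_eq_sum (ε : ℝ) (N : ℕ) : ∃ c : ℕ → ℕ → ℝ, ∀ i < N, ∀ {d : ℕ}
    (g : ℕ → Pt d → ℝ) (x : Pt d),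
    objective ε g (i + 1) x = ∑ l ∈ Finset.range N, c i l * g (l + 1) x := by
  refine ⟨fun i => Nat.rec (fun l => if l = 0 then 1 else 0)
    (fun i c l => √(1 - ε) * c l + √ε * if l = i + 1 then 1 else 0) i, fun i => ?_⟩
  induction i with
  | zero =>
    intro hN d g x
    rw [Finset.sum_eq_single_of_mem 0 (Finset.mem_range.2 hN)]
    · simp [objective_one]
    · intro b _ hb
      simp [hb]
  | succ i ih =>
    intro hN d g x
    rw [objective_succ, ih (by omega)]
    simp only [add_mul, Finset.sum_add_distrib]
    congr 1
    · rw [Finset.mul_sum]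
      exact Finset.sum_congr rfl fun l _ => by ring
    · rw [Finset.sum_eq_single_of_mem (i + 1) (Finset.mem_range.2 hN)]
      · simp
      · intro b _ hb
        simp [hb]

theorem continuousOn_objective {d : ℕ} (ε : ℝ) {g : ℕ → Pt d → ℝ} {X : Set (Pt d)}
    (hg : ∀ i, ContinuousOn (g (i + 1)) X) (i : ℕ) : ContinuousOn (objective ε g (i + 1)) X := by
  induction i with
  | zero => exact hg 0
  | succ i ih => exact (ih.const_smul (√(1 - ε))).add ((hg (i + 1)).const_smul (√ε))

variable {Ω : Type*} [MeasurableSpace Ω] {P : Measure Ω} {d : ℕ} {X : Set (Pt d)}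
  {k : Pt d → Pt d → ℝ} {σ : ℝ} {g : ℕ → Ω → Pt d → ℝ} {w : ℕ → Ω → ℝ}

theorem SmoothTails.ae_continuousOn {a₀ b₀ a₁ b₁ : ℝ} {h : Ω → Pt d → ℝ}
    (hs : SmoothTails P X a₀ b₀ a₁ b₁ h) : ∀ᵐ ω ∂P, ContinuousOn (h ω) X := by
  obtain ⟨G, hG, -⟩ := hs.deriv_tail
  filter_upwards [hG] with ω hω x hx
  exact (hω x hx).hasFDerivWithinAt.continuousWithinAt

namespace IsModel

theorem memLp_gp (h : IsModel P X k σ g w) (i : ℕ) {x : Pt d} (hx : x ∈ X) :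
    MemLp (fun ω => g (i + 1) ω x) 2 P :=
  ((h.gp (i + 1) (by omega)).gaussian.hasGaussianLaw_eval ⟨x, hx⟩).memLp_two

theorem isProbabilityMeasure (h : IsModel P X k σ g w) : IsProbabilityMeasure P :=
  (h.gp 1 le_rfl).gaussian.isProbabilityMeasure

theorem cov_gp_of_ne (h : IsModel P X k σ g w) {i j : ℕ} (hij : i ≠ j) {x x' : Pt d}
    (hx : x ∈ X) (hx' : x' ∈ X) :
    cov[fun ω => g (i + 1) ω x, fun ω => g (j + 1) ω x'; P] = 0 := by
  have := h.isProbabilityMeasure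
  have hi := (h.gp_indep.indepFun hij).comp (measurable_pi_apply (⟨x, hx⟩ : X))
    (measurable_pi_apply (⟨x', hx'⟩ : X))
  exact hi.covariance_eq_zero (h.memLp_gp i hx) (h.memLp_gp j hx')

theorem memLp_objective (h : IsModel P X k σ g w) (ε : ℝ) (i : ℕ) {x : Pt d} (hx : x ∈ X) :
    MemLp (fun ω => objective ε (fun t => g t ω) (i + 1) x) 2 P := by
  induction i with
  | zero => exact h.memLp_gp 0 hx
  | succ i ih => exact (ih.const_mul _).add ((h.memLp_gp (i + 1) hx).const_mul _)

theorem integral_objective (h : IsModel P X k σ g w) (ε : ℝ) (i : ℕ) {x : Pt d} (hx : x ∈ X) :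
    ∫ ω, objective ε (fun t => g t ω) (i + 1) x ∂P = 0 := by
  have := h.isProbabilityMeasure
  induction i with
  | zero => exact (h.gp 1 le_rfl).mean x hx
  | succ i ih =>
    simp only [objective_succ]
    rw [integral_add (((h.memLp_objective ε i hx).integrable one_le_two).const_mul _)
      (((h.memLp_gp (i + 1) hx).integrable one_le_two).const_mul _), integral_const_mul,
      integral_const_mul, ih, (h.gp (i + 1 + 1) (by omega)).mean x hx]
    simp

theorem cov_objective_gp (h : IsModel P X k σ g w) (ε : ℝ) (i : ℕ) {j : ℕ} (hij : i < j)
    {x x' : Pt d} (hx : x ∈ X) (hx' : x' ∈ X) :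
    cov[fun ω => objective ε (fun t => g t ω) (i + 1) x, fun ω => g (j + 1) ω x'; P] = 0 := by
  have := h.isProbabilityMeasure
  induction i with
  | zero => exact h.cov_gp_of_ne hij.ne hx hx'
  | succ i ih =>
    simp only [objective_succ]
    have := covariance_add_left ((h.memLp_objective ε i hx).const_mul (√(1 - ε)))
      ((h.memLp_gp (i + 1) hx).const_mul (√ε)) (h.memLp_gp j hx')
    refine this.trans ?_
    rw [covariance_const_mul_left, covariance_const_mul_left, ih (by omega),
      h.cov_gp_of_ne hij.ne hx hx']
    simp

/-- The weights satisfy (1-ε) + ε = 1 and the new sample is uncorrelated with the past, so the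
covariance is invariant in time. -/
theorem cov_objective_self (h : IsModel P X k σ g w) {ε : ℝ} (hε : ε ∈ Set.Icc (0 : ℝ) 1) (i : ℕ)
    {x x' : Pt d} (hx : x ∈ X) (hx' : x' ∈ X) :
    cov[fun ω => objective ε (fun t => g t ω) (i + 1) x,
      fun ω => objective ε (fun t => g t ω) (i + 1) x'; P] = k x x' := by
  have := h.isProbabilityMeasure
  induction i with
  | zero => exact (h.gp 1 le_rfl).cov x hx x' hx'
  | succ i ih =>
    simp only [objective_succ]
    have ml := fun {x} hx => (h.memLp_objective ε i (x := x) hx).const_mul (√(1 - ε))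
    have mg := fun {x} hx => (h.memLp_gp (i + 1) (x := x) hx).const_mul (√ε)
    have h1 := covariance_add_left (ml hx) (mg hx) ((ml hx').add (mg hx'))
    refine h1.trans ?_
    rw [covariance_add_right (ml hx) (ml hx') (mg hx'),
      covariance_add_right (mg hx) (ml hx') (mg hx')]
    simp only [covariance_const_mul_left, covariance_const_mul_right]
    rw [ih, h.cov_objective_gp ε i (Nat.lt_succ_self i) hx hx', covariance_comm,
      h.cov_objective_gp ε i (Nat.lt_succ_self i) hx' hx,
      (h.gp (i + 1 + 1) (by omega)).cov x hx x' hx']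
    have e1 := Real.mul_self_sqrt (sub_nonneg.2 hε.2)
    have e2 := Real.mul_self_sqrt hε.1
    linear_combination k x x' * e1 + k x x' * e2

theorem cov_objective_add (h : IsModel P X k σ g w) {ε : ℝ} (hε : ε ∈ Set.Icc (0 : ℝ) 1)
    (i m : ℕ) {x x' : Pt d} (hx : x ∈ X) (hx' : x' ∈ X) :
    cov[fun ω => objective ε (fun t => g t ω) (i + 1) x,
      fun ω => objective ε (fun t => g t ω) (i + m + 1) x'; P] = √(1 - ε) ^ m * k x x' := by
  have := h.isProbabilityMeasure
  induction m with
  | zero => simpa using h.cov_objective_self hε i hx hx'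
  | succ m ih =>
    have e : i + (m + 1) + 1 = (i + m) + 1 + 1 := by omega
    simp only [e, objective_succ]
    refine (covariance_add_right (h.memLp_objective ε i hx)
      ((h.memLp_objective ε (i + m) hx').const_mul (√(1 - ε)))
      ((h.memLp_gp (i + m + 1) hx').const_mul (√ε))).trans ?_
    rw [covariance_const_mul_right, covariance_const_mul_right, ih,
      h.cov_objective_gp ε i (by omega) hx hx']
    ring

theorem kernel_symm (h : IsModel P X k σ g w) {x x' : Pt d} (hx : x ∈ X) (hx' : x' ∈ X) :
    k x x' = k x' x := by
  have hg := h.gp 1 le_rfl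
  rw [← hg.cov x hx x' hx', covariance_comm, hg.cov x' hx' x hx]

theorem cov_objective (h : IsModel P X k σ g w) {ε : ℝ} (hε : ε ∈ Set.Icc (0 : ℝ) 1)
    (i j : ℕ) {x x' : Pt d} (hx : x ∈ X) (hx' : x' ∈ X) :
    cov[fun ω => objective ε (fun t => g t ω) (i + 1) x,
      fun ω => objective ε (fun t => g t ω) (j + 1) x'; P] = k x x' * √(1 - ε) ^ gap i j := by
  rcases le_total i j with hij | hij
  · obtain ⟨m, rfl⟩ := Nat.exists_eq_add_of_le hij
    rw [h.cov_objective_add hε i m hx hx']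
    have : gap i (i + m) = m := by unfold gap; omega
    rw [this, mul_comm]
  · obtain ⟨m, rfl⟩ := Nat.exists_eq_add_of_le hij
    rw [covariance_comm, h.cov_objective_add hε j m hx' hx]
    have : gap (j + m) j = m := by unfold gap; omega
    rw [this, mul_comm, h.kernel_symm hx hx']

theorem hasGaussianLaw_objective (h : IsModel P X k σ g w) (ε : ℝ) {ι : Type*} [Fintype ι]
    (a : ι → ℕ) (p : ι → Pt d) (hp : ∀ i, p i ∈ X) :
    HasGaussianLaw (fun ω i => objective ε (fun t => g t ω) (a i + 1) (p i)) P := by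
  have := h.isProbabilityMeasure
  obtain ⟨N, hN⟩ : ∃ N, ∀ i, a i < N :=
    ⟨Finset.univ.sup a + 1, fun i => Nat.lt_succ_of_le (Finset.le_sup (Finset.mem_univ i))⟩
  obtain ⟨c, hc⟩ := exists_objective_eq_sum ε N
  have h1 : ∀ l : Fin N, HasGaussianLaw (fun ω (i : ι) => g ((l : ℕ) + 1) ω (p i)) P := by
    intro l
    have hG := ((h.gp (l + 1) (by omega)).gaussian.comp_right
      (fun i : ι => (⟨p i, hp i⟩ : X))).hasGaussianLaw Finset.univ
    exact hG.map_fun (ContinuousLinearMap.pi fun i : ι =>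
      ContinuousLinearMap.proj (R := ℝ) (φ := fun _ : (Finset.univ : Finset ι) => ℝ)
        ⟨i, Finset.mem_univ i⟩)
  have h2 : iIndepFun (fun (l : Fin N) ω (i : ι) => g ((l : ℕ) + 1) ω (p i)) P :=
    (h.gp_indep.precomp Fin.val_injective).comp (fun _ z i => z ⟨p i, hp i⟩)
      fun _ => measurable_pi_lambda _ fun i => measurable_pi_apply _
  have h3 := (iIndepFun.hasGaussianLaw h1 h2).map_fun
    (ContinuousLinearMap.pi fun i : ι => ∑ l : Fin N, c (a i) l •
      (ContinuousLinearMap.proj (R := ℝ) (φ := fun _ : ι => ℝ) i ∘L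
        ContinuousLinearMap.proj (R := ℝ) (φ := fun _ : Fin N => ι → ℝ) l))
  have e : (fun ω i => objective ε (fun t => g t ω) (a i + 1) (p i)) = fun ω =>
      (ContinuousLinearMap.pi fun i : ι => ∑ l : Fin N, c (a i) l •
      (ContinuousLinearMap.proj (R := ℝ) (φ := fun _ : ι => ℝ) i ∘L
        ContinuousLinearMap.proj (R := ℝ) (φ := fun _ : Fin N => ι → ℝ) l))
        (fun l i => g ((l : ℕ) + 1) ω (p i)) := by
    ext ω i
    rw [hc _ (hN i)]
    simp [Finset.sum_range]
  rw [e]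
  exact h3

/-- The quadratic form at v is the variance of Σ v_i g_1(p_i). -/
theorem posSemidef_gram (h : IsModel P X k σ g w) {ι : Type} [Fintype ι] (p : ι → Pt d)
    (hp : ∀ i, p i ∈ X) : (gram k p).PosSemidef := by
  have := h.isProbabilityMeasure
  have hg := h.gp 1 le_rfl
  refine Matrix.posSemidef_iff_dotProduct_mulVec.2 ⟨?_, fun v => ?_⟩
  · ext i j
    exact h.kernel_symm (hp j) (hp i)
  · have hm : ∀ i, MemLp (fun ω => v i * g 1 ω (p i)) 2 P :=
      fun i => (h.memLp_gp 0 (hp i)).const_mul _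
    have hs : MemLp (fun ω => ∑ i, v i * g 1 ω (p i)) 2 P := memLp_finsetSum _ fun i _ => hm i
    have h1 := covariance_fun_sum_fun_sum hm hm
    rw [covariance_self hs.aemeasurable] at h1
    have h2 := variance_nonneg (fun ω => ∑ i, v i * g 1 ω (p i)) P
    rw [h1] at h2
    simp only [covariance_const_mul_left, covariance_const_mul_right, hg.cov _ (hp _) _ (hp _)]
      at h2
    simp only [star_trivial, dotProduct, Matrix.mulVec, gram, Matrix.of_apply, Finset.mul_sum]
    refine h2.trans (le_of_eq (Finset.sum_congr rfl fun i _ => Finset.sum_congr rfl fun j _ => ?_))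
    ring

theorem abs_kernel_le (h : IsModel P X k σ g w) (hk1 : ∀ x ∈ X, ∀ x' ∈ X, k x x' ≤ 1)
    {x x' : Pt d} (hx : x ∈ X) (hx' : x' ∈ X) : |k x x'| ≤ 1 := by
  refine abs_le.2 ⟨?_, hk1 x hx x' hx'⟩
  -- The variance of g(x) + g(x') is nonnegative, so 2k(x,x') ≥ -k(x,x) - k(x',x') ≥ -2.
  have h1 := (h.posSemidef_gram ![x, x'] (by simp [hx, hx'])).dotProduct_mulVec_nonneg ![1, 1]
  simp [Matrix.mulVec, dotProduct, gram, Fin.sum_univ_two] at h1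
  have := hk1 x hx x hx
  have := hk1 x' hx' x' hx'
  have := h.kernel_symm hx hx'
  linarith

theorem map_objective_eq (h : IsModel P X k σ g w) {ε : ℝ} (hε : ε ∈ Set.Icc (0 : ℝ) 1) (i : ℕ)
    (e : ℕ → Pt d) (he : ∀ m, e m ∈ X) :
    P.map (fun ω m => objective ε (fun t => g t ω) (i + 1) (e m))
      = P.map fun ω m => g 1 ω (e m) := by
  have := h.isProbabilityMeasure
  have hm : ∀ i, AEMeasurable (fun ω m => objective ε (fun t => g t ω) (i + 1) (e m)) P :=
    fun i => aemeasurable_pi_lambda _ fun m => (h.memLp_objective ε i (he m)).aemeasurable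
  refine (map_eq_iff_forall_finset_map_restrict_eq
    (X := fun m ω => objective ε (fun t => g t ω) (i + 1) (e m))
    (Y := fun m ω => g 1 ω (e m)) (hm i) (hm 0)).2 fun I => ?_
  refine map_eq_of_covariance_eq (U := fun (m : I) ω => objective ε (fun t => g t ω) (i + 1) (e m))
    (V := fun (m : I) ω => objective ε (fun t => g t ω) (0 + 1) (e m))
    (h.hasGaussianLaw_objective ε _ _ fun m => he m)
    (h.hasGaussianLaw_objective ε _ _ fun m => he m) (fun m => ?_) fun m n => ?_
  · rw [h.integral_objective ε i (he m), h.integral_objective ε 0 (he m)]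
  · rw [h.cov_objective_self hε i (he m) (he n), h.cov_objective_self hε 0 (he m) (he n)]

/-- All the objectives have the same tails of the supremum. -/
theorem sup_tail_objective (h : IsModel P X k σ g w) {ε : ℝ} (hε : ε ∈ Set.Icc (0 : ℝ) 1)
    (hne : X.Nonempty) (hcont : ∀ i, ∀ᵐ ω ∂P, ContinuousOn (g (i + 1) ω) X) (i : ℕ) (L : ℝ) :
    P {ω | ∃ x ∈ X, L < |objective ε (fun t => g t ω) (i + 1) x|}
      ≤ P {ω | ∃ x ∈ X, L < |g 1 ω x|} := by
  have := hne.to_subtype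
  set e : ℕ → Pt d := fun m => (TopologicalSpace.denseSeq X m : Pt d) with he
  have heX : ∀ m, e m ∈ X := fun m => (TopologicalSpace.denseSeq X m).2
  have hm : ∀ i, AEMeasurable (fun ω m => objective ε (fun t => g t ω) (i + 1) (e m)) P :=
    fun i => aemeasurable_pi_lambda _ fun m => (h.memLp_objective ε i (heX m)).aemeasurable
  have hS : MeasurableSet {z : ℕ → ℝ | ∃ m, L < |z m|} := by
    have : {z : ℕ → ℝ | ∃ m, L < |z m|} = ⋃ m, {z : ℕ → ℝ | L < |z m|} := by ext; simp
    rw [this]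
    exact MeasurableSet.iUnion fun m =>
      measurableSet_lt measurable_const (measurable_pi_apply m).abs
  calc P {ω | ∃ x ∈ X, L < |objective ε (fun t => g t ω) (i + 1) x|}
      ≤ P ((fun ω m => objective ε (fun t => g t ω) (i + 1) (e m)) ⁻¹'
          {z : ℕ → ℝ | ∃ m, L < |z m|}) := by
        -- Path continuity reduces the supremum to a dense sequence, where the event is determined
        -- by countably many coordinates and hence by the finite-dimensional laws.
        refine measure_mono_ae ?_
        filter_upwards [ae_all_iff.2 hcont] with ω hω
        rintro ⟨x, hx, hLx⟩
        have hc := continuousOn_iff_continuous_domRestrict.1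
          (continuousOn_objective ε (g := fun t => g t ω) hω i)
        have hopen : IsOpen {z : X | L < |objective ε (fun t => g t ω) (i + 1) z|} :=
          isOpen_lt continuous_const hc.abs
        obtain ⟨m, hm⟩ := (TopologicalSpace.denseRange_denseSeq X).exists_mem_open hopen
          ⟨⟨x, hx⟩, hLx⟩
        exact ⟨m, hm⟩
    _ = P ((fun ω m => g 1 ω (e m)) ⁻¹' {z : ℕ → ℝ | ∃ m, L < |z m|}) := by
        rw [← Measure.map_apply_of_aemeasurable (hm i) hS, h.map_objective_eq hε i e heX]
        exact Measure.map_apply_of_aemeasurable (hm 0) hS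
    _ ≤ _ := measure_mono <| by
        rintro ω ⟨m, hm⟩
        exact ⟨e m, heX m, hm⟩

end IsModel

end Model

/-! ### Observations whose means depend on the past -/

section AdaptiveObservations

open scoped NNReal

/-- Extension of a finite sequence by zero. -/
def extend {n : ℕ} (y : Fin n → ℝ) : ℕ → ℝ := fun i => if h : i < n then y ⟨i, h⟩ else 0

theorem extend_apply {n : ℕ} (y : Fin n → ℝ) (i : Fin n) : extend y i = y i := by
  simp [extend]

theorem measurable_extend {n : ℕ} : Measurable (extend : (Fin n → ℝ) → ℕ → ℝ) := by
  refine measurable_pi_lambda _ fun i => ?_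
  by_cases h : i < n
  · simpa [extend, h] using measurable_pi_apply _
  · simp [extend, h]

/-- A functional of a sequence that depends on the first `i` terms only. -/
def Predictable {β : Type*} (i : ℕ) (m : (ℕ → ℝ) → β) : Prop :=
  ∀ y y' : ℕ → ℝ, (∀ j < i, y j = y' j) → m y = m y'

/-- The first `n` terms, followed by zeros, of the solution of `y i = m i y + w i`. -/
noncomputable def solvePrefix (m : ℕ → (ℕ → ℝ) → ℝ) (w : ℕ → ℝ) : ℕ → ℕ → ℝ
  | 0 => 0
  | n + 1 => Function.update (solvePrefix m w n) n (m n (solvePrefix m w n) + w n)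

/-- Uniqueness of the solution: each term is determined by the noise and the earlier terms. -/
theorem solvePrefix_eq {m : ℕ → (ℕ → ℝ) → ℝ} (hm : ∀ i, Predictable i (m i)) {w y : ℕ → ℝ} :
    ∀ n, (∀ i < n, y i = m i y + w i) →
      solvePrefix m w n = fun i => if i < n then y i else 0 := by
  intro n
  induction n with
  | zero => intro _; ext i; simp [solvePrefix]
  | succ n ih =>
    intro h
    have ih' := ih fun i hi => h i (by omega)
    have hmn : m n (solvePrefix m w n) = m n y :=
      hm n _ _ fun j hj => by rw [ih']; simp [hj]
    ext i
    rw [solvePrefix]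
    rcases eq_or_ne i n with rfl | hi
    · rw [Function.update_self, hmn, if_pos (Nat.lt_succ_self i), h i (Nat.lt_succ_self i)]
    · rw [Function.update_of_ne hi, ih']
      have : i < n + 1 ↔ i < n := by omega
      simp [this]

/-- The solution of `y i = m i y + w i`. -/
noncomputable def solve (m : ℕ → (ℕ → ℝ) → ℝ) (w : ℕ → ℝ) : ℕ → ℝ :=
  fun i => solvePrefix m w (i + 1) i

theorem solve_eq {m : ℕ → (ℕ → ℝ) → ℝ} (hm : ∀ i, Predictable i (m i)) (w : ℕ → ℝ) (i : ℕ) :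
    solve m w i = m i (solve m w) + w i := by
  have key : ∀ n, ∀ j < n, solvePrefix m w n j = solve m w j := by
    intro n
    induction n with
    | zero => intro j hj; omega
    | succ n ih =>
      intro j hj
      rcases eq_or_ne j n with rfl | hi
      · rfl
      · rw [solvePrefix, Function.update_of_ne hi, ih j (by omega)]
  rw [solve, solvePrefix, Function.update_self, hm i _ _ (key i)]

variable {E : Type*} [MeasurableSpace E]

theorem measurable_solvePrefix {m : ℕ → E → (ℕ → ℝ) → ℝ}
    (hm : ∀ i, Measurable fun p : E × (ℕ → ℝ) => m i p.1 p.2) (n : ℕ) :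
    Measurable fun p : E × (ℕ → ℝ) => solvePrefix (fun i => m i p.1) p.2 n := by
  induction n with
  | zero => exact measurable_const
  | succ n ih =>
    refine measurable_pi_lambda _ fun i => ?_
    simp only [solvePrefix]
    rcases eq_or_ne i n with rfl | hi
    · simp only [Function.update_self]
      exact ((hm i).comp (measurable_fst.prodMk ih)).add
        ((measurable_pi_apply i).comp measurable_snd)
    · simp only [Function.update_of_ne hi]
      exact (measurable_pi_apply i).comp ih

theorem extend_init {n : ℕ} (y : Fin (n + 1) → ℝ) (j : ℕ) (hj : j < n) :
    extend (fun i : Fin n => y i.castSucc) j = extend y j := by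
  simp [extend, hj, Nat.lt_succ_of_lt hj]

/-- Splitting off the last coordinate. -/
theorem measurePreserving_init_last (n : ℕ) :
    MeasurePreserving (fun y : Fin (n + 1) → ℝ => ((fun i : Fin n => y i.castSucc), y (Fin.last n)))
      volume (volume.prod volume) := by
  have h := (Measure.measurePreserving_swap (μ := (volume : Measure ℝ))
    (ν := (volume : Measure (Fin n → ℝ)))).comp
    (volume_preserving_piFinSuccAbove (fun _ : Fin (n + 1) => ℝ) (Fin.last n))
  have e : (fun y : Fin (n + 1) → ℝ => ((fun i : Fin n => y i.castSucc), y (Fin.last n)))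
      = Prod.swap ∘ MeasurableEquiv.piFinSuccAbove (fun _ => ℝ) (Fin.last n) := by
    ext y i
    · simp [Fin.init]
    · simp
  rw [e]
  exact h

theorem lintegral_init_last (n : ℕ) (f : (Fin n → ℝ) → ℝ → ℝ≥0∞)
    (hf : Measurable (Function.uncurry f)) :
    ∫⁻ y : Fin (n + 1) → ℝ, f (fun i => y i.castSucc) (y (Fin.last n))
      = ∫⁻ y', ∫⁻ a, f y' a := by
  refine Eq.trans ?_ (lintegral_prod (Function.uncurry f) hf.aemeasurable)
  rw [← (measurePreserving_init_last n).lintegral_comp hf]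
  rfl

theorem lintegral_prod_eq_prod_lintegral : ∀ {n : ℕ} (f : Fin n → ℝ → ℝ≥0∞),
    (∀ i, Measurable (f i)) → ∫⁻ y : Fin n → ℝ, ∏ i, f i (y i) = ∏ i, ∫⁻ a, f i a := by
  intro n
  induction n with
  | zero =>
    intro f _
    simp [volume_pi]
  | succ n ih =>
    intro f hf
    have h1 : Measurable fun y : Fin n → ℝ => ∏ i, f i.castSucc (y i) :=
      Finset.measurable_fun_prod _ fun i _ => (hf _).comp (measurable_pi_apply i)
    simp_rw [Fin.prod_univ_castSucc]
    rw [lintegral_init_last n (fun y' a => (∏ i : Fin n, f i.castSucc (y' i)) * f (Fin.last n) a)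
      ((h1.comp measurable_fst).mul ((hf _).comp measurable_snd))]
    simp_rw [lintegral_const_mul _ (hf (Fin.last n))]
    rw [lintegral_mul_const _ h1, ih _ fun i => hf _]

/-- Triangular shears preserve Lebesgue measure. -/
theorem measurePreserving_shear {m : ℕ → (ℕ → ℝ) → ℝ} (hm : ∀ i, Measurable (m i))
    (hp : ∀ i, Predictable i (m i)) (n : ℕ) :
    MeasurePreserving (fun (y : Fin n → ℝ) (i : Fin n) => y i - m i (extend y)) volume volume := by
  induction n with
  | zero =>
    convert MeasurePreserving.id volume using 1
  | succ n ih =>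
    have hs : MeasurePreserving (fun p : (Fin n → ℝ) × ℝ =>
        ((fun i : Fin n => p.1 i - m i (extend p.1)), p.2 - m n (extend p.1)))
        (volume.prod volume) (volume.prod volume) := by
      -- Given the earlier coordinates, the last one is merely translated, and translations preserve
      -- Lebesgue measure.
      refine ih.skew_product (g := fun y a => a - m n (extend y)) ?_ (ae_of_all _ fun y => ?_)
      · exact measurable_snd.sub ((hm n).comp (measurable_extend.comp measurable_fst))
      · exact (measurePreserving_sub_right volume (m n (extend y))).map_eq
    have hsplit : MeasurePreserving
        (((MeasurableEquiv.piFinSuccAbove (fun _ : Fin (n + 1) => ℝ) (Fin.last n)).trans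
        MeasurableEquiv.prodComm)) volume
        ((volume : Measure (Fin n → ℝ)).prod (volume : Measure ℝ)) := by
      have h := (Measure.measurePreserving_swap (μ := (volume : Measure ℝ))
        (ν := (volume : Measure (Fin n → ℝ)))).comp
        (volume_preserving_piFinSuccAbove (fun _ : Fin (n + 1) => ℝ) (Fin.last n))
      exact h
    have h := (hsplit.symm _).comp (hs.comp hsplit)
    convert h using 1
    ext y i
    refine Fin.lastCases ?_ (fun i => ?_) i
    · simp [MeasurableEquiv.piFinSuccAbove, Fin.insertNthEquiv]
      exact congrArg (y (Fin.last n) - ·) (hp n _ _ fun j hj => (extend_init y j hj).symm)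
    · simp [MeasurableEquiv.piFinSuccAbove, Fin.insertNthEquiv]
      exact congrArg (y i.castSucc - ·)
        (hp i _ _ fun j hj => (extend_init y j (hj.trans i.2)).symm)

theorem pi_gaussianReal (n : ℕ) {s : ℝ≥0} (hs : s ≠ 0) :
    Measure.pi (fun _ : Fin n => gaussianReal 0 s)
      = (volume : Measure (Fin n → ℝ)).withDensity fun y => ∏ i, gaussianPDF 0 s (y i) := by
  refine Measure.pi_eq fun t ht => ?_
  rw [withDensity_apply _ (MeasurableSet.univ_pi ht), ← lintegral_indicator
    (MeasurableSet.univ_pi ht)]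
  have : ∀ y : Fin n → ℝ, (Set.univ.pi t).indicator (fun y => ∏ i, gaussianPDF 0 s (y i)) y
      = ∏ i, (t i).indicator (gaussianPDF 0 s) (y i) := by
    intro y
    by_cases hy : y ∈ Set.univ.pi t
    · rw [Set.indicator_of_mem hy]
      exact Finset.prod_congr rfl fun i _ => by rw [Set.indicator_of_mem (hy i trivial)]
    · rw [Set.indicator_of_notMem hy]
      simp only [Set.mem_univ_pi, not_forall] at hy
      obtain ⟨i, hi⟩ := hy
      exact (Finset.prod_eq_zero (Finset.mem_univ i) (Set.indicator_of_notMem hi _)).symm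
  simp_rw [this]
  rw [lintegral_prod_eq_prod_lintegral (fun i => (t i).indicator (gaussianPDF 0 s))
    fun i => (measurable_gaussianPDF 0 s).indicator (ht i)]
  refine Finset.prod_congr rfl fun i _ => ?_
  rw [lintegral_indicator (ht i), gaussianReal_apply _ hs]

/-- The law of observations whose conditional means depend on an independent random element and on
the past observations. -/
theorem measure_adaptive {Ω : Type*} [MeasurableSpace Ω] {P : Measure Ω} [IsProbabilityMeasure P]
    {n : ℕ} {s : ℝ≥0} (hs : s ≠ 0) {m : ℕ → E → (ℕ → ℝ) → ℝ}
    (hm : ∀ i, Measurable fun p : E × (ℕ → ℝ) => m i p.1 p.2)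
    (hp : ∀ i φ, Predictable i (m i φ)) {Φ : Ω → E} (hΦ : AEMeasurable Φ P)
    {W Y : Ω → ℕ → ℝ} (hW : P.map (fun ω (i : Fin n) => W ω i)
      = Measure.pi fun _ => gaussianReal 0 s)
    (hWm : AEMeasurable (fun ω (i : Fin n) => W ω i) P)
    (hind : IndepFun Φ (fun ω (i : Fin n) => W ω i) P)
    (hY : ∀ᵐ ω ∂P, ∀ i < n, Y ω i = m i (Φ ω) (Y ω) + W ω i) {B : Set (Fin n → ℝ)}
    (hB : MeasurableSet B) :
    P {ω | (fun i : Fin n => Y ω i) ∈ B}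
      = ∫⁻ y in B, ∫⁻ ω, ∏ i : Fin n, gaussianPDF (m i (Φ ω) (extend y)) s (y i) ∂P := by
  -- S sends the random element and the noise to the observations, so the event becomes one about an
  -- independent pair.
  set S : E × (Fin n → ℝ) → Fin n → ℝ :=
    fun p i => solvePrefix (fun i => m i p.1) (extend p.2) n i with hS
  have hSm : Measurable S := measurable_pi_lambda _ fun i => (measurable_pi_apply (i : ℕ)).comp
    ((measurable_solvePrefix hm n).comp (measurable_fst.prodMk (measurable_extend.comp
      measurable_snd)))
  have hSsol : ∀ φ (y : ℕ → ℝ) (w : Fin n → ℝ), (∀ i : Fin n, y i = m i φ y + w i) →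
      S (φ, w) = fun i : Fin n => y i := by
    intro φ y w h
    ext i
    have := solvePrefix_eq (m := fun i => m i φ) (fun i => hp i φ) (w := extend w) (y := y) n
      fun i hi => by rw [extend_apply w ⟨i, hi⟩]; exact h ⟨i, hi⟩
    simp only [hS, this, if_pos i.2]
  have hA : MeasurableSet (S ⁻¹' B) := hSm hB
  have hpdf : ∀ i : Fin n, Measurable fun q : E × (Fin n → ℝ) =>
      gaussianPDF (m i q.1 (extend q.2)) s (q.2 i) := fun i =>
    measurable_uncurry_gaussianPDF.comp (((hm i).comp (measurable_fst.prodMk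
      (measurable_extend.comp measurable_snd))).prodMk
      (measurable_const.prodMk ((measurable_pi_apply i).comp measurable_snd)))
  have hprodm : Measurable fun q : E × (Fin n → ℝ) =>
      ∏ i : Fin n, gaussianPDF (m i q.1 (extend q.2)) s (q.2 i) :=
    Finset.measurable_fun_prod _ fun i _ => hpdf i
  have h1 : P {ω | (fun i : Fin n => Y ω i) ∈ B}
      = P ((fun ω => (Φ ω, fun i : Fin n => W ω i)) ⁻¹' (S ⁻¹' B)) := by
    refine measure_congr ?_
    filter_upwards [hY] with ω hω
    have := hSsol (Φ ω) (Y ω) (fun i => W ω i) fun i => hω i i.2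
    refine propext ?_
    change (fun i : Fin n => Y ω i) ∈ B ↔ S (Φ ω, fun i => W ω i) ∈ B
    rw [this]
  have hprobΦ : IsProbabilityMeasure (P.map Φ) := P.isProbabilityMeasure_map hΦ
  rw [h1, ← Measure.map_apply_of_aemeasurable (hΦ.prodMk hWm) hA,
    (indepFun_iff_map_prod_eq_prod_map_map hΦ hWm).1 hind, hW, Measure.prod_apply hA]
  have h2 : ∀ φ, (Measure.pi fun _ : Fin n => gaussianReal 0 s) (Prod.mk φ ⁻¹' (S ⁻¹' B))
      = ∫⁻ y in B, ∏ i : Fin n, gaussianPDF (m i φ (extend y)) s (y i) := by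
    intro φ
    have hmφ : ∀ i, Measurable (m i φ) := fun i => (hm i).comp measurable_prodMk_left
    have hmeas : MeasurableSet (Prod.mk φ ⁻¹' (S ⁻¹' B)) := measurable_prodMk_left hA
    have hdens : Measurable fun y : Fin n → ℝ => ∏ i, gaussianPDF 0 s (y i) :=
      Finset.measurable_fun_prod _ fun i _ => (measurable_gaussianPDF 0 s).comp
        (measurable_pi_apply i)
    -- With φ frozen, the change of variables w = y - m(y) is a triangular shear, so the noise
    -- density at w is the density of the observations at y.
    rw [pi_gaussianReal n hs, withDensity_apply _ hmeas, ← lintegral_indicator hmeas,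
      ← lintegral_indicator hB, ← (measurePreserving_shear hmφ (fun i => hp i φ) n).lintegral_comp
        (hdens.indicator hmeas)]
    refine lintegral_congr fun y => ?_
    have hSy : S (φ, fun i : Fin n => y i - m i φ (extend y)) = y := by
      rw [hSsol φ (extend y) _ fun i => by rw [extend_apply]; ring]
      ext i
      exact extend_apply y i
    have hmem : (fun i : Fin n => y i - m i φ (extend y)) ∈ Prod.mk φ ⁻¹' (S ⁻¹' B) ↔ y ∈ B := by
      simp only [Set.mem_preimage, hSy]
    by_cases hyB : y ∈ B
    · rw [Set.indicator_of_mem (hmem.2 hyB), Set.indicator_of_mem hyB]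
      refine Finset.prod_congr rfl fun i _ => ?_
      rw [gaussianPDF, gaussianPDF, gaussianPDFReal_sub, zero_add]
    · rw [Set.indicator_of_notMem (fun h => hyB (hmem.1 h)), Set.indicator_of_notMem hyB]
  simp_rw [h2]
  rw [lintegral_lintegral_swap hprodm.aemeasurable]
  refine lintegral_congr fun y => ?_
  exact lintegral_map' (hprodm.comp measurable_prodMk_right).aemeasurable hΦ

end AdaptiveObservations

/-! ### Innovations under a predictable covariance -/

section SequentialDensity

open Matrix
open scoped NNReal

theorem measurable_det {α ι : Type*} [MeasurableSpace α] [Fintype ι] [DecidableEq ι]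
    {M : α → Matrix ι ι ℝ} (hM : ∀ i j, Measurable fun a => M a i j) :
    Measurable fun a => (M a).det := by
  simp only [det_apply']
  exact Finset.measurable_fun_sum _ fun τ _ => measurable_const.mul
    (Finset.measurable_fun_prod _ fun i _ => hM _ _)

/-- Cramer's formula, with inverse 0 at determinant 0, is measurable without any invertibility
assumption. -/
theorem measurable_inv_apply {α ι : Type*} [MeasurableSpace α] [Fintype ι] [DecidableEq ι]
    {M : α → Matrix ι ι ℝ} (hM : ∀ i j, Measurable fun a => M a i j) (i j : ι) :
    Measurable fun a => (M a)⁻¹ i j := by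
  simp only [inv_def, Ring.inverse_eq_inv', Matrix.smul_apply, adjugate_apply, smul_eq_mul]
  refine (measurable_det hM).inv.mul (measurable_det fun a b => ?_)
  simp only [updateRow_apply]
  split_ifs
  · exact measurable_const
  · exact hM _ _

theorem measurable_dotProduct_inv_mulVec {α ι : Type*} [MeasurableSpace α] [Fintype ι]
    [DecidableEq ι] {M : α → Matrix ι ι ℝ} (hM : ∀ i j, Measurable fun a => M a i j)
    {u v : α → ι → ℝ} (hu : ∀ i, Measurable fun a => u a i) (hv : ∀ i, Measurable fun a => v a i) :
    Measurable fun a => u a ⬝ᵥ (M a)⁻¹ *ᵥ v a := by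
  simp only [dotProduct, mulVec]
  exact Finset.measurable_fun_sum _ fun i _ => (hu i).mul
    (Finset.measurable_fun_sum _ fun j _ => (measurable_inv_apply hM i j).mul (hv j))

theorem measurable_gaussDensity {α ι : Type*} [MeasurableSpace α] [Fintype ι] [DecidableEq ι]
    {M : α → Matrix ι ι ℝ} (hM : ∀ i j, Measurable fun a => M a i j)
    {u : α → ι → ℝ} (hu : ∀ i, Measurable fun a => u a i) :
    Measurable fun a => gaussDensity (M a) (u a) := by
  unfold gaussDensity
  exact ((measurable_const.mul (measurable_det hM)).sqrt.inv).mul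
    (((measurable_dotProduct_inv_mulVec hM hu hu).neg.div_const 2).exp)

/-- The two-sided tail of the standard Gaussian distribution. -/
noncomputable def gaussTail (c : ℝ) : ℝ≥0∞ := gaussianReal 0 1 {z | c < |z|}

/-- Standardisation when the threshold is calibrated to the variance S but the true variance is cS:
the tail depends on neither the mean nor S. -/
theorem gaussianReal_abs_sub_gt {c S : ℝ} (hc : 0 < c) (hS : 0 < S) (μ ρ : ℝ) :
    gaussianReal μ (c * S).toNNReal {a | √ρ * √S < |a - μ|} = gaussTail (√(ρ / c)) := by
  have hcS : 0 < √(c * S) := Real.sqrt_pos.2 (by positivity)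
  have h1 : (gaussianReal 0 1).map (fun z => μ + √(c * S) * z)
      = gaussianReal μ (c * S).toNNReal := by
    have e : (fun z : ℝ => μ + √(c * S) * z) = (fun z => μ + z) ∘ fun z => √(c * S) * z := rfl
    rw [e, ← Measure.map_map (by fun_prop) (by fun_prop), gaussianReal_map_const_mul,
      gaussianReal_map_const_add]
    congr 1
    · simp
    · ext
      have : 0 ≤ c * S := by positivity
      simp [Real.sq_sqrt this, this]
  rw [← h1, Measure.map_apply (by fun_prop)
    (measurableSet_lt measurable_const (by fun_prop)), gaussTail]
  congr 1
  ext z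
  simp only [Set.mem_preimage, Set.mem_ofPred_eq, add_sub_cancel_left, abs_mul, abs_of_pos hcS]
  rw [Real.sqrt_div' _ hc.le, Real.sqrt_mul hc.le, mul_comm √c, mul_assoc, mul_comm √ρ,
    mul_lt_mul_iff_right₀ (Real.sqrt_pos.2 hS), div_lt_iff₀' (Real.sqrt_pos.2 hc)]

/-- The `n × n` matrix with entries `K i j y`. -/
def seqMatrix (K : ℕ → ℕ → (ℕ → ℝ) → ℝ) (n : ℕ) (y : ℕ → ℝ) : Matrix (Fin n) (Fin n) ℝ :=
  Matrix.of fun i j => K i j y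

variable {K : ℕ → ℕ → (ℕ → ℝ) → ℝ}

theorem lead_seqMatrix (n : ℕ) (y : ℕ → ℝ) :
    lead (seqMatrix K (n + 1) y) = seqMatrix K n y := rfl

/-- The matrix of size n + 1 depends on only n observations, because the last query is chosen before
its measurement is seen. Hence the conditional mean and variance are predictable. -/
theorem seqMatrix_congr (hKp : ∀ i j, Predictable (max i j) (K i j)) {n : ℕ} {y y' : ℕ → ℝ}
    (h : ∀ j < n, y j = y' j) : seqMatrix K (n + 1) y = seqMatrix K (n + 1) y' := by
  ext i j
  exact hKp i j _ _ fun l hl => h l (by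
    have hi := i.2
    have hj := j.2
    rcases lt_max_iff.1 hl with h' | h' <;> omega)

/-- The conditional mean of the next observation. -/
noncomputable def seqMean (K : ℕ → ℕ → (ℕ → ℝ) → ℝ) (n : ℕ) (y : ℕ → ℝ) : ℝ :=
  border (seqMatrix K (n + 1) y) ⬝ᵥ (seqMatrix K n y)⁻¹ *ᵥ fun i : Fin n => y i

/-- The conditional variance of the next observation. -/
noncomputable def seqVar (K : ℕ → ℕ → (ℕ → ℝ) → ℝ) (n : ℕ) (y : ℕ → ℝ) : ℝ :=
  schur (seqMatrix K (n + 1) y)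

theorem seqMean_congr (hKp : ∀ i j, Predictable (max i j) (K i j)) (n : ℕ) :
    Predictable n (seqMean K n) := by
  intro y y' h
  unfold seqMean
  rw [← lead_seqMatrix n y, ← lead_seqMatrix n y', seqMatrix_congr hKp h]
  congr 3
  ext i
  exact h i i.2

theorem seqVar_congr (hKp : ∀ i j, Predictable (max i j) (K i j)) (n : ℕ) :
    Predictable n (seqVar K n) := fun y y' h => by
  unfold seqVar
  rw [seqMatrix_congr hKp h]

theorem measurable_seqMean (hKm : ∀ i j, Measurable (K i j)) (n : ℕ) :
    Measurable (seqMean K n) :=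
  measurable_dotProduct_inv_mulVec (M := fun y => seqMatrix K n y)
    (u := fun y => border (seqMatrix K (n + 1) y)) (fun i j => hKm i j)
    (fun _ => hKm _ _) fun _ => measurable_pi_apply _

theorem measurable_seqVar (hKm : ∀ i j, Measurable (K i j)) (n : ℕ) :
    Measurable (seqVar K n) :=
  (hKm n n).sub (measurable_dotProduct_inv_mulVec
    (M := fun y => seqMatrix K n y) (u := fun y => border (seqMatrix K (n + 1) y))
    (v := fun y => border (seqMatrix K (n + 1) y)) (fun i j => hKm i j)
    (fun _ => hKm _ _) fun _ => hKm _ _)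

/-- Inflating the covariance by c keeps the conditional means and multiplies the conditional
variances by c. Although the matrix depends on y, the chain rule survives because it depends only on
the past coordinates. -/
theorem gaussDensity_seq_succ (hKp : ∀ i j, Predictable (max i j) (K i j))
    (hpos : ∀ n y, (seqMatrix K n y).PosDef) {c : ℝ} (hc : 0 < c) (n : ℕ)
    (y : Fin (n + 1) → ℝ) :
    gaussDensity (c • seqMatrix K (n + 1) (extend y)) y
      = gaussDensity (c • seqMatrix K n (extend fun i : Fin n => y i.castSucc))
          (fun i => y i.castSucc)
        * gaussianPDFReal (seqMean K n (extend fun i : Fin n => y i.castSucc))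
          (c * seqVar K n (extend fun i : Fin n => y i.castSucc)).toNNReal (y (Fin.last n)) := by
  have hext : ∀ j < n, extend y j = extend (fun i : Fin n => y i.castSucc) j :=
    fun j hj => (extend_init y j hj).symm
  rw [gaussDensity_succ ((hpos _ _).smul hc), seqMatrix_congr hKp hext]
  set z := extend fun i : Fin n => y i.castSucc with hz
  have hl : lead (c • seqMatrix K (n + 1) z) = c • seqMatrix K n z := rfl
  have hb : border (c • seqMatrix K (n + 1) z) = c • border (seqMatrix K (n + 1) z) := rfl
  have hu : IsUnit (seqMatrix K n z).det :=
    (Matrix.isUnit_iff_isUnit_det _).1 (hpos n z).isUnit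
  have hinv : (c • seqMatrix K n z)⁻¹ = c⁻¹ • (seqMatrix K n z)⁻¹ := by
    refine inv_eq_right_inv ?_
    rw [Matrix.smul_mul, Matrix.mul_smul, smul_smul, mul_inv_cancel₀ hc.ne', one_smul,
      mul_nonsing_inv _ hu]
  have hs : schur (c • seqMatrix K (n + 1) z) = c * seqVar K n z := by
    rw [schur, seqVar, schur, hl, hb, hinv, lead_seqMatrix, smul_mulVec, mulVec_smul, smul_smul,
      inv_mul_cancel₀ hc.ne', one_smul, smul_dotProduct, Matrix.smul_apply, smul_eq_mul,
      smul_eq_mul, mul_sub]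
  have hm : border (c • seqMatrix K (n + 1) z) ⬝ᵥ (c • seqMatrix K n z)⁻¹ *ᵥ
      (fun i => y i.castSucc) = seqMean K n z := by
    have hy : (fun i : Fin n => z i) = fun i : Fin n => y i.castSucc := by
      ext i
      exact extend_apply _ i
    rw [seqMean, hy, hb, hinv, smul_mulVec, dotProduct_smul, smul_dotProduct, smul_smul,
      inv_mul_cancel₀ hc.ne', one_smul]
  rw [hl, hs, hm]

theorem seqVar_pos (hpos : ∀ n y, (seqMatrix K n y).PosDef) (n : ℕ) (y : ℕ → ℝ) :
    0 < seqVar K n y := schur_pos (hpos _ _)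

/-- Integrating out the last observation. This yields both the total mass 1 and the innovation tail.
-/
theorem lintegral_gaussDensity_seq_mul (hKp : ∀ i j, Predictable (max i j) (K i j))
    (hKm : ∀ i j, Measurable (K i j)) (hpos : ∀ n y, (seqMatrix K n y).PosDef) {c : ℝ}
    (hc : 0 < c) (n : ℕ) (h : (ℕ → ℝ) → ℝ → ℝ≥0∞) (hh : Measurable (Function.uncurry h)) :
    ∫⁻ y : Fin (n + 1) → ℝ, ENNReal.ofReal (gaussDensity (c • seqMatrix K (n + 1) (extend y)) y)
        * h (extend fun i : Fin n => y i.castSucc) (y (Fin.last n))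
      = ∫⁻ y : Fin n → ℝ, ENNReal.ofReal (gaussDensity (c • seqMatrix K n (extend y)) y) *
        ∫⁻ a, h (extend y) a ∂(gaussianReal (seqMean K n (extend y))
          (c * seqVar K n (extend y)).toNNReal) := by
  have hpdf : Measurable fun p : (Fin n → ℝ) × ℝ => gaussianPDF (seqMean K n (extend p.1))
      (c * seqVar K n (extend p.1)).toNNReal p.2 :=
    measurable_uncurry_gaussianPDF.comp ((((measurable_seqMean hKm n).comp
      (measurable_extend.comp measurable_fst))).prodMk (((((measurable_seqVar hKm n).comp
      (measurable_extend.comp measurable_fst)).const_mul c).real_toNNReal).prodMk measurable_snd))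
  have hg : Measurable fun y : Fin n → ℝ =>
      ENNReal.ofReal (gaussDensity (c • seqMatrix K n (extend y)) y) :=
    (measurable_gaussDensity (M := fun y : Fin n → ℝ => c • seqMatrix K n (extend y))
      (u := fun y => y) (fun i j => ((hKm i j).comp measurable_extend).const_mul c)
      fun i => measurable_pi_apply i).ennreal_ofReal
  have hh' : Measurable fun p : (Fin n → ℝ) × ℝ => h (extend p.1) p.2 :=
    hh.comp ((measurable_extend.comp measurable_fst).prodMk measurable_snd)
  have key := lintegral_init_last n (fun y a =>
    ENNReal.ofReal (gaussDensity (c • seqMatrix K n (extend y)) y) *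
      (gaussianPDF (seqMean K n (extend y)) (c * seqVar K n (extend y)).toNNReal a
        * h (extend y) a)) ((hg.comp measurable_fst).mul (hpdf.mul hh'))
  refine Eq.trans (lintegral_congr fun y => ?_) (key.trans (lintegral_congr fun y => ?_))
  · rw [gaussDensity_seq_succ hKp hpos hc, ENNReal.ofReal_mul, mul_assoc]
    · rfl
    · unfold gaussDensity
      positivity
  · have h1 : Measurable fun a => h (extend y) a := hh'.comp measurable_prodMk_left
    have h2 : (c * seqVar K n (extend y)).toNNReal ≠ 0 := by
      have := seqVar_pos hpos n (extend y)
      simp only [ne_eq, Real.toNNReal_eq_zero, not_le]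
      positivity
    have h3 : Measurable fun a => gaussianPDF (seqMean K n (extend y))
        (c * seqVar K n (extend y)).toNNReal a * h (extend y) a :=
      (measurable_gaussianPDF _ _).mul h1
    rw [lintegral_const_mul _ h3,
      gaussianReal_of_var_ne_zero _ h2, lintegral_withDensity_eq_lintegral_mul _
      (measurable_gaussianPDF _ _) h1]
    rfl

theorem lintegral_gaussDensity_seq (hKp : ∀ i j, Predictable (max i j) (K i j))
    (hKm : ∀ i j, Measurable (K i j)) (hpos : ∀ n y, (seqMatrix K n y).PosDef) {c : ℝ}
    (hc : 0 < c) (n : ℕ) :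
    ∫⁻ y : Fin n → ℝ, ENNReal.ofReal (gaussDensity (c • seqMatrix K n (extend y)) y) = 1 := by
  induction n with
  | zero => simp [gaussDensity, volume_pi]
  | succ n ih =>
    have := lintegral_gaussDensity_seq_mul hKp hKm hpos hc n (fun _ _ => 1) measurable_const
    simp only [mul_one, lintegral_const, measure_univ] at this
    rw [this, ih]

/-- The probability, under the sequential Gaussian density, of a large innovation. -/
theorem lintegral_gaussDensity_innovation (hKp : ∀ i j, Predictable (max i j) (K i j))
    (hKm : ∀ i j, Measurable (K i j)) (hpos : ∀ n y, (seqMatrix K n y).PosDef) {c : ℝ}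
    (hc : 0 < c) (n : ℕ) (ρ : ℝ) :
    ∫⁻ y in {y : Fin (n + 1) → ℝ | √ρ * √(seqVar K n (extend y))
        < |y (Fin.last n) - seqMean K n (extend y)|},
      ENNReal.ofReal (gaussDensity (c • seqMatrix K (n + 1) (extend y)) y)
      = gaussTail (√(ρ / c)) := by
  have hA : MeasurableSet {p : (ℕ → ℝ) × ℝ | √ρ * √(seqVar K n p.1) < |p.2 - seqMean K n p.1|} :=
    measurableSet_lt (((measurable_seqVar hKm n).comp measurable_fst).sqrt.const_mul _)
      ((measurable_snd.sub ((measurable_seqMean hKm n).comp measurable_fst)).abs)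
  have hext : ∀ (y : Fin (n + 1) → ℝ), ∀ j < n,
      extend y j = extend (fun i : Fin n => y i.castSucc) j :=
    fun y j hj => (extend_init y j hj).symm
  have hB : {y : Fin (n + 1) → ℝ | √ρ * √(seqVar K n (extend y))
        < |y (Fin.last n) - seqMean K n (extend y)|}
      = (fun y : Fin (n + 1) → ℝ => (extend (fun i : Fin n => y i.castSucc), y (Fin.last n))) ⁻¹'
        {p : (ℕ → ℝ) × ℝ | √ρ * √(seqVar K n p.1) < |p.2 - seqMean K n p.1|} := by
    ext y
    simp only [Set.mem_ofPred_eq, Set.mem_preimage]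
    rw [seqVar_congr hKp n _ _ (hext y), seqMean_congr hKp n _ _ (hext y)]
  have hBm : MeasurableSet {y : Fin (n + 1) → ℝ | √ρ * √(seqVar K n (extend y))
        < |y (Fin.last n) - seqMean K n (extend y)|} := by
    rw [hB]
    refine hA.preimage (Measurable.prodMk (measurable_extend.comp ?_) (measurable_pi_apply _))
    exact measurable_pi_lambda _ fun i => measurable_pi_apply _
  have key := lintegral_gaussDensity_seq_mul hKp hKm hpos hc n
    (fun y a => Set.indicator {p : (ℕ → ℝ) × ℝ | √ρ * √(seqVar K n p.1) < |p.2 - seqMean K n p.1|}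
      (fun _ => 1) (y, a)) (measurable_const.indicator hA)
  rw [← lintegral_indicator hBm]
  refine Eq.trans (lintegral_congr fun y => ?_) (key.trans ?_)
  · by_cases hy : y ∈ {y : Fin (n + 1) → ℝ | √ρ * √(seqVar K n (extend y))
        < |y (Fin.last n) - seqMean K n (extend y)|}
    · rw [Set.indicator_of_mem hy, Set.indicator_of_mem (by rw [hB] at hy; exact hy), mul_one]
    · rw [Set.indicator_of_notMem hy, Set.indicator_of_notMem (by rw [hB] at hy; exact hy),
        mul_zero]
  · have h1 : ∀ y : ℕ → ℝ, ∫⁻ a, Set.indicator {p : (ℕ → ℝ) × ℝ | √ρ * √(seqVar K n p.1)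
        < |p.2 - seqMean K n p.1|} (fun _ => 1) (y, a) ∂(gaussianReal (seqMean K n y)
          (c * seqVar K n y).toNNReal) = gaussTail (√(ρ / c)) := by
      intro y
      rw [← gaussianReal_abs_sub_gt hc (seqVar_pos hpos n y) (seqMean K n y) ρ]
      exact lintegral_indicator_one (measurable_prodMk_left hA)
    simp_rw [h1]
    -- The conditional tail is the same for every past, so it factors out of an integral of total
    -- mass 1.
    rw [lintegral_mul_const', lintegral_gaussDensity_seq hKp hKm hpos hc, one_mul]
    exact measure_ne_top _ _

end SequentialDensity

/-! ### Measurable evaluation at random points -/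

section Evaluation

open Filter Topology
open scoped NNReal

variable {d : ℕ}

/-- Evaluation at `x` of the function with value `z m` at the point `e m` of a dense sequence. -/
noncomputable def denseEval (e : ℕ → Pt d) (z : ℕ → ℝ) (x : Pt d) : ℝ :=
  limsup (fun N => z (SimpleFunc.nearestPtInd e N x)) atTop

/-- The evaluation of a path at a data-dependent point must be jointly measurable in the path and
the point. Nearest points among finitely many give this, and the limsup keeps it even where no limit
exists. -/
theorem measurable_denseEval (e : ℕ → Pt d) :
    Measurable fun p : (ℕ → ℝ) × Pt d => denseEval e p.1 p.2 := by
  refine Measurable.limsup fun N => ?_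
  have h : Measurable fun p : (ℕ → ℝ) × ℕ => p.1 p.2 :=
    measurable_from_prod_countable_left fun m => measurable_pi_apply m
  exact h.comp (measurable_fst.prodMk
    ((SimpleFunc.nearestPtInd e N).measurable.comp measurable_snd))

theorem denseEval_eq {e : ℕ → Pt d} {X : Set (Pt d)} (he : ∀ m, e m ∈ X)
    (hX : X ⊆ closure (Set.range e)) {f : Pt d → ℝ} (hf : ContinuousOn f X) {x : Pt d}
    (hx : x ∈ X) : denseEval e (fun m => f (e m)) x = f x := by
  have h1 := SimpleFunc.tendsto_nearestPt (hX hx)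
  have h2 : Tendsto (fun N => SimpleFunc.nearestPt e N x) atTop (𝓝[X] x) :=
    tendsto_nhdsWithin_iff.2 ⟨h1, Eventually.of_forall fun N => he _⟩
  exact ((hf x hx).tendsto.comp h2).limsup_eq

attribute [irreducible] denseEval

theorem exists_dense_seq {X : Set (Pt d)} (hne : X.Nonempty) :
    ∃ e : ℕ → Pt d, (∀ m, e m ∈ X) ∧ X ⊆ closure (Set.range e) := by
  have := hne.to_subtype
  refine ⟨fun m => (TopologicalSpace.denseSeq X m : Pt d),
    fun m => (TopologicalSpace.denseSeq X m).2, fun x hx => ?_⟩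
  have h1 : (⟨x, hx⟩ : X) ∈ closure (Set.range (TopologicalSpace.denseSeq X)) :=
    TopologicalSpace.denseRange_denseSeq X _
  have h2 := image_closure_subset_closure_image continuous_subtype_val
    (Set.mem_image_of_mem _ h1)
  rwa [← Set.range_comp] at h2

theorem measurable_integral_denseEval_mul (e : ℕ → Pt d) (ν : Measure (ℕ → ℝ)) [SFinite ν] :
    Measurable fun p : Pt d × Pt d => ∫ z, denseEval e z p.1 * denseEval e z p.2 ∂ν := by
  have h1 : Measurable fun q : (Pt d × Pt d) × (ℕ → ℝ) => denseEval e q.2 q.1.1 :=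
    (measurable_denseEval e).comp (measurable_snd.prodMk (measurable_fst.comp measurable_fst))
  have h2 : Measurable fun q : (Pt d × Pt d) × (ℕ → ℝ) => denseEval e q.2 q.1.2 :=
    (measurable_denseEval e).comp (measurable_snd.prodMk (measurable_snd.comp measurable_fst))
  exact ((h1.mul h2).stronglyMeasurable.integral_prod_right' (ν := ν)).measurable

/-- On `X`, the kernel agrees with a jointly measurable function. -/
theorem IsModel.exists_measurable_kernel {Ω : Type*} [MeasurableSpace Ω] {P : Measure Ω}
    {X : Set (Pt d)} {k : Pt d → Pt d → ℝ} {σ : ℝ} {g : ℕ → Ω → Pt d → ℝ} {w : ℕ → Ω → ℝ}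
    (h : IsModel P X k σ g w) (hne : X.Nonempty) (hcont : ∀ᵐ ω ∂P, ContinuousOn (g 1 ω) X) :
    ∃ k' : Pt d → Pt d → ℝ, Measurable (Function.uncurry k') ∧
      ∀ x ∈ X, ∀ x' ∈ X, k' x x' = k x x' := by
  have := h.isProbabilityMeasure
  obtain ⟨e, he, heX⟩ := exists_dense_seq hne
  have hm : AEMeasurable (fun ω m => g 1 ω (e m)) P :=
    aemeasurable_pi_lambda _ fun m => (h.memLp_gp 0 (he m)).aemeasurable
  set ν := P.map fun ω m => g 1 ω (e m) with hν
  have hνp : IsProbabilityMeasure ν := P.isProbabilityMeasure_map hm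
  -- Joint measurability of k is derived from its being a covariance, written as an integral over
  -- the law of g_1 on a dense sequence.
  refine ⟨fun x x' => ∫ z, denseEval e z x * denseEval e z x' ∂ν, ?_, fun x hx x' hx' => ?_⟩
  · exact measurable_integral_denseEval_mul e ν
  · have h0 : ∀ x, Measurable fun z : ℕ → ℝ => denseEval e z x := fun x =>
      (measurable_denseEval e).comp (measurable_id.prodMk measurable_const)
    have h1 : Measurable fun z : ℕ → ℝ => denseEval e z x * denseEval e z x' :=
      (h0 x).mul (h0 x')
    have h2 := covariance_eq_sub (h.memLp_gp 0 hx) (h.memLp_gp 0 hx')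
    rw [(h.gp 1 le_rfl).cov x hx x' hx', (h.gp 1 le_rfl).mean x hx, zero_mul, sub_zero] at h2
    rw [h2]
    refine (integral_map hm h1.aestronglyMeasurable).trans ?_
    refine integral_congr_ae ?_
    filter_upwards [hcont] with ω hω
    rw [denseEval_eq he heX hω hx, denseEval_eq he heX hω hx']
    rfl

end Evaluation

/-! ### The queries without resets -/

section Design

open Matrix

variable {d : ℕ}

/-- The dataset after `n` steps without a reset and with measurements `y 0, y 1, …`. -/
def hist (sel : ℕ → Dataset d → Pt d) (y : ℕ → ℝ) : ℕ → Dataset d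
  | 0 => []
  | n + 1 => hist sel y n ++ [(sel (n + 1) (hist sel y n), y n)]

/-- The query location after `n` steps without a reset. -/
def design (sel : ℕ → Dataset d → Pt d) (n : ℕ) (y : ℕ → ℝ) : Pt d := sel (n + 1) (hist sel y n)

variable {sel : ℕ → Dataset d → Pt d}

theorem hist_eq_ofFn (y : ℕ → ℝ) (n : ℕ) :
    hist sel y n = List.ofFn fun i : Fin n => (design sel i y, y i) := by
  induction n with
  | zero => rfl
  | succ n ih =>
    rw [List.ofFn_succ_last, hist, ih]
    simp [design, ih]

theorem hist_congr (n : ℕ) : Predictable n fun y => hist sel y n := by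
  induction n with
  | zero => exact fun _ _ _ => rfl
  | succ n ih =>
    intro y y' h
    have := ih y y' fun j hj => h j (by omega)
    simp only [hist] at this ⊢
    rw [this, h n (Nat.lt_succ_self n)]

theorem design_congr (n : ℕ) : Predictable n (design sel n) := fun y y' h => by
  exact congrArg (sel (n + 1)) (hist_congr n y y' h)

theorem design_mem {X : Set (Pt d)} {k : Pt d → Pt d → ℝ} {σ : ℝ} {β : ℕ → ℝ}
    (hsel : IsArgmaxRule X k σ β sel) (n : ℕ) (y : ℕ → ℝ) : design sel n y ∈ X := by
  have key : ∀ n, ∀ p ∈ hist sel y n, p.1 ∈ X := by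
    intro n
    induction n with
    | zero => simp [hist]
    | succ n ih =>
      intro p hp
      rcases List.mem_append.1 hp with hp | hp
      · exact ih p hp
      · rw [List.mem_singleton.1 hp]
        exact hsel.mem _ (by omega) _ ih
  exact hsel.mem _ (by omega) _ (key n)

/-- The query after n steps is a measurable function of the n earlier pairs, so measurability
propagates by strong induction. -/
theorem measurable_design (hsel : ∀ t n, Measurable fun v : Fin n → Pt d × ℝ => sel t (List.ofFn v))
    (n : ℕ) : Measurable (design sel n) := by
  induction n using Nat.strong_induction_on with
  | _ n ih =>
    have h : design sel n = (fun v : Fin n → Pt d × ℝ => sel (n + 1) (List.ofFn v)) ∘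
        fun y i => (design sel i y, y i) := by
      ext1 y
      rw [design, hist_eq_ofFn]
      rfl
    rw [h]
    exact (hsel _ _).comp (measurable_pi_lambda _ fun i => (ih i i.2).prodMk (measurable_pi_apply _))

theorem get_ofFn_of_eq {α : Type*} {D : List α} {f : Fin D.length → α} (hD : D = List.ofFn f)
    (i : Fin D.length) : D.get i = f i := by
  have h := congrArg (fun l : List α => l[(i : ℕ)]?) hD
  simpa using h

theorem postMean_eq (k : Pt d → Pt d → ℝ) (σ : ℝ) {n : ℕ} (p : Fin n → Pt d) (v : Fin n → ℝ)
    {D : Dataset d} (hD : D = List.ofFn fun i => (p i, v i)) (x : Pt d) :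
    postMean k σ D x = (fun i => k (p i) x) ⬝ᵥ (gram k p + σ ^ 2 • 1)⁻¹ *ᵥ v := by
  obtain rfl : D.length = n := by rw [hD, List.length_ofFn]
  have h := get_ofFn_of_eq hD
  have h1 : kvec k D x = fun i => k (p i) x := funext fun i => by rw [kvec, h]
  have h2 : yvec D = v := funext fun i => by rw [yvec, h]
  have h3 : (fun i => (D.get i).1) = p := funext fun i => by rw [h]
  rw [postMean, regGram, h1, h2, h3]

theorem postStd_eq (k : Pt d → Pt d → ℝ) (σ : ℝ) {n : ℕ} (p : Fin n → Pt d) (v : Fin n → ℝ)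
    {D : Dataset d} (hD : D = List.ofFn fun i => (p i, v i)) (x : Pt d) :
    postStd k σ D x = √(k x x - (fun i => k (p i) x) ⬝ᵥ (gram k p + σ ^ 2 • 1)⁻¹ *ᵥ
      fun i => k (p i) x) := by
  obtain rfl : D.length = n := by rw [hD, List.length_ofFn]
  have h := get_ofFn_of_eq hD
  have h1 : kvec k D x = fun i => k (p i) x := funext fun i => by rw [kvec, h]
  have h3 : (fun i => (D.get i).1) = p := funext fun i => by rw [h]
  rw [postStd, regGram, h1, h3]

/-- The covariances of the observations of a time-invariant objective. -/
noncomputable def obsKernel (k : Pt d → Pt d → ℝ) (σ : ℝ) (sel : ℕ → Dataset d → Pt d)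
    (i j : ℕ) (y : ℕ → ℝ) : ℝ :=
  k (design sel i y) (design sel j y) + if i = j then σ ^ 2 else 0

theorem obsKernel_congr (k : Pt d → Pt d → ℝ) (σ : ℝ) (i j : ℕ) :
    Predictable (max i j) (obsKernel k σ sel i j) := fun y y' h => by
  rw [obsKernel, obsKernel, design_congr i y y' fun l hl => h l (lt_max_of_lt_left hl),
    design_congr j y y' fun l hl => h l (lt_max_of_lt_right hl)]

theorem measurable_obsKernel {k : Pt d → Pt d → ℝ} (hk : Measurable (Function.uncurry k)) (σ : ℝ)
    (hsel : ∀ t n, Measurable fun v : Fin n → Pt d × ℝ => sel t (List.ofFn v)) (i j : ℕ) :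
    Measurable (obsKernel k σ sel i j) :=
  (hk.comp ((measurable_design hsel i).prodMk (measurable_design hsel j))).add_const _

theorem seqMatrix_obsKernel (k : Pt d → Pt d → ℝ) (σ : ℝ) (n : ℕ) (y : ℕ → ℝ) :
    seqMatrix (obsKernel k σ sel) n y
      = gram k (fun i : Fin n => design sel i y) + σ ^ 2 • (1 : Matrix (Fin n) (Fin n) ℝ) := by
  ext i j
  simp [seqMatrix, obsKernel, gram, Matrix.one_apply, Fin.ext_iff]

theorem border_seqMatrix_obsKernel (k : Pt d → Pt d → ℝ) (σ : ℝ) (n : ℕ) (y : ℕ → ℝ) :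
    border (seqMatrix (obsKernel k σ sel) (n + 1) y)
      = fun i : Fin n => k (design sel i y) (design sel n y) := by
  ext i
  have : (i : ℕ) ≠ n := i.2.ne
  simp [border, seqMatrix, obsKernel, this]

/-- A triggering innovation is large compared to its conditional standard deviation. -/
theorem Trigger.innovation {k : Pt d → Pt d → ℝ} {σ δB : ℝ} (hσ : 0 < σ) {n : ℕ} {y : ℕ → ℝ}
    (h : Trigger k σ δB (n + 1) (hist sel y n) (design sel n y) (y n)) :
    √(rho δB (n + 1)) * √(seqVar (obsKernel k σ sel) n y)
      < |y n - seqMean (obsKernel k σ sel) n y| := by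
  have hD := hist_eq_ofFn (sel := sel) y n
  rw [Trigger, postMean_eq k σ _ _ hD, postStd_eq k σ _ _ hD] at h
  have hV : seqVar (obsKernel k σ sel) n y = k (design sel n y) (design sel n y) -
      (fun i : Fin n => k (design sel i y) (design sel n y)) ⬝ᵥ
      (gram k (fun i : Fin n => design sel i y) + σ ^ 2 • (1 : Matrix (Fin n) (Fin n) ℝ))⁻¹ *ᵥ
      (fun i : Fin n => k (design sel i y) (design sel n y)) + σ ^ 2 := by
    rw [seqVar, schur, border_seqMatrix_obsKernel, lead_seqMatrix,
      seqMatrix_obsKernel, seqMatrix_obsKernel, Matrix.add_apply, Matrix.smul_apply,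
      Matrix.one_apply_eq, smul_eq_mul, mul_one, add_sub_right_comm]
    rfl
  rw [seqMean, border_seqMatrix_obsKernel, seqMatrix_obsKernel, hV]
  set a := k (design sel n y) (design sel n y) -
      (fun i : Fin n => k (design sel i y) (design sel n y)) ⬝ᵥ
      (gram k (fun i : Fin n => design sel i y) + σ ^ 2 • (1 : Matrix (Fin n) (Fin n) ℝ))⁻¹ *ᵥ
      (fun i : Fin n => k (design sel i y) (design sel n y))
  -- The noise bound is √ρ·σ, so the threshold is √ρ(√a + σ), at least √ρ√(a + σ²); here a + σ² is
  -- the conditional variance of the measurement.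
  have hw : wbar σ δB (n + 1) = √(rho δB (n + 1)) * σ := by
    rw [wbar, rho, mul_assoc, mul_left_comm, Real.sqrt_mul (sq_nonneg σ), Real.sqrt_sq hσ.le,
      mul_comm]
  refine lt_of_le_of_lt ?_ h
  rw [hw, ← mul_add]
  refine mul_le_mul_of_nonneg_left ?_ (Real.sqrt_nonneg _)
  refine Real.sqrt_le_iff.2 ⟨by positivity, ?_⟩
  have h0 := Real.sqrt_nonneg a
  -- No sign of the posterior variance is needed: for negative a the square root is 0.
  have h1 : a ≤ √a ^ 2 := by
    rcases le_total 0 a with ha | ha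
    · rw [Real.sq_sqrt ha]
    · exact ha.trans (sq_nonneg _)
  nlinarith [mul_nonneg h0 hσ.le]

end Design

/-! ### Probability of a trigger under slow drift -/

section TriggerProbability

open Matrix

variable {d : ℕ}

/-- The measurements of the algorithm without resets. -/
noncomputable def freeObs (sel : ℕ → Dataset d → Pt d) (f : ℕ → Pt d → ℝ) (w : ℕ → ℝ) : ℕ → ℝ :=
  solve (fun i y => f (i + 1) (design sel i y)) fun i => w (i + 1)

theorem freeObs_eq (sel : ℕ → Dataset d → Pt d) (f : ℕ → Pt d → ℝ) (w : ℕ → ℝ) (i : ℕ) :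
    freeObs sel f w i = f (i + 1) (design sel i (freeObs sel f w)) + w (i + 1) :=
  solve_eq (fun i y y' h => congrArg (f (i + 1)) (design_congr i y y' h)) _ i

variable {Ω : Type*} [MeasurableSpace Ω] {P : Measure Ω} {X : Set (Pt d)}
  {k : Pt d → Pt d → ℝ} {σ : ℝ} {g : ℕ → Ω → Pt d → ℝ} {w : ℕ → Ω → ℝ}

namespace IsModel

theorem aemeasurable_noise (h : IsModel P X k σ g w) (i : ℕ) : AEMeasurable (w (i + 1)) P :=
  (h.noise (i + 1) (by omega)).aemeasurable

theorem map_noise (h : IsModel P X k σ g w) (n : ℕ) :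
    P.map (fun ω (i : Fin n) => w (i + 1) ω)
      = Measure.pi fun _ => gaussianReal 0 (σ ^ 2).toNNReal := by
  have := h.isProbabilityMeasure
  have h1 : iIndepFun (fun (i : Fin n) ω => w (i + 1) ω) P :=
    h.noise_indep.precomp Fin.val_injective
  rw [(iIndepFun_iff_map_fun_eq_pi_map fun i : Fin n => h.aemeasurable_noise i).1 h1]
  congr 1
  ext1 i
  exact (h.noise (i + 1) (by omega)).map_eq

theorem indepFun_objective_noise (h : IsModel P X k σ g w) (ε : ℝ) {e : ℕ → Pt d}
    (he : ∀ m, e m ∈ X) (n : ℕ) :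
    IndepFun (fun ω i m => objective ε (fun t => g t ω) (i + 1) (e m))
      (fun ω (i : Fin n) => w (i + 1) ω) P := by
  choose c hc using fun i => exists_objective_eq_sum ε (i + 1)
  have e1 : (fun ω i m => objective ε (fun t => g t ω) (i + 1) (e m))
      = (fun (G : ℕ → X → ℝ) i m => ∑ l ∈ Finset.range (i + 1), c i i l * G l ⟨e m, he m⟩) ∘
        fun ω i x => g (i + 1) ω x := by
    ext ω i m
    exact hc i i (Nat.lt_succ_self i) _ _
  have e2 : (fun ω (i : Fin n) => w (i + 1) ω)
      = (fun (z : ℕ → ℝ) (i : Fin n) => z i) ∘ fun ω i => w (i + 1) ω := rfl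
  rw [e1, e2]
  refine h.gp_noise_indep.comp ?_ ?_
  · refine measurable_pi_lambda _ fun i => measurable_pi_lambda _ fun m => ?_
    refine Finset.measurable_fun_sum _ fun l _ => measurable_const.mul ?_
    exact (measurable_pi_apply _).comp (measurable_pi_apply l)
  · exact measurable_pi_lambda _ fun i => measurable_pi_apply _

theorem posDef_regularized_gram (h : IsModel P X k σ g w) (hσ : 0 < σ) {ι : Type} [Fintype ι]
    [DecidableEq ι] (p : ι → Pt d) (hp : ∀ i, p i ∈ X) :
    (gram k p + σ ^ 2 • (1 : Matrix ι ι ℝ)).PosDef :=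
  (Matrix.PosDef.one.smul (by positivity : (0 : ℝ) < σ ^ 2)).posSemidef_add (h.posSemidef_gram p hp)

/-- The density of the observations along a fixed design, compared to the time-invariant model. -/
theorem gaussDensity_observations_le (h : IsModel P X k σ g w) (hσ : 0 < σ)
    (hk1 : ∀ x ∈ X, ∀ x' ∈ X, k x x' ≤ 1) {α κ : ℝ} (h0 : 0 ≤ α) (h1 : α ≤ 1) {n : ℕ}
    (hκ : κ * σ ^ 2 = (1 - α) * (n * (n - 1) / 2)) (hκ0 : 0 ≤ κ)
    (p : Fin n → Pt d) (hp : ∀ i, p i ∈ X) (y : Fin n → ℝ) :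
    gaussDensity (gram k p ⊙ arCorr α n + σ ^ 2 • (1 : Matrix (Fin n) (Fin n) ℝ)) y
      ≤ √((1 + κ) ^ n) *
        gaussDensity ((1 + κ) • (gram k p + σ ^ 2 • (1 : Matrix (Fin n) (Fin n) ℝ))) y := by
  have hM := h.posDef_regularized_gram hσ p hp
  have hG := h.posSemidef_gram p hp
  -- The correlation matrix has unit diagonal, so the noise part is unaffected by the Hadamard
  -- product.
  have e : (gram k p + σ ^ 2 • (1 : Matrix (Fin n) (Fin n) ℝ)) ⊙ arCorr α n
      = gram k p ⊙ arCorr α n + σ ^ 2 • (1 : Matrix (Fin n) (Fin n) ℝ) := by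
    ext i j
    rcases eq_or_ne i j with rfl | hij
    · simp [arCorr, gap]
    · simp [hij]
  have hM' : (gram k p ⊙ arCorr α n + σ ^ 2 • (1 : Matrix (Fin n) (Fin n) ℝ)).PosDef :=
    (Matrix.PosDef.one.smul (by positivity : (0 : ℝ) < σ ^ 2)).posSemidef_add
      (posSemidef_hadamard_arCorr h0 h1 hG)
  refine gaussDensity_le hM hM' ?_ hκ0 (fun v => ?_) y
  · rw [← e] at hM' ⊢
    exact det_le_det_hadamard_arCorr h0 h1 hM hM'
  · have hq := quad_hadamard_arCorr_le h0 h1 (gram k p)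
      (fun i j => h.abs_kernel_le hk1 (hp i) (hp j)) v
    have h2 := hG.dotProduct_mulVec_nonneg v
    rw [star_trivial] at h2
    simp only [add_mulVec, dotProduct_add, smul_mulVec, one_mulVec, dotProduct_smul, smul_eq_mul]
    rw [← hκ] at hq
    nlinarith [mul_nonneg hκ0 h2]

/-- Without resets, the event-trigger is unlikely to be activated while the drift is small. -/
theorem measure_trigger_le (h : IsModel P X k σ g w) (hσ : 0 < σ)
    (hk1 : ∀ x ∈ X, ∀ x' ∈ X, k x x' ≤ 1) {ε : ℝ} (hε : ε ∈ Set.Icc (0 : ℝ) 1)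
    (hne : X.Nonempty) (hcont : ∀ i, ∀ᵐ ω ∂P, ContinuousOn (g (i + 1) ω) X) {β : ℕ → ℝ}
    {sel : ℕ → Dataset d → Pt d} (hsel : IsArgmaxRule X k σ β sel) (δB : ℝ) {n : ℕ} {κ : ℝ}
    (hκ : κ * σ ^ 2 = (1 - √(1 - ε)) * ((n + 1) * n / 2)) :
    P {ω | Trigger k σ δB (n + 1)
        (hist sel (freeObs sel (objective ε fun t => g t ω) fun t => w t ω) n)
        (design sel n (freeObs sel (objective ε fun t => g t ω) fun t => w t ω))
        (freeObs sel (objective ε fun t => g t ω) (fun t => w t ω) n)}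
      ≤ ENNReal.ofReal √((1 + κ) ^ (n + 1)) * gaussTail √(rho δB (n + 1) / (1 + κ)) := by
  have := h.isProbabilityMeasure
  obtain ⟨k', hk'm, hk'⟩ := h.exists_measurable_kernel hne (hcont 0)
  obtain ⟨e, he, heX⟩ := exists_dense_seq hne
  have hα0 : 0 ≤ √(1 - ε) := Real.sqrt_nonneg _
  have hα1 : √(1 - ε) ≤ 1 := Real.sqrt_le_one.2 (by linarith [hε.1])
  have hκ0 : 0 ≤ κ := by
    have : 0 ≤ κ * σ ^ 2 := by
      rw [hκ]
      exact mul_nonneg (by linarith) (by positivity)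
    exact nonneg_of_mul_nonneg_left this (by positivity)
  have hc : 0 < 1 + κ := by linarith
  have hX : ∀ i y, design sel i y ∈ X := fun i y => design_mem hsel i y
  -- All queries lie in X, so k may be replaced there by its measurable version.
  have hKK : obsKernel k σ sel = obsKernel k' σ sel := by
    ext i j y
    rw [obsKernel, obsKernel, hk' _ (hX i y) _ (hX j y)]
  have hKm : ∀ i j, Measurable (obsKernel k σ sel i j) := by
    rw [hKK]
    exact measurable_obsKernel hk'm σ hsel.measurable
  have hKp := obsKernel_congr (sel := sel) k σ
  have hpos : ∀ n y, (seqMatrix (obsKernel k σ sel) n y).PosDef := fun n y => by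
    rw [seqMatrix_obsKernel]
    exact h.posDef_regularized_gram hσ _ fun i => hX i y
  have hs : (σ ^ 2).toNNReal ≠ 0 := by
    have : 0 < σ ^ 2 := by positivity
    simpa [Real.toNNReal_eq_zero] using hσ.ne'
  set Y : Ω → ℕ → ℝ := fun ω => freeObs sel (objective ε fun t => g t ω) fun t => w t ω with hYdef
  set B : Set (Fin (n + 1) → ℝ) := {y | √(rho δB (n + 1)) *
    √(seqVar (obsKernel k σ sel) n (extend y))
      < |y (Fin.last n) - seqMean (obsKernel k σ sel) n (extend y)|} with hBdef
  have hB : MeasurableSet B :=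
    measurableSet_lt (((measurable_seqVar hKm n).comp measurable_extend).sqrt.const_mul _)
      (((measurable_pi_apply _).sub ((measurable_seqMean hKm n).comp measurable_extend)).abs)
  have hcobj : ∀ᵐ ω ∂P, ∀ i, ContinuousOn (objective ε (fun t => g t ω) (i + 1)) X := by
    filter_upwards [ae_all_iff.2 hcont] with ω hω i
    exact continuousOn_objective ε hω i
  have hsub : P {ω | Trigger k σ δB (n + 1) (hist sel (Y ω) n) (design sel n (Y ω)) (Y ω n)}
      ≤ P {ω | (fun i : Fin (n + 1) => Y ω i) ∈ B} := by
    refine measure_mono fun ω hω => ?_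
    have h1 := Trigger.innovation hσ hω
    have hext : ∀ j < n, Y ω j = extend (fun i : Fin (n + 1) => Y ω i) j := fun j hj =>
      (extend_apply (fun i : Fin (n + 1) => Y ω i) ⟨j, by omega⟩).symm
    rw [seqVar_congr hKp n _ _ hext, seqMean_congr hKp n _ _ hext] at h1
    exact h1
  have hΦ : AEMeasurable (fun ω i m => objective ε (fun t => g t ω) (i + 1) (e m)) P :=
    aemeasurable_pi_lambda _ fun i => aemeasurable_pi_lambda _ fun m =>
      (h.memLp_objective ε i (he m)).aemeasurable
  have hev : ∀ i, Measurable fun p : (ℕ → ℕ → ℝ) × (ℕ → ℝ) =>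
      denseEval e (p.1 i) (design sel i p.2) := by
    intro i
    have h1 : Measurable fun p : (ℕ → ℕ → ℝ) × (ℕ → ℝ) => (p.1 i, design sel i p.2) :=
      ((measurable_pi_apply i).comp measurable_fst).prodMk
        ((measurable_design hsel.measurable i).comp measurable_snd)
    exact (measurable_denseEval e).comp h1
  have hlaw := measure_adaptive (n := n + 1) hs
    (m := fun i φ y => denseEval e (φ i) (design sel i y))
    hev
    (fun i φ y y' hy => congrArg (denseEval e (φ i)) (design_congr i y y' hy)) hΦ
    (W := fun ω i => w (i + 1) ω) (Y := Y) (h.map_noise (n + 1))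
    (aemeasurable_pi_lambda _ fun i => h.aemeasurable_noise i)
    (h.indepFun_objective_noise ε he (n + 1))
    (by
      filter_upwards [hcobj] with ω hω i _
      rw [denseEval_eq he heX (hω i) (hX i _)]
      exact freeObs_eq _ _ _ _) hB
  rw [hlaw] at hsub
  refine hsub.trans ?_
  -- With y fixed the queries are fixed points, so averaging over ω gives the density of an ordinary
  -- Gaussian vector with covariance K ⊙ α^|i-j| + σ²I, to which the comparison of densities
  -- applies.
  have hdens : ∀ y : Fin (n + 1) → ℝ, ∫⁻ ω, ∏ i : Fin (n + 1), gaussianPDF (denseEval e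
      (fun m => objective ε (fun t => g t ω) (i + 1) (e m)) (design sel i (extend y)))
        (σ ^ 2).toNNReal (y i) ∂P
      ≤ ENNReal.ofReal √((1 + κ) ^ (n + 1)) * ENNReal.ofReal
        (gaussDensity ((1 + κ) • seqMatrix (obsKernel k σ sel) (n + 1) (extend y)) y) := by
    intro y
    have h1 : ∫⁻ ω, ∏ i : Fin (n + 1), gaussianPDF (denseEval e
      (fun m => objective ε (fun t => g t ω) (i + 1) (e m)) (design sel i (extend y)))
        (σ ^ 2).toNNReal (y i) ∂P = ∫⁻ ω, ∏ i : Fin (n + 1), gaussianPDF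
          (objective ε (fun t => g t ω) (i + 1) (design sel i (extend y)))
          (σ ^ 2).toNNReal (y i) ∂P := by
      refine lintegral_congr_ae ?_
      filter_upwards [hcobj] with ω hω
      exact Finset.prod_congr rfl fun i _ => by rw [denseEval_eq he heX (hω i) (hX i _)]
    rw [h1, lintegral_prod_gaussianPDF
      (v := fun (i : Fin (n + 1)) ω => objective ε (fun t => g t ω) (i + 1)
        (design sel i (extend y)))
      (C := gram k (fun i : Fin (n + 1) => design sel i (extend y)) ⊙ arCorr √(1 - ε) (n + 1))
      (h.hasGaussianLaw_objective ε (fun i : Fin (n + 1) => (i : ℕ)) _ fun i => hX i _)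
      (fun i => h.integral_objective ε i (hX i _))
      (fun i j => h.cov_objective hε i j (hX i _) (hX j _)) hs,
      Real.coe_toNNReal _ (sq_nonneg σ), ← ENNReal.ofReal_mul (Real.sqrt_nonneg _),
      seqMatrix_obsKernel]
    refine ENNReal.ofReal_le_ofReal
      (h.gaussDensity_observations_le hσ hk1 hα0 hα1 ?_ hκ0 _ (fun i => hX i _) y)
    rw [hκ]
    push_cast
    ring
  calc _ ≤ ∫⁻ y in B, ENNReal.ofReal √((1 + κ) ^ (n + 1)) * ENNReal.ofReal
        (gaussDensity ((1 + κ) • seqMatrix (obsKernel k σ sel) (n + 1) (extend y)) y) :=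
      lintegral_mono fun y => hdens y
    _ = _ := by
      rw [lintegral_const_mul' _ _ ENNReal.ofReal_ne_top,
        lintegral_gaussDensity_innovation hKp hKm hpos hc]

end IsModel

end TriggerProbability

/-! ### Mills' bound -/

section GaussianTail

open Filter Topology

theorem gaussTail_anti : Antitone gaussTail := fun _ _ h =>
  measure_mono fun _ hz => lt_of_le_of_lt h hz

theorem gaussianReal_Ioi_le {c : ℝ} (hc : 0 < c) :
    gaussianReal 0 1 (Set.Ioi c)
      ≤ ENNReal.ofReal ((√(2 * Real.pi))⁻¹ * (c⁻¹ * Real.exp (-c ^ 2 / 2))) := by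
  set G : ℝ → ℝ := fun z => -((√(2 * Real.pi))⁻¹ * (c⁻¹ * Real.exp (-z ^ 2 / 2))) with hG
  set G' : ℝ → ℝ := fun z => (√(2 * Real.pi))⁻¹ * (c⁻¹ * (z * Real.exp (-z ^ 2 / 2))) with hG'
  have hd : ∀ z ∈ Set.Ici c, HasDerivAt G (G' z) z := by
    intro z _
    have h1 : HasDerivAt (fun z : ℝ => -z ^ 2 / 2) (-z) z := by
      refine HasDerivAt.congr_deriv (((hasDerivAt_pow 2 z).neg).div_const 2) ?_
      push_cast
      ring
    refine HasDerivAt.congr_deriv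
      (((h1.exp).const_mul c⁻¹).const_mul (√(2 * Real.pi))⁻¹).neg ?_
    simp only [hG']
    ring
  have hpos : ∀ z ∈ Set.Ioi c, 0 ≤ G' z := fun z hz => by
    have : 0 < z := hc.trans hz
    positivity
  have hlim : Tendsto G atTop (𝓝 0) := by
    have h1 : Tendsto (fun z : ℝ => -z ^ 2 / 2) atTop atBot := by
      have := ((tendsto_pow_atTop (α := ℝ) two_ne_zero).atTop_div_const two_pos)
      refine (tendsto_neg_atTop_atBot.comp this).congr fun z => ?_
      simp only [Function.comp]
      ring
    have := (((Real.tendsto_exp_atBot.comp h1).const_mul c⁻¹).const_mul (√(2 * Real.pi))⁻¹).neg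
    rwa [mul_zero, mul_zero, neg_zero] at this
  have hint := integrableOn_Ioi_deriv_of_nonneg' hd hpos hlim
  have hval := integral_Ioi_of_hasDerivAt_of_nonneg' hd hpos hlim
  rw [gaussianReal_apply _ one_ne_zero]
  -- On (c, ∞) the factor z/c is at least 1, and with it the density has the explicit primitive G.
  calc ∫⁻ z in Set.Ioi c, gaussianPDF 0 1 z ≤ ∫⁻ z in Set.Ioi c, ENNReal.ofReal (G' z) := by
        refine setLIntegral_mono' measurableSet_Ioi fun z hz => ENNReal.ofReal_le_ofReal ?_
        have h1 : 1 ≤ c⁻¹ * z := by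
          rw [inv_mul_eq_div, one_le_div hc]
          exact le_of_lt hz
        simp only [gaussianPDFReal_def, sub_zero, NNReal.coe_one, mul_one, hG']
        rw [← mul_assoc c⁻¹]
        exact mul_le_mul_of_nonneg_left (le_mul_of_one_le_left (Real.exp_pos _).le h1)
          (by positivity)
    _ = ENNReal.ofReal (∫ z in Set.Ioi c, G' z) :=
        (ofReal_integral_eq_lintegral_ofReal hint
          ((ae_restrict_mem measurableSet_Ioi).mono hpos)).symm
    _ = _ := by rw [hval]; simp [hG]

/-- Mills' bound. -/
theorem gaussTail_le {c : ℝ} (hc : 0 < c) :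
    gaussTail c ≤ ENNReal.ofReal (√(2 / Real.pi) * (c⁻¹ * Real.exp (-c ^ 2 / 2))) := by
  have h1 : {z : ℝ | c < |z|} ⊆ Set.Ioi c ∪ (fun z => -z) ⁻¹' Set.Ioi c := by
    intro z hz
    rcases lt_abs.1 (show c < |z| from hz) with h | h
    · exact Or.inl h
    · exact Or.inr h
  have h2 : gaussianReal 0 1 ((fun z => -z) ⁻¹' Set.Ioi c) = gaussianReal 0 1 (Set.Ioi c) := by
    rw [← Measure.map_apply measurable_neg measurableSet_Ioi, gaussianReal_map_neg, neg_zero]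
  have h3 : √(2 / Real.pi) = (√(2 * Real.pi))⁻¹ + (√(2 * Real.pi))⁻¹ := by
    have : 2 / Real.pi = (2 * (√(2 * Real.pi))⁻¹) ^ 2 := by
      rw [mul_pow, inv_pow, Real.sq_sqrt (by positivity)]
      field_simp
    rw [this, Real.sqrt_sq (by positivity)]
    ring
  calc gaussTail c ≤ gaussianReal 0 1 (Set.Ioi c) + gaussianReal 0 1 (Set.Ioi c) := by
        refine (measure_mono h1).trans ((measure_union_le _ _).trans ?_)
        rw [h2]
    _ ≤ _ := by
        rw [h3, add_mul, ENNReal.ofReal_add (by positivity) (by positivity)]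
        exact add_le_add (gaussianReal_Ioi_le hc) (gaussianReal_Ioi_le hc)

/-- Mills' bound at √(2L/c), using monotonicity of the tail to replace ρ by its lower bound 2L. -/
theorem gaussTail_sqrt_le {ρ L c : ℝ} (hc : 0 < c) (hL : 0 < L) (hρ : 2 * L ≤ ρ) :
    gaussTail √(ρ / c) ≤ ENNReal.ofReal (√(c / (Real.pi * L)) * Real.exp (-L / c)) := by
  have h0 : 0 < √(2 * L / c) := Real.sqrt_pos.2 (by positivity)
  refine (gaussTail_anti (Real.sqrt_le_sqrt (div_le_div_of_nonneg_right hρ hc.le))).trans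
    ((gaussTail_le h0).trans (le_of_eq ?_))
  rw [Real.sq_sqrt (by positivity), ← Real.sqrt_inv, ← mul_assoc, ← Real.sqrt_mul (by positivity)]
  have e1 : 2 / Real.pi * (2 * L / c)⁻¹ = c / (Real.pi * L) := by field_simp
  have e2 : -(2 * L / c) / 2 = -L / c := by field_simp
  rw [e1, e2]

end GaussianTail

/-! ### Numerical estimate of the weighted trigger probabilities -/

section DriftSum

theorem log_pi_sq_div_three_ge : 1.18 ≤ Real.log (Real.pi ^ 2 / 3) := by
  rw [Real.le_log_iff_exp_le (by positivity)]
  have h1 : Real.exp 1.18 = Real.exp 1 * (Real.exp 0.09 * Real.exp 0.09) := by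
    rw [← Real.exp_add, ← Real.exp_add]
    norm_num
  have h2 : Real.exp 0.09 ≤ 1.0990 := by
    have h := Real.one_sub_le_exp_neg 0.09
    rw [Real.exp_neg] at h
    have hp := Real.exp_pos 0.09
    rw [le_inv_comm₀ (by norm_num) hp] at h
    exact h.trans (by norm_num)
  have h3 := Real.exp_one_lt_d9
  have h4 := Real.pi_gt_d4
  have h5 : Real.exp 0.09 * Real.exp 0.09 ≤ 1.0990 * 1.0990 :=
    mul_le_mul h2 h2 (Real.exp_pos _).le (by norm_num)
  rw [h1]
  have h6 : Real.exp 1 * (Real.exp 0.09 * Real.exp 0.09) ≤ 2.7182818286 * (1.0990 * 1.0990) :=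
    mul_le_mul h3.le h5 (by positivity) (by norm_num)
  nlinarith

theorem log_pi_sq_div_three_le : Real.log (Real.pi ^ 2 / 3) ≤ 1.2 := by
  rw [Real.log_le_iff_le_exp (by positivity)]
  have h1 : Real.exp 1.2 = Real.exp 1 * Real.exp 0.2 := by
    rw [← Real.exp_add]
    norm_num
  have h2 := Real.quadratic_le_exp_of_nonneg (x := 0.2) (by norm_num)
  have h3 := Real.exp_one_gt_d9
  have h4 := Real.pi_lt_d4
  have h5 := Real.pi_pos
  rw [h1]
  nlinarith

theorem log_pi_sq_mul (t : ℝ) (ht : 0 < t) :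
    Real.log (Real.pi ^ 2 * t ^ 2 / 3) = Real.log (Real.pi ^ 2 / 3) + 2 * Real.log t := by
  rw [mul_div_right_comm, Real.log_mul (by positivity) (by positivity), Real.log_pow]
  norm_num

/-- Here x stands for t/(1.4N): the weight 1 - x must absorb the growth of the density ratio as t
approaches 1.4N. The exponent is 3.087 = 1.125 · 1.4³. -/
theorem one_sub_mul_exp_cube_le {x : ℝ} (h0 : 0 ≤ x) (h1 : x ≤ 1) :
    (1 - x) * Real.exp (3.087 * x ^ 3) ≤ 1.4 := by
  have key : (1 - x) / 1.4 ≤ Real.exp (-(3.087 * x ^ 3)) := by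
    -- The linear bound e^(-u) ≥ 1 - u suffices for small x; beyond 0.6 it is recentred at u = 2.1,
    -- where e^(-2.1) ≥ 0.12.
    rcases le_total x 0.6 with h | h
    · refine le_trans ?_ (Real.one_sub_le_exp_neg _)
      rw [div_le_iff₀ (by norm_num)]
      nlinarith [mul_nonneg (mul_nonneg h0 (sub_nonneg.2 h)) (by linarith : 0 ≤ x + 0.6)]
    · have e : Real.exp (-(3.087 * x ^ 3))
          = Real.exp (-2.1) * Real.exp (-(3.087 * x ^ 3 - 2.1)) := by
        rw [← Real.exp_add]
        congr 1
        ring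
      have h2 : 0.12 ≤ Real.exp (-2.1) := by
        have h3 : Real.exp 2.1 = Real.exp 1 * Real.exp 1 * Real.exp 0.1 := by
          rw [← Real.exp_add, ← Real.exp_add]
          norm_num
        have h4 : Real.exp 0.1 ≤ 1.12 := by
          have h := Real.one_sub_le_exp_neg 0.1
          rw [Real.exp_neg] at h
          rw [le_inv_comm₀ (by norm_num) (Real.exp_pos _)] at h
          exact h.trans (by norm_num)
        have h5 := Real.exp_one_lt_d9
        have h6 : Real.exp 1 * Real.exp 1 ≤ 2.72 * 2.72 :=
          mul_le_mul (by linarith) (by linarith) (Real.exp_pos _).le (by norm_num)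
        have h7 : Real.exp 2.1 ≤ 2.72 * 2.72 * 1.12 := by
          rw [h3]
          exact mul_le_mul h6 h4 (Real.exp_pos _).le (by norm_num)
        rw [Real.exp_neg, le_inv_comm₀ (by norm_num) (Real.exp_pos _)]
        exact h7.trans (by norm_num)
      have h3 := Real.one_sub_le_exp_neg (3.087 * x ^ 3 - 2.1)
      have h4 : x ^ 3 ≤ 1 := pow_le_one₀ h0 h1
      rw [e]
      refine le_trans ?_ (mul_le_mul h2 h3 (by linarith) (Real.exp_pos _).le)
      rw [div_le_iff₀ (by norm_num)]
      nlinarith [mul_nonneg (mul_nonneg (sub_nonneg.2 h) (sub_nonneg.2 h1))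
        (by linarith : 0 ≤ x + 1.6)]
  rw [Real.exp_neg, div_le_iff₀ (by norm_num), inv_mul_eq_div, le_div_iff₀ (Real.exp_pos _)] at key
  exact key

/-- Upper bound for the probability of an activation of the event-trigger at time `t`. -/
noncomputable def triggerBound (κ : ℝ) (t : ℕ) : ℝ :=
  √((1 + κ) ^ t) * (√((1 + κ) / (Real.pi * Real.log (Real.pi ^ 2 * t ^ 2 / 3))) *
    Real.exp (-Real.log (Real.pi ^ 2 * t ^ 2 / 3) / (1 + κ)))

/-- At the first step there is no drift yet, so κ = 0. The number 0.5195 bounds 1/√(1.18π). -/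
theorem triggerBound_one_le : triggerBound 0 1 ≤ 0.5195 * (3 / Real.pi ^ 2) := by
  have hL := log_pi_sq_div_three_ge
  have hπ := Real.pi_gt_d4
  have h1 : √(1 / (Real.pi * Real.log (Real.pi ^ 2 / 3))) ≤ 0.5195 := by
    refine Real.sqrt_le_iff.2 ⟨by norm_num, ?_⟩
    rw [div_le_iff₀ (by positivity)]
    nlinarith
  have h2 : Real.exp (-Real.log (Real.pi ^ 2 / 3)) = 3 / Real.pi ^ 2 := by
    rw [Real.exp_neg, Real.exp_log (by positivity), inv_div]
  simp only [triggerBound, add_zero, pow_one, Real.sqrt_one, one_mul, Nat.cast_one, one_pow,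
    mul_one, div_one, h2]
  exact mul_le_mul_of_nonneg_right h1 (by positivity)

theorem sub_mul_triggerBound_le {N κ : ℝ} {t : ℕ} (hN : 0 < N) (ht : 2 ≤ t) (htN : t ≤ 1.4 * N)
    (hκ0 : 0 ≤ κ) (hκ : κ ≤ t * (t - 1) / N ^ 3) :
    (1.4 * N - t) * triggerBound κ t ≤ 1.4 * N * (0.6404 * (3 / Real.pi ^ 2) * (1 / (t : ℝ) ^ 2)) := by
  have ht' : (2 : ℝ) ≤ t := by exact_mod_cast ht
  have ht0 : (0 : ℝ) < t := by linarith
  have hπ := Real.pi_gt_d4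
  set L := Real.log (Real.pi ^ 2 * t ^ 2 / 3) with hL
  -- The worst case is t = 2: 1.18 + 2 log 2.
  have hLlo : 2.566 ≤ L := by
    rw [hL, log_pi_sq_mul _ ht0]
    have h1 := log_pi_sq_div_three_ge
    have h2 := Real.log_two_gt_d9
    have h3 := Real.log_le_log two_pos ht'
    linarith
  -- The tangent of the logarithm at t = 4 gives 2 log t ≤ t/2 - 2 + 4 log 2.
  have hLhi : L ≤ 1.973 + t / 2 := by
    rw [hL, log_pi_sq_mul _ ht0]
    have h1 := log_pi_sq_div_three_le
    have h2 := Real.log_two_lt_d9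
    have h3 := Real.log_le_sub_one_of_pos (by positivity : (0 : ℝ) < t / 4)
    have h4 : Real.log ((t : ℝ) / 4) = Real.log t - 2 * Real.log 2 := by
      rw [Real.log_div ht0.ne' (by norm_num), show (4 : ℝ) = 2 ^ 2 by norm_num, Real.log_pow]
      norm_num
    rw [h4] at h3
    linarith
  set x : ℝ := t / (1.4 * N) with hx
  have hx0 : 0 ≤ x := by positivity
  have hx1 : x ≤ 1 := (div_le_one (by positivity)).2 htN
  have htx : (t : ℝ) = 1.4 * N * x := by
    rw [hx]
    field_simp
  have hx3 : (t : ℝ) ^ 3 / N ^ 3 = 2.744 * x ^ 3 := by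
    rw [htx, mul_pow, mul_pow]
    field_simp
    ring
  have hx3' : x ^ 3 ≤ 1 := pow_le_one₀ hx0 hx1
  -- Since t - 1 ≤ t²/4, κ is at most 1.4³ x³/4 ≤ 2.744/4.
  have hκ1 : κ ≤ 0.686 := by
    have h1 : (t : ℝ) * (t - 1) / N ^ 3 ≤ t ^ 3 / N ^ 3 / 4 := by
      rw [div_div, div_le_div_iff₀ (by positivity) (by positivity)]
      nlinarith [mul_nonneg (mul_nonneg ht0.le (sq_nonneg ((t : ℝ) - 2)))
        (by positivity : 0 ≤ N ^ 3)]
    rw [hx3] at h1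
    linarith
  have h1 : √((1 + κ) ^ t) ≤ Real.exp (κ * t / 2) := by
    have h2 : (1 + κ) ^ t ≤ Real.exp (κ * t) := by
      rw [mul_comm, Real.exp_nat_mul]
      exact pow_le_pow_left₀ (by linarith) (by linarith [Real.add_one_le_exp κ]) t
    rw [Real.exp_half]
    exact Real.sqrt_le_sqrt h2
  have h2 : √((1 + κ) / (Real.pi * L)) ≤ 0.4574 := by
    refine Real.sqrt_le_iff.2 ⟨by norm_num, ?_⟩
    rw [div_le_iff₀ (by positivity)]
    have : 3.1415 * 2.566 ≤ Real.pi * L := mul_le_mul hπ.le hLlo (by norm_num) (by positivity)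
    nlinarith
  -- From 1/(1+κ) ≥ 1 - κ. The loss Lκ joins the density ratio exponent κt/2; both are of order
  -- t³/N³.
  have h3 : -L / (1 + κ) ≤ -L + L * κ := by
    rw [div_le_iff₀ (by linarith)]
    nlinarith [mul_nonneg (by linarith : 0 ≤ L) (sq_nonneg κ)]
  have h4 : κ * t / 2 + L * κ ≤ 3.087 * x ^ 3 := by
    have h5 : κ * t / 2 + L * κ ≤ κ * (t + 1.973) := by
      nlinarith [mul_le_mul_of_nonneg_left hLhi hκ0]
    have h6 : κ * (t + 1.973) ≤ t * (t - 1) / N ^ 3 * (t + 1.973) :=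
      mul_le_mul_of_nonneg_right hκ (by linarith)
    have h7 : (t : ℝ) * (t - 1) / N ^ 3 * (t + 1.973) ≤ 1.125 * (t ^ 3 / N ^ 3) := by
      rw [div_mul_eq_mul_div, mul_div_assoc', div_le_div_iff_of_pos_right (by positivity)]
      have h8 : ((t : ℝ) - 1) * (t + 1.973) ≤ 1.125 * t ^ 2 := by
        nlinarith [sq_nonneg ((t : ℝ) - 3.892)]
      nlinarith [mul_le_mul_of_nonneg_left h8 ht0.le]
    rw [hx3] at h7
    linarith
  have h5 : Real.exp (-L) = 3 / (Real.pi ^ 2 * t ^ 2) := by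
    rw [Real.exp_neg, hL, Real.exp_log (by positivity), inv_div]
  have h6 : triggerBound κ t ≤ 0.4574 * (3 / (Real.pi ^ 2 * t ^ 2)) * Real.exp (3.087 * x ^ 3) := by
    calc triggerBound κ t ≤ Real.exp (κ * t / 2) * (0.4574 * Real.exp (-L + L * κ)) := by
          unfold triggerBound
          gcongr
      _ = 0.4574 * Real.exp (-L) * Real.exp (κ * t / 2 + L * κ) := by
          rw [Real.exp_add, Real.exp_add]
          ring
      _ ≤ 0.4574 * (3 / (Real.pi ^ 2 * t ^ 2)) * Real.exp (3.087 * x ^ 3) := by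
          rw [h5]
          gcongr
  have h7 := one_sub_mul_exp_cube_le hx0 hx1
  have h8 : 1.4 * N - t = 1.4 * N * (1 - x) := by rw [htx]; ring
  calc (1.4 * N - t) * triggerBound κ t
      ≤ (1.4 * N - t) * (0.4574 * (3 / (Real.pi ^ 2 * t ^ 2)) * Real.exp (3.087 * x ^ 3)) :=
        mul_le_mul_of_nonneg_left h6 (by linarith)
    _ = 1.4 * N * (0.4574 * (3 / (Real.pi ^ 2 * t ^ 2))) *
        ((1 - x) * Real.exp (3.087 * x ^ 3)) := by rw [h8]; ring
    _ ≤ 1.4 * N * (0.4574 * (3 / (Real.pi ^ 2 * t ^ 2))) * 1.4 :=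
        mul_le_mul_of_nonneg_left h7 (by positivity)
    -- The constant 0.6404 is 0.4574 · 1.4 = 0.64036 rounded up.
    _ ≤ _ := by
        have : 1.4 * N * (0.6404 * (3 / Real.pi ^ 2) * (1 / (t : ℝ) ^ 2))
            - 1.4 * N * (0.4574 * (3 / (Real.pi ^ 2 * t ^ 2))) * 1.4
            = 1.4 * N * (0.00004 * (3 / (Real.pi ^ 2 * t ^ 2))) := by
          field_simp
          norm_num
        have h9 : 0 ≤ 1.4 * N * (0.00004 * (3 / (Real.pi ^ 2 * (t : ℝ) ^ 2))) := by positivity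
        linarith

theorem sum_one_div_sq_le (m : ℕ) :
    ∑ n ∈ Finset.range m, 1 / ((n + 2 : ℕ) : ℝ) ^ 2 ≤ Real.pi ^ 2 / 6 - 1 := by
  have h := sum_le_hasSum (Finset.range (m + 2)) (fun n _ => by positivity) hasSum_zeta_two
  rw [Finset.sum_range_succ', Finset.sum_range_succ'] at h
  simp only [Nat.cast_zero, zero_add, Nat.cast_one] at h
  norm_num at h ⊢
  have e : ∀ n : ℕ, ((n : ℝ) + 1 + 1) = n + 2 := fun n => by ring
  simp only [e] at h
  linarith

theorem sum_sub_mul_triggerBound_le {N : ℝ} (hN : 0 < N) {κ : ℕ → ℝ} (hκ0 : ∀ n, 0 ≤ κ n)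
    (hκ : ∀ n : ℕ, κ n ≤ (n + 1) * n / N ^ 3) :
    ∑ n ∈ Finset.range ⌊1.4 * N⌋₊, (1.4 * N - (n + 1 : ℕ)) * triggerBound (κ n) (n + 1)
      ≤ 0.4 * N := by
  have hterm : ∀ n ∈ Finset.range ⌊1.4 * N⌋₊, ((n + 1 : ℕ) : ℝ) ≤ 1.4 * N := fun n hn =>
    (Nat.le_floor_iff (by positivity)).1 (Finset.mem_range.1 hn)
  have hπ := Real.pi_gt_d4
  have hπ' := Real.pi_lt_d4
  -- With q = 3/π² the total is 1.4N(0.5195q + 0.6404(1/2 - q)). The coefficient of q is negative,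
  -- so a lower bound on q suffices; the result is just below 0.4N.
  have h3 : 0.3039 ≤ 3 / Real.pi ^ 2 := by
    rw [le_div_iff₀ (by positivity)]
    nlinarith
  rcases Nat.eq_zero_or_pos ⌊1.4 * N⌋₊ with h0 | h0
  · rw [h0]
    rw [Finset.sum_range_zero]
    positivity
  obtain ⟨m, hm⟩ : ∃ m, ⌊1.4 * N⌋₊ = m + 1 := ⟨_, (Nat.succ_pred_eq_of_pos h0).symm⟩
  rw [hm] at hterm ⊢
  rw [Finset.sum_range_succ']
  have hκ00 : κ 0 = 0 := le_antisymm (by simpa using hκ 0) (hκ0 0)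
  have hfirst : (1.4 * N - ((0 + 1 : ℕ) : ℝ)) * triggerBound (κ 0) (0 + 1)
      ≤ 1.4 * N * (0.5195 * (3 / Real.pi ^ 2)) := by
    rw [hκ00]
    refine mul_le_mul (by simp) triggerBound_one_le ?_ (by positivity)
    unfold triggerBound
    positivity
  have hrest : ∑ n ∈ Finset.range m, (1.4 * N - (n + 1 + 1 : ℕ)) *
        triggerBound (κ (n + 1)) (n + 1 + 1)
      ≤ 1.4 * N * (0.6404 * (3 / Real.pi ^ 2) * (Real.pi ^ 2 / 6 - 1)) := by
    calc _ ≤ ∑ n ∈ Finset.range m,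
        1.4 * N * (0.6404 * (3 / Real.pi ^ 2) * (1 / ((n + 2 : ℕ) : ℝ) ^ 2)) := by
          refine Finset.sum_le_sum fun n hn => ?_
          refine sub_mul_triggerBound_le hN (by omega) (hterm (n + 1) ?_) (hκ0 _) ?_
          · have := Finset.mem_range.1 hn
            exact Finset.mem_range.2 (by omega)
          · refine (hκ (n + 1)).trans (le_of_eq ?_)
            push_cast
            ring
      _ = 1.4 * N * (0.6404 * (3 / Real.pi ^ 2) *
          ∑ n ∈ Finset.range m, 1 / ((n + 2 : ℕ) : ℝ) ^ 2) := by
          rw [Finset.mul_sum, Finset.mul_sum]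
      _ ≤ _ := by
          have := sum_one_div_sq_le m
          gcongr
  have e : 0.6404 * (3 / Real.pi ^ 2) * (Real.pi ^ 2 / 6 - 1)
      = 0.6404 * (0.5 - 3 / Real.pi ^ 2) := by
    field_simp
    ring
  rw [e] at hrest
  nlinarith

end DriftSum

/-! ### From trigger probabilities to the mean activation time -/

section ActivationTime

variable {d : ℕ} {k : Pt d → Pt d → ℝ} {σ δB : ℝ} {sel : ℕ → Dataset d → Pt d}

/-- Before the first activation the algorithm and its version without resets agree, which transfers
the trigger probabilities to the activation time. -/
theorem stateAt_of_not_fires {f : ℕ → Pt d → ℝ} {w : ℕ → ℝ} {n : ℕ}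
    (h : ∀ t, 1 ≤ t → t ≤ n → ¬ (stateAt k σ δB sel f w t).Fires k σ δB sel f w t) :
    stateAt k σ δB sel f w (n + 1) = ⟨hist sel (freeObs sel f w) n, 0⟩ := by
  induction n with
  | zero => rfl
  | succ n ih =>
    have ih' := ih fun t h1 h2 => h t h1 (by omega)
    rw [stateAt, State.step, if_neg (h (n + 1) (by omega) le_rfl), ih', hist]
    simp only [State.meas, State.query]
    rw [freeObs_eq]
    rfl

theorem fires_iff_trigger {f : ℕ → Pt d → ℝ} {w : ℕ → ℝ} {n : ℕ}
    (h : ∀ t, 1 ≤ t → t ≤ n → ¬ (stateAt k σ δB sel f w t).Fires k σ δB sel f w t) :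
    (stateAt k σ δB sel f w (n + 1)).Fires k σ δB sel f w (n + 1) ↔
      Trigger k σ δB (n + 1) (hist sel (freeObs sel f w) n) (design sel n (freeObs sel f w))
        (freeObs sel f w n) := by
  rw [stateAt_of_not_fires h, State.Fires, freeObs_eq]
  rfl

theorem one_le_activationTime (f : ℕ → Pt d → ℝ) (w : ℕ → ℝ) :
    1 ≤ activationTime k σ δB sel f w :=
  le_iInf₂ fun t ht => by exact_mod_cast ht.1

open Classical in
/-- If the activation is early, then some early trigger of the algorithm without resets holds. -/
theorem le_activationTime_add_sum (f : ℕ → Pt d → ℝ) (w : ℕ → ℝ) {R : ℝ} {M : ℕ}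
    (hR : R ≤ M + 1) :
    ENNReal.ofReal R ≤ activationTime k σ δB sel f w + ∑ n ∈ Finset.range M,
      if Trigger k σ δB (n + 1) (hist sel (freeObs sel f w) n) (design sel n (freeObs sel f w))
        (freeObs sel f w n) then ENNReal.ofReal (R - (n + 1 : ℕ)) else 0 := by
  by_cases hex : ∃ n < M, (stateAt k σ δB sel f w (n + 1)).Fires k σ δB sel f w (n + 1)
  · obtain ⟨hM, hf⟩ := Nat.find_spec hex
    have hmin := fun m (hm : m < Nat.find hex) => Nat.find_min hex hm
    set n := Nat.find hex
    have hno : ∀ t, 1 ≤ t → t ≤ n → ¬ (stateAt k σ δB sel f w t).Fires k σ δB sel f w t := by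
      intro t h1 h2 h3
      obtain ⟨t, rfl⟩ := Nat.exists_eq_add_of_le' h1
      exact hmin t (by omega) ⟨by omega, h3⟩
    have h1 : ((n + 1 : ℕ) : ℝ≥0∞) ≤ activationTime k σ δB sel f w := by
      refine le_iInf₂ fun t ht => ?_
      by_contra hlt
      have hlt' : t < n + 1 := by exact_mod_cast not_le.1 hlt
      exact hno t ht.1 (by omega) ht.2
    have h2 := Finset.single_le_sum (f := fun n => if Trigger k σ δB (n + 1)
        (hist sel (freeObs sel f w) n) (design sel n (freeObs sel f w))
        (freeObs sel f w n) then ENNReal.ofReal (R - (n + 1 : ℕ)) else 0)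
      (fun _ _ => zero_le) (Finset.mem_range.2 hM)
    simp only [if_pos ((fires_iff_trigger hno).1 hf)] at h2
    refine le_trans ?_ (add_le_add h1 h2)
    rw [← ENNReal.ofReal_natCast]
    refine le_trans (le_of_eq ?_) ENNReal.ofReal_add_le
    congr 1
    ring
  -- With no firing in the first M steps, τ ≥ M + 1 ≥ R already.
  · refine le_trans ?_ le_self_add
    refine le_iInf₂ fun t ht => ?_
    obtain ⟨n, rfl⟩ := Nat.exists_eq_add_of_le' ht.1
    have hn : M ≤ n := by
      by_contra hlt
      exact hex ⟨n, not_le.1 hlt, ht.2⟩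
    rw [← ENNReal.ofReal_natCast]
    refine ENNReal.ofReal_le_ofReal (hR.trans ?_)
    push_cast
    have : (M : ℝ) ≤ n := by exact_mod_cast hn
    linarith

theorem le_lintegral_activationTime_add_sum {Ω : Type*} [MeasurableSpace Ω] (P : Measure Ω)
    [IsProbabilityMeasure P] (f : Ω → ℕ → Pt d → ℝ) (w : Ω → ℕ → ℝ) {R : ℝ} {M : ℕ}
    (hR : R ≤ M + 1) :
    ENNReal.ofReal R ≤ ∫⁻ ω, activationTime k σ δB sel (f ω) (w ω) ∂P + ∑ n ∈ Finset.range M,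
      ENNReal.ofReal (R - (n + 1 : ℕ)) * P {ω | Trigger k σ δB (n + 1)
        (hist sel (freeObs sel (f ω) (w ω)) n) (design sel n (freeObs sel (f ω) (w ω)))
        (freeObs sel (f ω) (w ω) n)} := by
  set E : ℕ → Set Ω := fun n => {ω | Trigger k σ δB (n + 1)
        (hist sel (freeObs sel (f ω) (w ω)) n) (design sel n (freeObs sel (f ω) (w ω)))
        (freeObs sel (f ω) (w ω) n)} with hE
  -- Measurable hulls of the trigger events have the same measure and make the sum measurable, so
  -- the integral is additive without measurability of the activation time.
  have hm : ∀ n, Measurable ((toMeasurable P (E n)).indicator fun _ : Ω =>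
      ENNReal.ofReal (R - (n + 1 : ℕ))) := fun n =>
    measurable_const.indicator (measurableSet_toMeasurable _ _)
  have h1 : ∑ n ∈ Finset.range M, ENNReal.ofReal (R - (n + 1 : ℕ)) * P (E n)
      = ∫⁻ ω, ∑ n ∈ Finset.range M, (toMeasurable P (E n)).indicator (fun _ : Ω =>
          ENNReal.ofReal (R - (n + 1 : ℕ))) ω ∂P := by
    rw [lintegral_finsetSum _ fun n _ => hm n]
    refine Finset.sum_congr rfl fun n _ => ?_
    rw [lintegral_indicator_const (measurableSet_toMeasurable _ _), measure_toMeasurable]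
  rw [h1, ← lintegral_add_right _ (Finset.measurable_fun_sum _ fun n _ => hm n)]
  calc ENNReal.ofReal R = ∫⁻ _, ENNReal.ofReal R ∂P := by simp
    _ ≤ _ := by
      refine lintegral_mono fun ω => ?_
      refine (le_activationTime_add_sum (k := k) (σ := σ) (δB := δB) (sel := sel) (f ω) (w ω)
        hR).trans (add_le_add le_rfl (Finset.sum_le_sum fun n _ => ?_))
      split_ifs with hT
      · rw [Set.indicator_of_mem (subset_toMeasurable P (E n) hT)]
      · exact zero_le

/-- The threshold increases as δ_B decreases, so δ_B = 1 is the extreme case. -/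
theorem two_log_le_rho (hδB : δB ∈ Set.Ioo (0 : ℝ) 1) {t : ℕ} (ht : 1 ≤ t) :
    2 * Real.log (Real.pi ^ 2 * t ^ 2 / 3) ≤ rho δB t := by
  have ht' : (0 : ℝ) < t := by exact_mod_cast ht
  have h0 := hδB.1
  refine mul_le_mul_of_nonneg_left (Real.log_le_log (by positivity) ?_) two_pos.le
  rw [piSeq, le_div_iff₀ h0]
  calc Real.pi ^ 2 * (t : ℝ) ^ 2 / 3 * δB ≤ Real.pi ^ 2 * (t : ℝ) ^ 2 / 3 * 1 :=
        mul_le_mul_of_nonneg_left hδB.2.le (by positivity)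
    _ = _ := by ring

variable {Ω : Type*} [MeasurableSpace Ω] {P : Measure Ω} {X : Set (Pt d)}
  {g : ℕ → Ω → Pt d → ℝ} {w : ℕ → Ω → ℝ}

/-- A lower bound for the mean activation time in terms of the rate of change. -/
theorem IsModel.two_le_of_mean_activationTime (h : IsModel P X k σ g w) (hσ : 0 < σ)
    (hk1 : ∀ x ∈ X, ∀ x' ∈ X, k x x' ≤ 1) {ε : ℝ} (hε : ε ∈ Set.Icc (0 : ℝ) 1)
    (hne : X.Nonempty) (hcont : ∀ i, ∀ᵐ ω ∂P, ContinuousOn (g (i + 1) ω) X) {β : ℕ → ℝ}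
    (hsel : IsArgmaxRule X k σ β sel) (hδB : δB ∈ Set.Ioo (0 : ℝ) 1) {N : ℝ} (hN : 0 < N)
    (hτ : ∫⁻ ω, activationTime k σ δB sel (objective ε fun t => g t ω) (fun t => w t ω) ∂P
      < ENNReal.ofReal N) :
    2 ≤ (σ ^ 2)⁻¹ * N ^ 3 * ε := by
  have := h.isProbabilityMeasure
  by_contra! hlt
  -- The inflation is the row-sum bound for n + 1 observations divided by the noise variance. Since
  -- 1 - √(1-ε) ≤ ε, the assumed weak drift gives κ n ≤ (n+1)n/N³.
  set κ : ℕ → ℝ := fun n => (1 - √(1 - ε)) * ((n + 1) * n / 2) / σ ^ 2 with hκdef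
  have hσ2 : 0 < σ ^ 2 := by positivity
  have hs0 : 0 ≤ 1 - √(1 - ε) := sub_nonneg.2 (Real.sqrt_le_one.2 (by linarith [hε.1]))
  have hs1 : 1 - √(1 - ε) ≤ ε := by
    have : 1 - ε ≤ √(1 - ε) := Real.le_sqrt_of_sq_le (by nlinarith [hε.1, hε.2])
    linarith
  have hκ0 : ∀ n, 0 ≤ κ n := fun n => by
    simp only [hκdef]
    positivity
  have hκ : ∀ n : ℕ, κ n ≤ (n + 1) * n / N ^ 3 := fun n => by
    have h1 : ε / σ ^ 2 ≤ 2 / N ^ 3 := by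
      rw [div_le_div_iff₀ hσ2 (by positivity)]
      have h2 : (σ ^ 2)⁻¹ * N ^ 3 * ε * σ ^ 2 = ε * N ^ 3 := by field_simp
      nlinarith
    calc κ n ≤ ε * ((n + 1) * n / 2) / σ ^ 2 := by
          simp only [hκdef]
          gcongr
      _ = (n + 1) * n / 2 * (ε / σ ^ 2) := by ring
      _ ≤ (n + 1) * n / 2 * (2 / N ^ 3) := mul_le_mul_of_nonneg_left h1 (by positivity)
      _ = _ := by ring
  have hprob : ∀ n : ℕ, P {ω | Trigger k σ δB (n + 1)
        (hist sel (freeObs sel (objective ε fun t => g t ω) fun t => w t ω) n)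
        (design sel n (freeObs sel (objective ε fun t => g t ω) fun t => w t ω))
        (freeObs sel (objective ε fun t => g t ω) (fun t => w t ω) n)}
      ≤ ENNReal.ofReal (triggerBound (κ n) (n + 1)) := fun n => by
    have hL : 0 < Real.log (Real.pi ^ 2 * ((n + 1 : ℕ) : ℝ) ^ 2 / 3) := by
      rw [log_pi_sq_mul _ (by positivity)]
      have h1 := log_pi_sq_div_three_ge
      have h2 : 0 ≤ Real.log ((n + 1 : ℕ) : ℝ) := Real.log_natCast_nonneg _
      linarith
    refine (h.measure_trigger_le hσ hk1 hε hne hcont hsel δB (κ := κ n) ?_).trans ?_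
    · simp only [hκdef]
      field_simp
    · rw [triggerBound, ENNReal.ofReal_mul (Real.sqrt_nonneg _)]
      exact mul_le_mul_right (gaussTail_sqrt_le (by linarith [hκ0 n]) hL
        (two_log_le_rho hδB (by omega))) _
  have hlow := le_lintegral_activationTime_add_sum (k := k) (σ := σ) (δB := δB) (sel := sel) P
    (fun ω => objective ε fun t => g t ω) (fun ω t => w t ω) (R := 1.4 * N)
    (M := ⌊1.4 * N⌋₊) (Nat.lt_floor_add_one _).le
  have hsum : ∑ n ∈ Finset.range ⌊1.4 * N⌋₊, ENNReal.ofReal (1.4 * N - (n + 1 : ℕ)) *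
      P {ω | Trigger k σ δB (n + 1)
        (hist sel (freeObs sel (objective ε fun t => g t ω) fun t => w t ω) n)
        (design sel n (freeObs sel (objective ε fun t => g t ω) fun t => w t ω))
        (freeObs sel (objective ε fun t => g t ω) (fun t => w t ω) n)}
      ≤ ENNReal.ofReal (0.4 * N) := by
    have hterm : ∀ n ∈ Finset.range ⌊1.4 * N⌋₊, 0 ≤ 1.4 * N - ((n + 1 : ℕ) : ℝ) := fun n hn =>
      sub_nonneg.2 ((Nat.le_floor_iff (by positivity)).1 (Finset.mem_range.1 hn))
    calc _ ≤ ∑ n ∈ Finset.range ⌊1.4 * N⌋₊,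
          ENNReal.ofReal ((1.4 * N - (n + 1 : ℕ)) * triggerBound (κ n) (n + 1)) := by
          refine Finset.sum_le_sum fun n hn => ?_
          rw [ENNReal.ofReal_mul (hterm n hn)]
          exact mul_le_mul_right (hprob n) _
      _ = ENNReal.ofReal (∑ n ∈ Finset.range ⌊1.4 * N⌋₊,
          (1.4 * N - (n + 1 : ℕ)) * triggerBound (κ n) (n + 1)) := by
          refine (ENNReal.ofReal_sum_of_nonneg fun n hn => mul_nonneg (hterm n hn) ?_).symm
          unfold triggerBound
          positivity
      _ ≤ _ := ENNReal.ofReal_le_ofReal (sum_sub_mul_triggerBound_le hN hκ0 hκ)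
  -- With R = 1.4N, the bounds E[τ] < N and 0.4N for the sum would give 1.4N < 1.4N.
  have hfin := hlow.trans_lt (ENNReal.add_lt_add_of_lt_of_le
    (ENNReal.ofReal_ne_top.lt_top.trans_le' hsum).ne hτ hsum)
  rw [← ENNReal.ofReal_add hN.le (by positivity)] at hfin
  have := (ENNReal.ofReal_lt_ofReal_iff_of_nonneg (by positivity)).1 hfin
  linarith

end ActivationTime

/-! ### The trivial regret bound and the drift term -/

section Regret

variable {d : ℕ} {k : Pt d → Pt d → ℝ} {σ δB : ℝ} {sel : ℕ → Dataset d → Pt d}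
  {X : Set (Pt d)}

theorem data_mem {β : ℕ → ℝ} (hsel : IsArgmaxRule X k σ β sel) (f : ℕ → Pt d → ℝ) (w : ℕ → ℝ)
    (n : ℕ) : ∀ p ∈ (stateAt k σ δB sel f w (n + 1)).data, p.1 ∈ X := by
  induction n with
  | zero => simp [stateAt]
  | succ n ih =>
    have hq : (stateAt k σ δB sel f w (n + 1)).query sel (n + 1) ∈ X :=
      hsel.mem _ (by omega) _ ih
    intro p hp
    rw [stateAt, State.step] at hp
    split_ifs at hp
    · rw [List.mem_singleton.1 hp]
      exact hq
    · rcases List.mem_append.1 hp with hp | hp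
      · exact ih p hp
      · rw [List.mem_singleton.1 hp]
        exact hq

theorem regret_le {β : ℕ → ℝ} (hsel : IsArgmaxRule X k σ β sel) (hne : X.Nonempty)
    {f : ℕ → Pt d → ℝ} (w : ℕ → ℝ) {T : ℕ} {L : ℝ}
    (h : ∀ t ∈ Finset.Icc 1 T, ∀ x ∈ X, |f t x| ≤ L) :
    regret X k σ δB sel f w T ≤ T * (2 * L) := by
  have hterm : ∀ t ∈ Finset.Icc 1 T,
      sSup (f t '' X) - f t (queryAt k σ δB sel f w t) ≤ 2 * L := by
    intro t ht
    obtain ⟨n, rfl⟩ := Nat.exists_eq_add_of_le' (Finset.mem_Icc.1 ht).1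
    have hq : queryAt k σ δB sel f w (n + 1) ∈ X :=
      hsel.mem _ (by omega) _ (data_mem hsel f w n)
    have h1 : sSup (f (n + 1) '' X) ≤ L := by
      refine csSup_le (hne.image _) ?_
      rintro _ ⟨x, hx, rfl⟩
      exact (abs_le.1 (h _ ht x hx)).2
    have h2 := (abs_le.1 (h _ ht _ hq)).1
    linarith
  refine (Finset.sum_le_card_nsmul _ _ _ hterm).trans (le_of_eq ?_)
  simp

theorem one_le_beta {a₁ b₁ r δ : ℝ} (ha₁ : 0 ≤ a₁) (hb₁ : 0 < b₁) (hr : 0 ≤ r)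
    (hδ : δ ∈ Set.Ioo (0 : ℝ) 1)
    (hβ : 1 ≤ d * b₁ * r * √(Real.log (5 * d * a₁ * Real.pi ^ 2 / (3 * δ)))) {T : ℕ} (hT : 1 ≤ T) :
    1 ≤ beta d a₁ b₁ r δ T := by
  have hT' : (1 : ℝ) ≤ (T : ℝ) ^ 2 := one_le_pow₀ (by exact_mod_cast hT)
  have h0 := hδ.1
  have hπ := Real.pi_gt_three
  have h1 : 1 ≤ Real.log (5 * Real.pi ^ 2 * (T : ℝ) ^ 2 / (3 * δ)) := by
    rw [Real.le_log_iff_exp_le (by positivity), le_div_iff₀ (by positivity)]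
    have h2 := Real.exp_one_lt_d9
    calc Real.exp 1 * (3 * δ) ≤ 3 * (3 * 1) := by
          have := hδ.2
          gcongr
          linarith
      _ ≤ 5 * Real.pi ^ 2 * 1 := by nlinarith
      _ ≤ _ := by gcongr
  have h2 : 0 ≤ Real.log ((T : ℝ) ^ 2 * d * b₁ * r *
      √(Real.log (5 * d * a₁ * Real.pi ^ 2 * (T : ℝ) ^ 2 / (3 * δ)))) := by
    refine Real.log_nonneg ?_
    set A := 5 * d * a₁ * Real.pi ^ 2 / (3 * δ) with hA
    have hA0 : 0 ≤ A := by positivity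
    -- If A were 0, the convention log 0 = 0 would contradict `hβ`.
    have hApos : 0 < A := by
      refine hA0.lt_of_ne fun h => ?_
      rw [← h, Real.log_zero, Real.sqrt_zero, mul_zero] at hβ
      linarith
    have e : 5 * d * a₁ * Real.pi ^ 2 * (T : ℝ) ^ 2 / (3 * δ) = A * (T : ℝ) ^ 2 := by
      rw [hA]
      ring
    rw [e]
    calc (1 : ℝ) ≤ d * b₁ * r * √(Real.log A) := hβ
      _ ≤ (T : ℝ) ^ 2 * (d * b₁ * r * √(Real.log A)) :=
          le_mul_of_one_le_left (by positivity) hT'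
      _ = (T : ℝ) ^ 2 * d * b₁ * r * √(Real.log A) := by ring
      _ ≤ _ := by
          refine mul_le_mul_of_nonneg_left (Real.sqrt_le_sqrt (Real.log_le_log hApos ?_))
            (by positivity)
          exact le_mul_of_one_le_right hA0 hT'
  rw [beta]
  have h3 : 0 ≤ 2 * (d : ℝ) * Real.log ((T : ℝ) ^ 2 * d * b₁ * r *
      √(Real.log (5 * d * a₁ * Real.pi ^ 2 * (T : ℝ) ^ 2 / (3 * δ)))) := by positivity
  linarith

/-- Under a strong drift, the last term of the regret bound dominates the range of the
objective. -/
theorem two_mul_max_le_phi {a₀ b₀ βT ε δ N : ℝ} {T : ℕ} (hb₀ : 0 ≤ b₀) (hβ : 1 ≤ βT)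
    (hN : 0 ≤ N) (hε : 0 ≤ ε) (hdrift : 2 ≤ (σ ^ 2)⁻¹ * N ^ 3 * ε) :
    2 * max 1 (b₀ * √(Real.log (5 * a₀ * Real.pi ^ 2 * (T : ℝ) ^ 2 / (2 * δ))))
      ≤ phi σ a₀ b₀ βT ε δ N T := by
  set l := b₀ * √(Real.log (5 * a₀ * Real.pi ^ 2 * (T : ℝ) ^ 2 / (2 * δ)))
  have hl : 0 ≤ l := by positivity
  have hv : 0 ≤ (σ ^ 4)⁻¹ * N ^ 3 * ε := by positivity
  have h1 : 2 ≤ 3 * √(βT * (3 * (σ ^ 2)⁻¹ + (σ ^ 4)⁻¹) * N ^ 3 * ε) := by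
    have : 1 ≤ √(βT * (3 * (σ ^ 2)⁻¹ + (σ ^ 4)⁻¹) * N ^ 3 * ε) := by
      refine Real.one_le_sqrt.2 ?_
      -- The radicand is at least 3 · 2 since β_T ≥ 1 and the drift is at least 2; radicand at least
      -- 1 already suffices.
      have h2 : βT * (3 * (σ ^ 2)⁻¹ + (σ ^ 4)⁻¹) * N ^ 3 * ε
          = βT * (3 * ((σ ^ 2)⁻¹ * N ^ 3 * ε) + (σ ^ 4)⁻¹ * N ^ 3 * ε) := by ring
      rw [h2]
      nlinarith
    linarith
  have h2 : 2 * l ≤ ((σ ^ 2)⁻¹ + (σ ^ 4)⁻¹) * N ^ 3 * ε *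
      (l + √(2 * σ ^ 2 * Real.log (5 * Real.pi ^ 2 * N ^ 2 / (6 * δ)))) := by
    have h3 := Real.sqrt_nonneg (2 * σ ^ 2 * Real.log (5 * Real.pi ^ 2 * N ^ 2 / (6 * δ)))
    refine mul_le_mul ?_ (by linarith) hl (by positivity)
    have : ((σ ^ 2)⁻¹ + (σ ^ 4)⁻¹) * N ^ 3 * ε
        = (σ ^ 2)⁻¹ * N ^ 3 * ε + (σ ^ 4)⁻¹ * N ^ 3 * ε := by ring
    linarith
  have h3 : max 1 l ≤ 1 + l := max_le (by linarith) (by linarith)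
  rw [phi]
  linarith

/-- The union bound over T steps costs 2δ/(5π²T), well below δ. The maximum with 1 puts the level in
the range of the tail hypothesis, and when log A < 0 the estimate is weaker but still true. The case
a₀ = 0 is separate because A must be positive. -/
theorem mul_tail_le {a₀ b₀ δ : ℝ} (ha₀ : 0 ≤ a₀) (hb₀ : 0 < b₀) (hδ : 0 < δ) {T : ℕ}
    (hT : 1 ≤ T) :
    T * (a₀ * Real.exp (-(max 1 (b₀ * √(Real.log (5 * a₀ * Real.pi ^ 2 * (T : ℝ) ^ 2 / (2 * δ))))
      / b₀) ^ 2)) ≤ δ := by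
  have hT' : (1 : ℝ) ≤ T := by exact_mod_cast hT
  rcases ha₀.eq_or_lt with rfl | ha
  · simpa using hδ.le
  set A := 5 * a₀ * Real.pi ^ 2 * (T : ℝ) ^ 2 / (2 * δ) with hA
  have hApos : 0 < A := by positivity
  have h1 : √(Real.log A) ≤ max 1 (b₀ * √(Real.log A)) / b₀ := by
    rw [le_div_iff₀ hb₀, mul_comm]
    exact le_max_right _ _
  have h2 : Real.log A ≤ (max 1 (b₀ * √(Real.log A)) / b₀) ^ 2 := by
    rcases le_total 0 (Real.log A) with h | h
    · exact (Real.sq_sqrt h).symm.le.trans (pow_le_pow_left₀ (Real.sqrt_nonneg _) h1 2)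
    · exact h.trans (sq_nonneg _)
  calc _ ≤ T * (a₀ * Real.exp (-Real.log A)) := by gcongr
    _ = 2 * δ / (5 * Real.pi ^ 2 * T) := by
      rw [Real.exp_neg, Real.exp_log hApos, hA]
      field_simp
    _ ≤ δ := by
      rw [div_le_iff₀ (by positivity)]
      have hπ := Real.pi_gt_three
      have : (2 : ℝ) ≤ 5 * Real.pi ^ 2 * T := by nlinarith [sq_nonneg Real.pi]
      nlinarith

end Regret

end ETGPUCB

/-! ### The regret bound -/

theorem theorem1 {Ω : Type*} [MeasurableSpace Ω] (P : Measure Ω) [IsProbabilityMeasure P]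
    (d : ℕ) (hd : 1 ≤ d) (r : ℝ) (X : Set (ETGPUCB.Pt d)) (hXne : X.Nonempty)
    (hXr : ∀ x ∈ X, ∀ i, 0 ≤ x i ∧ x i ≤ r) (hXconv : Convex ℝ X) (hXcomp : IsCompact X)
    -- kernel, noise level, rate of change
    (k : ETGPUCB.Pt d → ETGPUCB.Pt d → ℝ) (hkstat : ETGPUCB.IsStationaryOn X k)
    (hk1 : ∀ x ∈ X, ∀ x' ∈ X, k x x' ≤ 1)
    (σ : ℝ) (hσ : 0 < σ) (ε : ℝ) (hε : ε ∈ Set.Icc (0 : ℝ) 1)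
    -- the Gaussian processes and the noise
    (g : ℕ → Ω → ETGPUCB.Pt d → ℝ) (w : ℕ → Ω → ℝ) (hmodel : ETGPUCB.IsModel P X k σ g w)
    (a₀ b₀ a₁ b₁ : ℝ) (ha₀ : 0 ≤ a₀) (hb₀ : 0 < b₀) (ha₁ : 0 ≤ a₁) (hb₁ : 0 < b₁)
    (hsmooth : ∀ t, 1 ≤ t → ETGPUCB.SmoothTails P X a₀ b₀ a₁ b₁ (g t))
    -- parameters of the algorithm
    (δ : ℝ) (hδ : δ ∈ Set.Ioo (0 : ℝ) 1) (δB : ℝ) (hδB : δB ∈ Set.Ioo (0 : ℝ) 1)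
    (hδBδ : δ / 5 ≤ δB)
    (hβ : 1 ≤ d * b₁ * r * Real.sqrt (Real.log (5 * d * a₁ * Real.pi ^ 2 / (3 * δ))))
    (sel : ℕ → ETGPUCB.Dataset d → ETGPUCB.Pt d)
    (hsel : ETGPUCB.IsArgmaxRule X k σ (ETGPUCB.beta d a₁ b₁ r δ) sel)
    -- the expected activation time is finite, and `τbar` is its Markov bound
    (hτ : ∫⁻ ω, ETGPUCB.activationTime k σ δB sel
      (ETGPUCB.objective ε fun t => g t ω) (fun t => w t ω) ∂P ≠ ∞)
    (τbar : ℝ)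
    (hτbar : τbar = (∫⁻ ω, ETGPUCB.activationTime k σ δB sel
      (ETGPUCB.objective ε fun t => g t ω) (fun t => w t ω) ∂P).toReal / δ)
    (T : ℕ) (hT : 1 ≤ T) :
    P {ω | ¬ ETGPUCB.regret X k σ δB sel
          (ETGPUCB.objective ε fun t => g t ω) (fun t => w t ω) T
        ≤ ETGPUCB.regretBound X k σ a₀ b₀ (ETGPUCB.beta d a₁ b₁ r δ T) ε δ τbar T}
      ≤ ENNReal.ofReal δ := by
  have hcont : ∀ i, ∀ᵐ ω ∂P, ContinuousOn (g (i + 1) ω) X := fun i =>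
    (hsmooth (i + 1) (by omega)).ae_continuousOn
  set E := ∫⁻ ω, ETGPUCB.activationTime k σ δB sel
      (ETGPUCB.objective ε fun t => g t ω) (fun t => w t ω) ∂P with hE
  have hE1 : 1 ≤ E.toReal := by
    have : (1 : ℝ≥0∞) ≤ E := by
      calc (1 : ℝ≥0∞) = ∫⁻ _, 1 ∂P := by simp
        _ ≤ E := lintegral_mono fun ω => ETGPUCB.one_le_activationTime _ _
    simpa using ENNReal.toReal_mono hτ this
  have hδ0 := hδ.1
  have hN : 0 < τbar := by
    rw [hτbar]
    positivity
  -- Strict because E[τ] ≥ 1 is positive and δ < 1; this strictness drives the contradiction behind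
  -- the drift bound.
  have hEN : E < ENNReal.ofReal τbar := by
    rw [← ENNReal.ofReal_toReal hτ, ENNReal.ofReal_lt_ofReal_iff hN, hτbar,
      lt_div_iff₀ hδ0]
    nlinarith [hδ.2]
  have hdrift := hmodel.two_le_of_mean_activationTime hσ hk1 hε hXne hcont hsel hδB hN hEN
  have hr : 0 ≤ r := by
    obtain ⟨x, hx⟩ := hXne
    exact (hXr x hx ⟨0, hd⟩).1.trans (hXr x hx ⟨0, hd⟩).2
  have hβ1 := ETGPUCB.one_le_beta ha₁ hb₁ hr hδ hβ hT
  have hphi := ETGPUCB.two_mul_max_le_phi (a₀ := a₀) (δ := δ) (T := T) hb₀.le hβ1 hN.le hε.1 hdrift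
  have htail := ETGPUCB.mul_tail_le ha₀ hb₀ hδ0 hT
  set L := max 1 (b₀ * √(Real.log (5 * a₀ * Real.pi ^ 2 * (T : ℝ) ^ 2 / (2 * δ)))) with hL
  -- If every |f_t| stays below L, the regret is at most 2LT ≤ T·`phi`, and the remaining terms of
  -- the bound are nonnegative.
  have hsub : {ω | ¬ ETGPUCB.regret X k σ δB sel
          (ETGPUCB.objective ε fun t => g t ω) (fun t => w t ω) T
        ≤ ETGPUCB.regretBound X k σ a₀ b₀ (ETGPUCB.beta d a₁ b₁ r δ T) ε δ τbar T}
      ⊆ ⋃ i ∈ Finset.range T,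
        {ω | ∃ x ∈ X, L < |ETGPUCB.objective ε (fun t => g t ω) (i + 1) x|} := by
    intro ω hω
    by_contra hno
    simp only [Set.mem_iUnion, not_exists] at hno
    refine hω ((ETGPUCB.regret_le hsel hXne _ (L := L) fun t ht x hx => ?_).trans ?_)
    · obtain ⟨i, rfl⟩ := Nat.exists_eq_add_of_le' (Finset.mem_Icc.1 ht).1
      by_contra hlt
      exact hno i (Finset.mem_range.2 (Finset.mem_Icc.1 ht).2) ⟨x, hx, not_le.1 hlt⟩
    · have h1 := mul_le_mul_of_nonneg_left hphi (Nat.cast_nonneg (α := ℝ) T)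
      rw [ETGPUCB.regretBound]
      have h2 := Real.sqrt_nonneg (72 / Real.log (1 + (σ ^ 2)⁻¹) * T *
        ETGPUCB.beta d a₁ b₁ r δ T * (T / τbar + 1) * ETGPUCB.maxInfoGain X k σ ⌊τbar⌋₊)
      linarith
  refine (measure_mono hsub).trans ((measure_biUnion_finset_le _ _).trans ?_)
  calc ∑ i ∈ Finset.range T,
        P {ω | ∃ x ∈ X, L < |ETGPUCB.objective ε (fun t => g t ω) (i + 1) x|}
      ≤ ∑ _i ∈ Finset.range T, ENNReal.ofReal (a₀ * Real.exp (-(L / b₀) ^ 2)) :=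
        Finset.sum_le_sum fun i _ => (hmodel.sup_tail_objective hε hXne hcont i L).trans
          ((hsmooth 1 le_rfl).sup_tail L (le_max_left _ _))
    _ = ENNReal.ofReal (T * (a₀ * Real.exp (-(L / b₀) ^ 2))) := by
        rw [Finset.sum_const, Finset.card_range, nsmul_eq_mul,
          ENNReal.ofReal_mul (Nat.cast_nonneg _), ENNReal.ofReal_natCast]
    _ ≤ ENNReal.ofReal δ := ENNReal.ofReal_le_ofReal htail
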